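/- Consider splittable Capacitated Vehicle Routing on a finite tree rooted at the depot $r$: edge lengths $l(e)\in\mathbb{Z}_{\ge 0}$, integer vehicle capacity $Q\ge 1$, integer demands, where the vertices with positive demand are exactly the leaves and every leaf has demand $d(v)<Q$. For an edge $e=(u,v)$ with $u$ the parent of $v$, let $T_v$ be the subtree below $v$; the traffic is $f(e)=\lceil d(T_v)/Q\rceil$, and the lower bound is $LB=\sum_e 2\,l(e)f(e)$. A branch at $u$ is $T_v\cup\{(u,v)\}$ with stem $(u,v)$; it is a $p$-branch if its stem has traffic $p$. A nonempty $4/3$-approximate tour set is a nonempty finite family of closed walks from $r$ to $r$, each covering a positive amount, at most $Q$, of demand at vertices on it, jointly covering no more than the existing demand, whose total length is at most $4/3$ times the decrease of $LB$ caused by removing the covered demand. The safe operations are: - condense: if $f(u,v)=1$ and $v$ is not a leaf, replace $(u,v)$ and $T_v$ by one leaf edge at $u$ of length $l(u,v)+\sum_{e\in T_v}l(e)$ and demand $d(T_v)$; - unzip: if $v$ is not a leaf and $f(u,v)$ equals the sum of the traffic of the child edges $(v,w_i)$, delete $v$ and attach each $w_i$ to $u$ by an edge of length $l(u,v)+l(v,w_i)$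 (with one child this is splicing a vertex of degree two); - group: if $u$ has at least four children, among them leaves $v_1,v_2,v_3$ with $1.5Q<d(v_1)+d(v_2)+d(v_3)<2Q$, insert a new child $u'$ of $u$ by an edge of length $0$ and move $v_1,v_2,v_3$ below $u'$; - unite: merge two leaf children $v_1,v_2$ of $u$ with $d(v_1)+d(v_2)\le Q$ into one, adding their demands and their edge lengths; - slide: if $e_0=(u,v)$ has child edges $e_1=(v,w_1)$ and $(v,w_2)$, $w_1$ not a leaf, with $f(e_0)=f(e_1)$, move the branch with stem $(v,w_2)$ to $w_1$, keeping its stem length. A tree, or a branch, is simplified if no safe operation is available in it, its internal vertices have no demand, no non-root vertex has degree two, and every leaf has $0<d(v)<Q$. A $2$-chain is a simplified $2$-branch whose stem's lower end has exactly three children, all leaves, with total demand in $(1.5Q,2Q]$. For $p\ge 3$, a $p$-chain is a simplified $p$-branch with stem $(u,v)$ such that $v$ has exactly three children: the lower end of the stem of a $(p-1)$-chain, and two leaves with total demand in $(Q,1.5Q]$. All $2$-chains are long; for $p\ge 3$ a $p$-chain is long if the shorter of the two leaf edges at $v$ is strictly shorter than the path from $v$ to the depot and the $(p-1)$-chain at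 $v$ is long. Then one iteration can be carried out in polynomial time: there is a program (on a machine with unit-cost pairing, addition, subtraction and comparison) and a polynomial bounding its running time, including the size of the output, in the size of the input, such that on every such instance it outputs a tree obtained by exhaustively applying safe operations to the instance (so that no safe operation is available any more) and, moreover, either it finds a nonempty $4/3$-approximate tour set for the instance, or it outputs no tour, the obtained tree is simplified, and every branch at its root is a long $p$-chain for some $p\ge 2$ or a $1$-branch. -/

import Mathlib

/-! # Capacitated vehicle routing on rooted trees: data, lower bound, tours -/

namespace CVRP

/-- A branch: a stem edge `(u, v)` of length `len`, the demand of its lower end `v`, and the list of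
the child branches (the branches at `v`).  An instance on a tree rooted at the depot is given by the
list of the branches at the depot, together with the vehicle capacity `Q`. The order of the siblings
carries no meaning. -/
inductive Branch : Type
  | mk (len dem : ℕ) (children : List Branch) : Branch

namespace Branch

/-- Length of the stem. -/
def len : Branch → ℕ
  | mk l _ _ => l

/-- Demand located at the lower end of the stem itself. -/
def dem : Branch → ℕ
  | mk _ d _ => d

/-- The child branches. -/
def children : Branch → List Branch
  | mk _ _ cs => cs

end Branch

/-- The branch consisting of a single edge that ends in a leaf of demand `d`. -/
abbrev leaf (l d : ℕ) : Branch := Branch.mk l d []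

/-! `Branch.demand` is the total demand `d(T_v)` of a branch with stem `(u, v)`. -/
mutual
def Branch.demand : Branch → ℕ
  | .mk _ d cs => d + totalDemand cs
def totalDemand : List Branch → ℕ
  | [] => 0
  | b :: bs => b.demand + totalDemand bs
end

/-! `Branch.totalLen` is the total length of all edges of a branch, its stem included. -/
mutual
def Branch.totalLen : Branch → ℕ
  | .mk l _ cs => l + totalLength cs
def totalLength : List Branch → ℕ
  | [] => 0
  | b :: bs => b.totalLen + totalLength bs
end

/-- The traffic `⌈d(T_v) / Q⌉` of the stem `(u, v)`. -/
def Branch.traffic (Q : ℕ) (b : Branch) : ℕ := b.demand ⌈/⌉ Q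

/-! The lower bound `∑ₑ 2 · l(e) · f(e)`, over the edges of a branch, and over those of a list of
branches. -/
mutual
def Branch.lb (Q : ℕ) : Branch → ℕ
  | .mk l d cs => 2 * l * ((d + totalDemand cs) ⌈/⌉ Q) + lowerBound Q cs
def lowerBound (Q : ℕ) : List Branch → ℕ
  | [] => 0
  | b :: bs => b.lb Q + lowerBound Q bs
end

/-- A vertex is addressed by the sequence of the positions, among their siblings, of the branches
that lead to it from the depot; the depot is `[]`. -/
abbrev Vertex : Type := List ℕ

/-- The branch whose stem leads down to the given vertex (none for the depot and for addresses that
do not belong to the tree). -/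
def branchAt : List Branch → Vertex → Option Branch
  | _, [] => none
  | bs, [i] => bs[i]?
  | bs, i :: j :: a => (bs[i]?).bind fun b => branchAt b.children (j :: a)

/-- `v` is a child of `u` in the tree. -/
def IsChild (bs : List Branch) (u v : Vertex) : Prop :=
  (∃ i, v = u ++ [i]) ∧ (branchAt bs v).isSome

/-- Adjacency in the tree. -/
def Adj (bs : List Branch) (u v : Vertex) : Prop := IsChild bs u v ∨ IsChild bs v u

/-- Length of the edge from `v` to its parent. -/
def stemLen (bs : List Branch) (v : Vertex) : ℕ := ((branchAt bs v).map Branch.len).getD 0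

/-- Demand located at the vertex `v`. -/
def demandAt (bs : List Branch) (v : Vertex) : ℕ := ((branchAt bs v).map Branch.dem).getD 0

/-- Length of the edge between two adjacent vertices. -/
def edgeLen (bs : List Branch) (u v : Vertex) : ℕ :=
  if u.length < v.length then stemLen bs v else stemLen bs u

/-- A tour: the vertices in the order in which they are traversed, and the amounts of demand that
are covered at vertices. -/
structure Tour : Type where
  route : List Vertex
  served : List (Vertex × ℕ)

/-- Length of a route. -/
def routeCost (bs : List Branch) : List Vertex → ℕ
  | u :: v :: r => edgeLen bs u v + routeCost bs (v :: r)
  | _ => 0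

namespace Tour

/-- The amount of demand that the tour covers at `v`. -/
def servedAt (t : Tour) (v : Vertex) : ℕ :=
  ((t.served.filter fun x => x.1 = v).map Prod.snd).sum

/-- The amount of demand that the tour covers altogether. -/
def load (t : Tour) : ℕ := (t.served.map Prod.snd).sum

/-- The route is a closed walk in the tree from the depot to the depot, the tour covers demand only
at vertices on its route, and it covers at most `Q` units of demand. -/
structure Valid (Q : ℕ) (bs : List Branch) (t : Tour) : Prop where
  starts : t.route.head? = some []
  ends : t.route.getLast? = some []
  walk : t.route.IsChain (Adj bs)
  onRoute : ∀ x ∈ t.served, x.1 ∈ t.route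
  capacity : t.load ≤ Q

end Tour

/-- The amount of demand that a list of tours covers at `v`. -/
def covered (ts : List Tour) (v : Vertex) : ℕ := (ts.map fun t => t.servedAt v).sum

/-- Total length of a list of tours. -/
def totalCost (bs : List Branch) (ts : List Tour) : ℕ := (ts.map fun t => routeCost bs t.route).sum

/-! `removeDemand c i bs` is the list `bs`, whose entries have the positions `i, i + 1, …` among
their siblings, after `c v` units of demand have been removed at every vertex `v`. -/
mutual
def Branch.removeDemand (c : Vertex → ℕ) : Branch → Branch
  | .mk l d cs => .mk l (d - c []) (removeDemandFrom c 0 cs)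
def removeDemandFrom (c : Vertex → ℕ) (i : ℕ) : List Branch → List Branch
  | [] => []
  | b :: bs => b.removeDemand (fun a => c (i :: a)) :: removeDemandFrom c (i + 1) bs
end

/-- What remains of an instance after the tours `ts`. -/
def residual (bs : List Branch) (ts : List Tour) : List Branch :=
  removeDemandFrom (covered ts) 0 bs

/-- `ts` is a nonempty `4/3`-approximate tour set: a nonempty family of tours, each of which covers
some demand, whose total length is at most `4/3` times the reduction of the lower bound that results
from removing the covered demand. -/
structure IsApproxTourSet (Q : ℕ) (bs : List Branch) (ts : List Tour) : Prop where
  nonempty : ts ≠ []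
  valid : ∀ t ∈ ts, t.Valid Q bs
  useful : ∀ t ∈ ts, 0 < t.load
  le_demand : ∀ v, covered ts v ≤ demandAt bs v
  approx : 3 * totalCost bs ts + 4 * lowerBound Q (residual bs ts) ≤ 4 * lowerBound Q bs

/-! # Safe operations and simplified instances -/

/-- `SafeOp Q bs bs'`: one safe operation turns the tree with the branches `bs` at its root into
the tree with the branches `bs'` at its root.  The first five operations act at the root `u` of the
tree, the last clause lets them act at any other vertex. Splicing a vertex `v` of degree two is the
case of one child of `unzip`. -/
inductive SafeOp (Q : ℕ) : List Branch → List Branch → Prop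
  /-- An edge of traffic one is contracted together with everything below it. -/
  | condense {bs r : List Branch} {l d : ℕ} {cs : List Branch}
      (h : bs.Perm (.mk l d cs :: r)) (hcs : cs ≠ [])
      (hf : (Branch.mk l d cs).traffic Q = 1) :
      SafeOp Q bs (leaf (l + totalLength cs) (d + totalDemand cs) :: r)
  /-- A vertex `v` is deleted, its children are attached to its parent. -/
  | unzip {bs r : List Branch} {l : ℕ} {cs : List Branch}
      (h : bs.Perm (.mk l 0 cs :: r)) (hcs : cs ≠ [])
      (hf : (Branch.mk l 0 cs).traffic Q = (cs.map (Branch.traffic Q)).sum) :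
      SafeOp Q bs (cs.map (fun c => .mk (l + c.len) c.dem c.children) ++ r)
  /-- Three leaf children, of at least four children, are moved below a new vertex. -/
  | group {bs r : List Branch} {l₁ d₁ l₂ d₂ l₃ d₃ : ℕ}
      (h : bs.Perm (leaf l₁ d₁ :: leaf l₂ d₂ :: leaf l₃ d₃ :: r)) (hr : r ≠ [])
      (hlo : 3 * Q < 2 * (d₁ + d₂ + d₃)) (hhi : d₁ + d₂ + d₃ < 2 * Q) :
      SafeOp Q bs (.mk 0 0 [leaf l₁ d₁, leaf l₂ d₂, leaf l₃ d₃] :: r)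
  /-- Two leaf children are merged. -/
  | unite {bs r : List Branch} {l₁ d₁ l₂ d₂ : ℕ}
      (h : bs.Perm (leaf l₁ d₁ :: leaf l₂ d₂ :: r)) (hd : d₁ + d₂ ≤ Q) :
      SafeOp Q bs (leaf (l₁ + l₂) (d₁ + d₂) :: r)
  /-- The branch `b` at `v` is moved below the sibling vertex `w₁`; it is not moved below a leaf, so
  that the demand stays at the leaves. -/
  | slide {bs r : List Branch} {l d : ℕ} {cs : List Branch} {l₁ d₁ : ℕ} {cs₁ : List Branch}
      {b : Branch} {r' : List Branch}
      (h : bs.Perm (.mk l d cs :: r)) (hcs : cs.Perm (.mk l₁ d₁ cs₁ :: b :: r'))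
      (hcs₁ : cs₁ ≠ [])
      (hf : (Branch.mk l d cs).traffic Q = (Branch.mk l₁ d₁ cs₁).traffic Q) :
      SafeOp Q bs (.mk l d (.mk l₁ d₁ (b :: cs₁) :: r') :: r)
  /-- An operation at a vertex below the root. -/
  | inside {bs r : List Branch} {l d : ℕ} {cs cs' : List Branch}
      (h : bs.Perm (.mk l d cs :: r)) (hop : SafeOp Q cs cs') :
      SafeOp Q bs (.mk l d cs' :: r)

/-- No safe operation is available. -/
def Exhausted (Q : ℕ) (bs : List Branch) : Prop := ∀ bs', ¬ SafeOp Q bs bs'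

/-- `bs'` is obtained from `bs` by exhaustively applying safe operations. -/
def Simplifies (Q : ℕ) (bs bs' : List Branch) : Prop :=
  Relation.ReflTransGen (SafeOp Q) bs bs' ∧ Exhausted Q bs'

/-- The vertices with positive demand are exactly the leaves, and the demand of a leaf is less than
the capacity of a vehicle. -/
def DemandAtLeaves (Q : ℕ) (bs : List Branch) : Prop :=
  ∀ v b, branchAt bs v = some b →
    (b.children ≠ [] → b.dem = 0) ∧ (b.children = [] → 0 < b.dem ∧ b.dem < Q)

/-- Simplified: no safe operation is available, internal vertices have no demand, leaves have a
demand strictly between `0` and `Q`, and no vertex other than the root has degree two (that is,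
exactly one child). A branch `b` is simplified if `[b]` is. -/
structure Simplified (Q : ℕ) (bs : List Branch) : Prop where
  exhausted : Exhausted Q bs
  demand : DemandAtLeaves Q bs
  degree : ∀ v b, branchAt bs v = some b → b.children.length ≠ 1

/-! # Chains -/

/-- `IsChain Q p b`: the branch `b` is a `p`-chain. -/
inductive IsChain (Q : ℕ) : ℕ → Branch → Prop
  | two {b : Branch} {l₁ d₁ l₂ d₂ l₃ d₃ : ℕ}
      (hs : Simplified Q [b]) (hf : b.traffic Q = 2)
      (h : b.children.Perm [leaf l₁ d₁, leaf l₂ d₂, leaf l₃ d₃])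
      (hlo : 3 * Q < 2 * (d₁ + d₂ + d₃)) (hhi : d₁ + d₂ + d₃ ≤ 2 * Q) :
      IsChain Q 2 b
  | succ {p : ℕ} {b c : Branch} {l₁ d₁ l₂ d₂ : ℕ}
      (hs : Simplified Q [b]) (hf : b.traffic Q = p + 1)
      (h : b.children.Perm [c, leaf l₁ d₁, leaf l₂ d₂])
      (hlo : Q < d₁ + d₂) (hhi : 2 * (d₁ + d₂) ≤ 3 * Q)
      (hc : IsChain Q p c) :
      IsChain Q (p + 1) b

/-- `IsLongChain Q a p b`: the branch `b`, whose stem starts at a vertex at distance `a` from the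
depot, is a long `p`-chain. All `2`-chains are long; for `p ≥ 3` the shorter one of the two leaf
edges below the lower end `v` of the stem is shorter than the path from `v` to the depot, and the
`(p-1)`-chain below `v` is long. -/
inductive IsLongChain (Q : ℕ) : ℕ → ℕ → Branch → Prop
  | two {a : ℕ} {b : Branch} (hb : IsChain Q 2 b) : IsLongChain Q a 2 b
  | succ {a p : ℕ} {b c : Branch} {l₁ d₁ l₂ d₂ : ℕ}
      (hb : IsChain Q (p + 1) b)
      (h : b.children.Perm [c, leaf l₁ d₁, leaf l₂ d₂])
      (hl : l₂ ≤ l₁) (hlong : l₂ < a + b.len)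
      (hc : IsLongChain Q (a + b.len) p c) :
      IsLongChain Q a (p + 1) b

/-! # The machine model: first-order recursive programs on pairs and numbers

Values are binary trees of natural numbers. Programs are lists of mutually recursive functions of
one argument. Every construct costs one step; the only operations on numbers are addition,
truncated subtraction and comparison. -/

/-- Values. -/
inductive Val : Type
  | num (n : ℕ) : Val
  | pair (x y : Val) : Val

/-- Size of a value: number of nodes plus the lengths of the numbers in binary. -/
def Val.size : Val → ℕ
  | num n => 1 + Nat.size n
  | pair x y => 1 + x.size + y.size

/-- Expressions. Variables are de Bruijn indices; `call f e` calls the function number `f`. -/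
inductive Expr : Type
  | var (i : ℕ) : Expr
  | num (n : ℕ) : Expr
  | pair (e₁ e₂ : Expr) : Expr
  | fst (e : Expr) : Expr
  | snd (e : Expr) : Expr
  | add (e₁ e₂ : Expr) : Expr
  | sub (e₁ e₂ : Expr) : Expr
  | letIn (e₁ e₂ : Expr) : Expr
  | ifPair (e e₁ e₂ : Expr) : Expr
  | ifLe (e e' e₁ e₂ : Expr) : Expr
  | call (f : ℕ) (e : Expr) : Expr

/-- A program: the bodies of its functions, in which variable `0` is the argument. -/
abbrev Program : Type := List Expr

/-- `Eval P env e x t`: in the environment `env`, the expression `e` evaluates to `x` in exactly `t`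
steps. -/
inductive Eval (P : Program) : List Val → Expr → Val → ℕ → Prop
  | var {env : List Val} {i : ℕ} {x : Val} (h : env[i]? = some x) : Eval P env (.var i) x 1
  | num {env : List Val} {n : ℕ} : Eval P env (.num n) (.num n) 1
  | pair {env : List Val} {e₁ e₂ : Expr} {x₁ x₂ : Val} {t₁ t₂ : ℕ}
      (h₁ : Eval P env e₁ x₁ t₁) (h₂ : Eval P env e₂ x₂ t₂) :
      Eval P env (.pair e₁ e₂) (.pair x₁ x₂) (t₁ + t₂ + 1)
  | fst {env : List Val} {e : Expr} {x y : Val} {t : ℕ}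
      (h : Eval P env e (.pair x y) t) : Eval P env (.fst e) x (t + 1)
  | snd {env : List Val} {e : Expr} {x y : Val} {t : ℕ}
      (h : Eval P env e (.pair x y) t) : Eval P env (.snd e) y (t + 1)
  | add {env : List Val} {e₁ e₂ : Expr} {m n t₁ t₂ : ℕ}
      (h₁ : Eval P env e₁ (.num m) t₁) (h₂ : Eval P env e₂ (.num n) t₂) :
      Eval P env (.add e₁ e₂) (.num (m + n)) (t₁ + t₂ + 1)
  | sub {env : List Val} {e₁ e₂ : Expr} {m n t₁ t₂ : ℕ}
      (h₁ : Eval P env e₁ (.num m) t₁) (h₂ : Eval P env e₂ (.num n) t₂) :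
      Eval P env (.sub e₁ e₂) (.num (m - n)) (t₁ + t₂ + 1)
  | letIn {env : List Val} {e₁ e₂ : Expr} {x₁ x₂ : Val} {t₁ t₂ : ℕ}
      (h₁ : Eval P env e₁ x₁ t₁) (h₂ : Eval P (x₁ :: env) e₂ x₂ t₂) :
      Eval P env (.letIn e₁ e₂) x₂ (t₁ + t₂ + 1)
  | ifPair_pair {env : List Val} {e e₁ e₂ : Expr} {x y z : Val} {t t' : ℕ}
      (h : Eval P env e (.pair x y) t) (h' : Eval P env e₁ z t') :
      Eval P env (.ifPair e e₁ e₂) z (t + t' + 1)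
  | ifPair_num {env : List Val} {e e₁ e₂ : Expr} {n : ℕ} {z : Val} {t t' : ℕ}
      (h : Eval P env e (.num n) t) (h' : Eval P env e₂ z t') :
      Eval P env (.ifPair e e₁ e₂) z (t + t' + 1)
  | ifLe_true {env : List Val} {e e' e₁ e₂ : Expr} {m n : ℕ} {z : Val} {t t' t'' : ℕ}
      (h : Eval P env e (.num m) t) (h' : Eval P env e' (.num n) t') (hmn : m ≤ n)
      (h'' : Eval P env e₁ z t'') :
      Eval P env (.ifLe e e' e₁ e₂) z (t + t' + t'' + 1)
  | ifLe_false {env : List Val} {e e' e₁ e₂ : Expr} {m n : ℕ} {z : Val} {t t' t'' : ℕ}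
      (h : Eval P env e (.num m) t) (h' : Eval P env e' (.num n) t') (hmn : n < m)
      (h'' : Eval P env e₂ z t'') :
      Eval P env (.ifLe e e' e₁ e₂) z (t + t' + t'' + 1)
  | call {env : List Val} {f : ℕ} {e body : Expr} {x y : Val} {t t' : ℕ}
      (hf : P[f]? = some body) (h : Eval P env e x t) (h' : Eval P [x] body y t') :
      Eval P env (.call f e) y (t + t' + 1)

/-- On the input `x`, the program (that is, its function number `0`) returns `y` after exactly `t`
steps. -/
def Program.Computes (P : Program) (x y : Val) (t : ℕ) : Prop := Eval P [x] (.call 0 (.var 0)) y t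

/-! ## Encodings -/

/-- Encoding of a list. -/
def encodeList {α : Type} (enc : α → Val) : List α → Val
  | [] => .num 0
  | x :: xs => .pair (enc x) (encodeList enc xs)

mutual
def Branch.encode : Branch → Val
  | .mk l d cs => .pair (.num l) (.pair (.num d) (encodeBranches cs))
def encodeBranches : List Branch → Val
  | [] => .num 0
  | b :: bs => .pair b.encode (encodeBranches bs)
end

/-- Encoding of a vertex. -/
def encodeVertex (v : Vertex) : Val := encodeList .num v

/-- Encoding of a tour. -/
def Tour.encode (t : Tour) : Val :=
  .pair (encodeList encodeVertex t.route)
    (encodeList (fun x => .pair (encodeVertex x.1) (.num x.2)) t.served)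

/-- Encoding of the instance with capacity `Q` and the branches `bs` at the depot. -/
def encodeInstance (Q : ℕ) (bs : List Branch) : Val := .pair (.num Q) (encodeBranches bs)

/-- Encoding of an output: a modified tree and a list of tours. -/
def encodeOutput (bs : List Branch) (ts : List Tour) : Val :=
  .pair (encodeBranches bs) (encodeList Tour.encode ts)

end CVRP

set_option linter.unusedSimpArgs false

namespace CVRP

-- Simplification preserves the lower bound and never makes a tour shorter, so tours may be searched
-- for in the simplified tree and driven in the original one. To compare the two trees, every leaf
-- of the input becomes an item (address, demand). A safe operation rearranges items but keeps their
-- multiset (`HStep.collect_perm`). For a monotone subadditive `g` with `g 0 = 0`, `cost` weighs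
-- every edge with `g` of the weight below it. No safe operation lowers such a cost
-- (`HStep.cost_le`). With `g = ⌈· / Q⌉` and the uncovered demand as weight, this is half the
-- residual lower bound; with `g = min · 1` and the indicator of a set of items, it is half the
-- length of the walk through them. With the full demand as weight the cost does not grow either
-- (`HStep.cost_snd_le`). Hence a `4/3`-approximate family for the simplified tree is one for the
-- input (`result_isApprox`).
--
-- The simplification goes from the leaves upwards. At a vertex it unites or groups the least leaves
-- as long as possible, and then condenses, unzips or slides. What it establishes is `NodeOK`: the
-- demand below an inner vertex exceeds `Q`; the traffic `f` of its stem is less than the sum of the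
-- traffics of the child edges and greater than that of every child that is not a leaf; any two leaf
-- children exceed `Q` together; any three have at least `2Q` if there are four children. Each of
-- these clauses rules out one safe operation (`exhausted_of_nodeOK`).
--
-- The search also goes upwards. Consider a vertex at distance `x` from the depot whose non-leaf
-- children all start long chains, and halve all lengths. A tour costs `3x` on the path to the
-- depot, and a full load covered there is worth `4x`. Tours are found in each of these cases: - a
-- leaf has demand exactly `Q`; - there are two chains: a long `p`-chain is served by `p` tours with
-- a surplus of `2x` (`chain_spec`), and since its demand exceeds `(p - 1/2) Q`, two chains give at
-- least `p₁ + p₂ - 1` full loads, and the two surpluses pay for the missing one (`sol_two_chains`);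
-- - three leaves hold at least `2Q`: two tours that share the shortest leaf, or three separate
-- tours if that leaf is long (`sol_triple`); - two leaf edges beside a chain are both at least as
-- long as `x` (`sol_pair`). Otherwise, comparing traffics by `NodeOK` leaves only three leaves, a
-- `2`-chain, or one `(p-1)`-chain with two leaves, a long `p`-chain (`findHere_spec`). So a search
-- that fails everywhere has proved that every branch at the root is a long chain or a leaf.
--
-- The program transcribes these functions, and its steps are counted by symbolic execution. Three
-- facts keep the bounds polynomial. In a simplified tree every inner vertex has at least two
-- children, so vertices are at most twice as many as items (`nodes_add_length_le`). Traffics are at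
-- most the number of vertices of the input, so division by repeated subtraction is affordable. Edge
-- lengths may grow, but the total length is at most half the lower bound, which does not grow
-- (`resultTree_sizes`).

/-- An amount of demand at a vertex. -/
abbrev Item : Type := Vertex × ℕ

-- Trees whose demand is divided into items

/-- A branch that keeps track of the original vertices from which its demand stems. -/
inductive TBranch : Type
  | mk (len : ℕ) (its : List Item) (kids : List TBranch) : TBranch

def amount (I : List Item) : ℕ := (I.map Prod.snd).sum

/-- All items of a list of branches. -/
def collect : List TBranch → List Item
  | [] => []
  | .mk _ I cs :: r => I ++ (collect cs ++ collect r)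

def totLen : List TBranch → ℕ
  | [] => 0
  | .mk l _ cs :: r => l + totLen cs + totLen r

namespace TBranch

def len : TBranch → ℕ
  | mk l _ _ => l

def its : TBranch → List Item
  | mk _ I _ => I

def kids : TBranch → List TBranch
  | mk _ _ cs => cs

/-- The items of a branch. -/
def items : TBranch → List Item
  | mk _ I cs => I ++ collect cs

def traffic (Q : ℕ) (b : TBranch) : ℕ := amount b.items ⌈/⌉ Q

def erase : TBranch → Branch
  | mk l I cs => .mk l (amount I) (cs.map erase)

@[simp] lemma len_mk (l I cs) : (mk l I cs).len = l := rfl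
@[simp] lemma its_mk (l I cs) : (mk l I cs).its = I := rfl
@[simp] lemma kids_mk (l I cs) : (mk l I cs).kids = cs := rfl
@[simp] lemma items_mk (l I cs) : (mk l I cs).items = I ++ collect cs := rfl
@[simp] lemma erase_mk (l I cs) : (mk l I cs).erase = .mk l (amount I) (cs.map erase) := by
  rw [erase]

end TBranch

open TBranch

/-- The sum of the lengths of the edges, each of them weighted with `g` of the weight below it. -/
def cost (g : ℕ → ℕ) (wt : Item → ℕ) : List TBranch → ℕ
  | [] => 0
  | .mk l I cs :: r => l * g ((I ++ collect cs).map wt).sum + cost g wt cs + cost g wt r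

/-- All branches at all depths satisfy `p`. -/
def AllSub (p : TBranch → Prop) : List TBranch → Prop
  | [] => True
  | .mk l I cs :: r => p (.mk l I cs) ∧ AllSub p cs ∧ AllSub p r

def trafficSum (Q : ℕ) (F : List TBranch) : ℕ := (F.map (traffic Q)).sum

/-- This is what `unzip` does to the children of the vertex that it deletes. -/
def addLen (l : ℕ) : List TBranch → List TBranch
  | [] => []
  | .mk l' I cs :: r => .mk (l + l') I cs :: addLen l r

/-- A single recursion replaces the mutual one on branches and lists of branches: it descends to the
children of the first branch and to its later siblings. -/
theorem forest_induction {P : List TBranch → Prop} (nil : P [])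
    (cons : ∀ l I cs r, P cs → P r → P (.mk l I cs :: r)) : ∀ F, P F
  | [] => nil
  | .mk l I cs :: r =>
    cons l I cs r (forest_induction nil cons cs) (forest_induction nil cons r)

-- Demand, length and cost of a list of branches, up to the order of siblings

@[simp] lemma amount_nil : amount [] = 0 := rfl
@[simp] lemma amount_cons (x : Item) (I : List Item) : amount (x :: I) = x.2 + amount I := by
  simp [amount]
@[simp] lemma amount_append (I J : List Item) : amount (I ++ J) = amount I + amount J := by
  simp [amount]
lemma _root_.List.Perm.amount_eq {I J : List Item} (h : I.Perm J) : amount I = amount J :=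
  (h.map _).sum_eq

@[simp] lemma collect_nil : collect [] = [] := by rw [collect]
@[simp] lemma collect_cons (b : TBranch) (r) : collect (b :: r) = b.items ++ collect r := by
  cases b; simp [collect]
lemma collect_eq (F : List TBranch) : collect F = F.flatMap items := by
  induction F with
  | nil => simp
  | cons b r ih => simp [ih]
@[simp] lemma collect_append (F G : List TBranch) : collect (F ++ G) = collect F ++ collect G := by
  simp [collect_eq]
lemma _root_.List.Perm.collect {F G : List TBranch} (h : F.Perm G) :
    (collect F).Perm (collect G) := by
  simpa [collect_eq] using h.flatMap_right _

@[simp] lemma totLen_nil : totLen [] = 0 := by rw [totLen]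
@[simp] lemma totLen_cons (b : TBranch) (r) :
    totLen (b :: r) = b.len + totLen b.kids + totLen r := by
  cases b; simp [totLen]

@[simp] lemma cost_nil (g wt) : cost g wt [] = 0 := by rw [cost]
lemma cost_cons (g wt) (b : TBranch) (r) : cost g wt (b :: r) =
    b.len * g (b.items.map wt).sum + cost g wt b.kids + cost g wt r := by
  cases b; rw [cost]; simp
@[simp] lemma cost_mk (g wt) (l I cs r) : cost g wt (.mk l I cs :: r) =
    l * g ((I.map wt).sum + ((collect cs).map wt).sum) + cost g wt cs + cost g wt r := by
  rw [cost]; simp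
@[simp] lemma cost_append (g wt) (F G : List TBranch) :
    cost g wt (F ++ G) = cost g wt F + cost g wt G := by
  induction F with
  | nil => simp
  | cons b r ih => simp [cost_cons, ih]; ring
lemma _root_.List.Perm.cost_eq {F G : List TBranch} (h : F.Perm G) (g wt) :
    cost g wt F = cost g wt G := by
  induction h with
  | nil => rfl
  | cons x _ ih => simp [cost_cons, ih]
  | swap x y l => simp [cost_cons]; ring
  | trans _ _ h₁ h₂ => rw [h₁, h₂]

@[simp] lemma AllSub_nil (p) : AllSub p [] := by rw [AllSub]; trivial
@[simp] lemma AllSub_cons (p) (b : TBranch) (r) :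
    AllSub p (b :: r) ↔ p b ∧ AllSub p b.kids ∧ AllSub p r := by
  cases b; rw [AllSub]; simp
lemma AllSub_iff (p) (F : List TBranch) : AllSub p F ↔ ∀ b ∈ F, p b ∧ AllSub p b.kids := by
  induction F with
  | nil => simp
  | cons b r ih => rw [AllSub_cons, ih, List.forall_mem_cons, and_assoc]
@[simp] lemma AllSub_append (p) (F G : List TBranch) :
    AllSub p (F ++ G) ↔ AllSub p F ∧ AllSub p G := by
  rw [AllSub_iff, AllSub_iff p F, AllSub_iff p G]
  simp only [List.mem_append]
  exact ⟨fun h => ⟨fun b hb => h b (.inl hb), fun b hb => h b (.inr hb)⟩,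
    fun h b hb => hb.elim (h.1 b) (h.2 b)⟩
lemma _root_.List.Perm.allSub_iff {F G : List TBranch} (h : F.Perm G) (p) :
    AllSub p F ↔ AllSub p G := by
  rw [AllSub_iff, AllSub_iff p G]
  simp only [h.mem_iff]

@[simp] lemma trafficSum_nil (Q) : trafficSum Q [] = 0 := rfl
@[simp] lemma trafficSum_cons (Q) (b : TBranch) (r) :
    trafficSum Q (b :: r) = b.traffic Q + trafficSum Q r := by
  simp [trafficSum]
lemma _root_.List.Perm.trafficSum_eq {F G : List TBranch} (h : F.Perm G) (Q) :
    trafficSum Q F = trafficSum Q G := (h.map _).sum_eq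

@[simp] lemma addLen_nil (l) : addLen l [] = [] := rfl
lemma addLen_eq (l : ℕ) (F : List TBranch) :
    addLen l F = F.map fun b => .mk (l + b.len) b.its b.kids := by
  induction F with
  | nil => rfl
  | cons b r ih => cases b; simp [addLen, ih]
@[simp] lemma collect_addLen (l : ℕ) (F : List TBranch) : collect (addLen l F) = collect F := by
  induction F with
  | nil => rfl
  | cons b r ih => cases b; simp [addLen, ih]

lemma items_eq (b : TBranch) : b.items = b.its ++ collect b.kids := by cases b; rfl

/-! ## Erasing the items -/

lemma demand_erase (F : List TBranch) : totalDemand (F.map erase) = amount (collect F) := by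
  induction F using forest_induction with
  | nil => simp [totalDemand]
  | cons l I cs r h₁ h₂ =>
    simp [totalDemand, Branch.demand, h₁, h₂]; ring

lemma totLen_erase (F : List TBranch) : totalLength (F.map erase) = totLen F := by
  induction F using forest_induction with
  | nil => simp [totalLength]
  | cons l I cs r h₁ h₂ => simp [totalLength, Branch.totalLen, h₁, h₂]

lemma traffic_erase (Q : ℕ) (b : TBranch) : b.erase.traffic Q = b.traffic Q := by
  cases b; simp [Branch.traffic, TBranch.traffic, Branch.demand, demand_erase]

lemma lowerBound_erase (Q : ℕ) (F : List TBranch) :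
    lowerBound Q (F.map erase) = 2 * cost (· ⌈/⌉ Q) Prod.snd F := by
  induction F using forest_induction with
  | nil => simp [lowerBound]
  | cons l I cs r h₁ h₂ =>
    simp [lowerBound, Branch.lb, h₁, h₂, demand_erase]
    simp only [amount]; ring

/-! ## Safe operations -/

/-- A safe operation turns `F` into `B ++ r`, where the branches `B` are new. -/
inductive HStep (Q : ℕ) : List TBranch → List TBranch → List TBranch → Prop
  | condense {F r : List TBranch} {l : ℕ} {cs : List TBranch}
      (h : F.Perm (.mk l [] cs :: r)) (hcs : cs ≠ [])
      (hf : amount (collect cs) ⌈/⌉ Q = 1) :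
      HStep Q F [.mk (l + totLen cs) (collect cs) []] r
  | unzip {F r : List TBranch} {l : ℕ} {cs : List TBranch}
      (h : F.Perm (.mk l [] cs :: r)) (hcs : cs ≠ [])
      (hf : amount (collect cs) ⌈/⌉ Q = trafficSum Q cs) :
      HStep Q F (addLen l cs) r
  | group {F r : List TBranch} {l₁ l₂ l₃ : ℕ} {I₁ I₂ I₃ : List Item}
      (h : F.Perm (.mk l₁ I₁ [] :: .mk l₂ I₂ [] :: .mk l₃ I₃ [] :: r)) (hr : r ≠ [])
      (hlo : 3 * Q < 2 * (amount I₁ + amount I₂ + amount I₃))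
      (hhi : amount I₁ + amount I₂ + amount I₃ < 2 * Q) :
      HStep Q F [.mk 0 [] [.mk l₁ I₁ [], .mk l₂ I₂ [], .mk l₃ I₃ []]] r
  | unite {F r : List TBranch} {l₁ l₂ : ℕ} {I₁ I₂ : List Item}
      (h : F.Perm (.mk l₁ I₁ [] :: .mk l₂ I₂ [] :: r)) (hd : amount I₁ + amount I₂ ≤ Q) :
      HStep Q F [.mk (l₁ + l₂) (I₁ ++ I₂) []] r
  | slide {F r : List TBranch} {l : ℕ} {cs : List TBranch} {l₁ : ℕ} {cs₁ : List TBranch}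
      {b : TBranch} {r' : List TBranch}
      (h : F.Perm (.mk l [] cs :: r)) (hcs : cs.Perm (.mk l₁ [] cs₁ :: b :: r'))
      (hcs₁ : cs₁ ≠ []) (hf : amount (collect cs) ⌈/⌉ Q = amount (collect cs₁) ⌈/⌉ Q) :
      HStep Q F [.mk l [] (.mk l₁ [] (b :: cs₁) :: r')] r
  | inside {F r : List TBranch} {l : ℕ} {I : List Item} {cs B s : List TBranch}
      (h : F.Perm (.mk l I cs :: r)) (hop : HStep Q cs B s) :
      HStep Q F [.mk l I (B ++ s)] r

/-- Operations are local: siblings may be added and the untouched ones reordered. For this purpose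
`HStep` keeps the new branches apart from the rest. Only `group` looks at the rest, and additional
siblings cannot make it empty. -/
lemma HStep.context {Q : ℕ} {F B r : List TBranch} (h : HStep Q F B r) {F' ctx r' : List TBranch}
    (hF : F'.Perm (F ++ ctx)) (hr : r'.Perm (r ++ ctx)) : HStep Q F' B r' := by
  have key : ∀ {A : List TBranch}, F.Perm (A ++ r) → F'.Perm (A ++ r') := fun {A} h =>
    hF.trans ((h.append_right ctx).trans (by
      rw [List.append_assoc]; exact hr.symm.append_left A))
  cases h with
  | condense h hcs hf => exact .condense (key (A := [_]) h) hcs hf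
  | unzip h hcs hf => exact .unzip (key (A := [_]) h) hcs hf
  | group h hn hlo hhi =>
    refine .group (key (A := [_, _, _]) h) ?_ hlo hhi
    rintro rfl
    have := hr.length_eq
    simp at this
    exact hn (List.length_eq_zero_iff.1 (by omega))
  | unite h hd => exact .unite (key (A := [_, _]) h) hd
  | slide h hcs hcs₁ hf => exact .slide (key (A := [_]) h) hcs hcs₁ hf
  | inside h hop => exact .inside (key (A := [_]) h) hop

lemma erase_addLen (l : ℕ) (cs : List TBranch) : (addLen l cs).map erase =
    (cs.map erase).map fun c => .mk (l + c.len) c.dem c.children := by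
  rw [addLen_eq, List.map_map, List.map_map]
  refine List.map_congr_left fun b _ => ?_
  cases b; simp [Branch.len, Branch.dem, Branch.children]

lemma trafficSum_erase (Q : ℕ) (cs : List TBranch) :
    ((cs.map erase).map (Branch.traffic Q)).sum = trafficSum Q cs := by
  rw [List.map_map, trafficSum]
  exact congrArg _ (List.map_congr_left fun b _ => traffic_erase Q b)

lemma HStep.safeOp {Q : ℕ} {F B r : List TBranch} (h : HStep Q F B r) :
    SafeOp Q (F.map erase) ((B ++ r).map erase) := by
  induction h with
  | @condense F r l cs h hcs hf =>
    have := SafeOp.condense (Q := Q) (by simpa using h.map erase) (by simpa using hcs)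
      (by simpa [Branch.traffic, Branch.demand, demand_erase] using hf)
    simpa [totLen_erase, demand_erase] using this
  | @unzip F r l cs h hcs hf =>
    have := SafeOp.unzip (Q := Q) (by simpa using h.map erase) (by simpa using hcs)
      (by rw [trafficSum_erase]; simpa [Branch.traffic, Branch.demand, demand_erase] using hf)
    rw [List.map_append, erase_addLen]
    exact this
  | group h hn hlo hhi =>
    have := SafeOp.group (Q := Q) (by simpa using h.map erase) (by simpa using hn) hlo hhi
    simpa using this
  | unite h hd =>
    have := SafeOp.unite (Q := Q) (by simpa using h.map erase) hd
    simpa using this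
  | @slide F r l cs l₁ cs₁ b r' h hcs hcs₁ hf =>
    have := SafeOp.slide (Q := Q) (by simpa using h.map erase) (by simpa using hcs.map erase)
      (by simpa using hcs₁) (by simpa [Branch.traffic, Branch.demand, demand_erase] using hf)
    simpa using this
  | inside h hop ih =>
    have := SafeOp.inside (by simpa using h.map erase) ih
    simpa using this

lemma HStep.collect_perm {Q : ℕ} {F B r : List TBranch} (h : HStep Q F B r) :
    (collect F).Perm (collect (B ++ r)) := by
  induction h with
  | condense h hcs hf => simpa using h.collect
  | unzip h hcs hf => simpa using h.collect
  | group h hn hlo hhi => simpa using h.collect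
  | unite h hd => simpa using h.collect
  | @slide F r l cs l₁ cs₁ b r' h hcs hcs₁ hf =>
    refine h.collect.trans ?_
    have h2 := hcs.collect
    simp only [collect_cons, items_mk, List.nil_append, List.cons_append,
      List.append_assoc] at h2 ⊢
    refine (h2.append_right _).trans ?_
    simp only [← List.append_assoc]
    exact (List.perm_append_comm.append_right _).append_right _
  | inside h hop ih =>
    refine h.collect.trans ?_
    simp only [collect_cons, items_mk, List.cons_append, List.nil_append, List.append_assoc,
      collect_append] at ih ⊢
    refine List.Perm.append_left _ ?_
    simpa using ih.append_right _

-- Invariants of the safe operations: demand at the leaves and the lower bound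

/-- Demand is at the leaves, and at most the capacity. -/
def LeafOK (Q : ℕ) (b : TBranch) : Prop :=
  (b.kids = [] → 0 < amount b.its ∧ amount b.its ≤ Q) ∧ (b.kids ≠ [] → b.its = [])

lemma ceilDiv_eq_one_iff {Q n : ℕ} (hQ : 0 < Q) : n ⌈/⌉ Q = 1 ↔ 0 < n ∧ n ≤ Q := by
  have h1 : n ⌈/⌉ Q ≤ 1 ↔ n ≤ Q := by rw [ceilDiv_le_iff_le_mul hQ, mul_one]
  have h0 : n ⌈/⌉ Q ≤ 0 ↔ n ≤ 0 := by rw [ceilDiv_le_iff_le_mul hQ, mul_zero]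
  omega

lemma collect_ne_nil {Q : ℕ} {F : List TBranch} (h : AllSub (LeafOK Q) F) (hF : F ≠ []) :
    0 < amount (collect F) := by
  induction F using forest_induction with
  | nil => simp at hF
  | cons l I cs r h1 h2 =>
    simp only [AllSub_cons, kids_mk] at h
    by_cases hcs : cs = []
    · have := (h.1.1 hcs).1
      simp at this ⊢
      omega
    · have := h1 h.2.1 hcs
      simp
      omega
-- The strict bound `< Q` of the input is not an invariant: `condense` and `unite` may create a leaf
-- of demand exactly `Q`. Such leaves are left to the search for tours.
lemma HStep.leafOK {Q : ℕ} (hQ : 0 < Q) {F B r : List TBranch} (h : HStep Q F B r) :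
    AllSub (LeafOK Q) F → AllSub (LeafOK Q) (B ++ r) := by
  induction h with
  | condense h hcs hf =>
    rw [h.allSub_iff]
    rw [ceilDiv_eq_one_iff hQ] at hf
    simp only [List.cons_append, List.nil_append, AllSub_cons, kids_mk]
    rintro ⟨_, _, h3⟩
    exact ⟨by simpa [LeafOK] using hf, by simp, h3⟩
  | @unzip F r l cs h hcs hf =>
    rw [h.allSub_iff]
    simp only [AllSub_cons, kids_mk, AllSub_append]
    rintro ⟨_, h2, h3⟩
    refine ⟨?_, h3⟩
    rw [AllSub_iff] at h2 ⊢
    rw [addLen_eq]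
    intro b hb
    obtain ⟨c, hc, rfl⟩ := List.mem_map.1 hb
    simpa [LeafOK] using h2 c hc
  | group h hn hlo hhi =>
    rw [h.allSub_iff]
    simp [LeafOK]
    tauto
  | unite h hd =>
    rw [h.allSub_iff]
    simp only [AllSub_cons, kids_mk, List.cons_append, List.nil_append, AllSub_nil]
    rintro ⟨h1, -, h2, -, h3⟩
    have := (h1.1 rfl).1
    simp only [its_mk] at this
    exact ⟨by simp [LeafOK]; omega, trivial, h3⟩
  | @slide F r l cs l₁ cs₁ b r' h hcs hcs₁ hf =>
    rw [h.allSub_iff]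
    simp only [List.cons_append, List.nil_append, AllSub_cons, kids_mk, hcs.allSub_iff]
    rintro ⟨h1, ⟨h2, h3, h4, h5, h6⟩, h7⟩
    exact ⟨by simp [LeafOK], ⟨by simp [LeafOK], ⟨h4, h5, h3⟩, h6⟩, h7⟩
  | @inside F r l I cs B s h hop ih =>
    rw [h.allSub_iff]
    simp only [List.cons_append, List.nil_append, AllSub_cons, kids_mk]
    rintro ⟨h1, h2, h3⟩
    refine ⟨⟨?_, ?_⟩, ih h2, h3⟩
    · intro hk
      by_contra
      -- An operation needs a branch to act on, so `cs` is nonempty and has positive demand. This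
      -- demand persists, so the new list of children cannot be empty.
      have h4 : cs ≠ [] := by
        rintro rfl
        cases hop <;> simp_all
      have := collect_ne_nil h2 h4
      simp only [kids_mk] at hk
      rw [hop.collect_perm.amount_eq, hk] at this
      simp at this
    · intro _
      refine h1.2 ?_
      intro hk
      simp only [kids_mk] at hk
      subst hk
      cases hop <;> simp_all

/-- Monotone, subadditive, and zero at zero. -/
structure Subadd (g : ℕ → ℕ) : Prop where
  mono : Monotone g
  add_le : ∀ a b, g (a + b) ≤ g a + g b
  zero : g 0 = 0

lemma subadd_ceilDiv {Q : ℕ} (hQ : 0 < Q) : Subadd (· ⌈/⌉ Q) where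
  mono a b h := by
    rw [ceilDiv_le_iff_le_mul hQ]
    exact h.trans ((ceilDiv_le_iff_le_mul hQ).1 le_rfl)
  add_le a b := by
    rw [ceilDiv_le_iff_le_mul hQ, mul_add]
    exact add_le_add ((ceilDiv_le_iff_le_mul hQ).1 le_rfl) ((ceilDiv_le_iff_le_mul hQ).1 le_rfl)
  zero := by simp

lemma subadd_min : Subadd (min · 1) where
  mono a b h := min_le_min_right _ h
  add_le a b := by
    show min (a + b) 1 ≤ min a 1 + min b 1
    omega
  zero := rfl

/-- No edge has more weight below it than the whole list. This settles `condense`, where a single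
edge with the entire weight below it takes over all the lengths. -/
lemma cost_le_totLen {g : ℕ → ℕ} (hg : Subadd g) (wt) (F : List TBranch) :
    cost g wt F ≤ totLen F * g ((collect F).map wt).sum := by
  induction F using forest_induction with
  | nil => simp
  | cons l I cs r h1 h2 =>
    simp only [cost_mk, totLen_cons, len_mk, kids_mk, collect_cons, items_mk, List.map_append,
      List.sum_append, add_mul]
    refine add_le_add (add_le_add ?_ (h1.trans ?_)) (h2.trans ?_) <;>
    exact Nat.mul_le_mul_left _ (hg.mono (by omega))

/-- The common stem, weighted once with `g` of the total, is replaced by one copy for each child,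
weighted with `g` of its part. Subadditivity compares the two. -/
lemma cost_addLen {g : ℕ → ℕ} (hg : Subadd g) (wt) (l : ℕ) (F : List TBranch) :
    l * g ((collect F).map wt).sum + cost g wt F ≤ cost g wt (addLen l F) := by
  induction F with
  | nil => simp [hg.zero]
  | cons b r ih =>
    cases b with | mk l' I cs =>
    simp only [addLen, cost_mk, collect_cons, items_mk, List.map_append, List.sum_append]
    have := Nat.mul_le_mul_left l (hg.add_le ((I.map wt).sum + ((collect cs).map wt).sum)
      ((collect r).map wt).sum)
    rw [add_mul]
    rw [mul_add] at this
    omega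

/-- Every operation lets some edges have more weight below them (`condense`, `unite`, `slide`), or
replaces an edge by copies over the parts of its weight (`unzip`), or adds an edge of length zero
(`group`). As `wt` is arbitrary, this applies both to the uncovered demand and to the indicator of a
tour. -/
lemma HStep.cost_le {Q : ℕ} {g : ℕ → ℕ} (hg : Subadd g) (wt) {F B r : List TBranch}
    (h : HStep Q F B r) : cost g wt F ≤ cost g wt (B ++ r) := by
  induction h with
  | @condense F r l cs h hcs hf =>
    rw [h.cost_eq]
    have := cost_le_totLen hg wt cs
    simp [add_mul]
    omega
  | @unzip F r l cs h hcs hf =>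
    rw [h.cost_eq]
    have := cost_addLen hg wt l cs
    simp
    omega
  | group h hn hlo hhi =>
    rw [h.cost_eq]
    simp
    omega
  | @unite F r l₁ l₂ I₁ I₂ h hd =>
    rw [h.cost_eq]
    simp only [cost_mk, List.cons_append, List.nil_append, List.map_append, List.sum_append,
      collect_nil, List.map_nil, List.sum_nil, cost_nil, add_mul, add_zero]
    have := Nat.mul_le_mul_left l₁ (hg.mono (Nat.le_add_right (I₁.map wt).sum (I₂.map wt).sum))
    have := Nat.mul_le_mul_left l₂ (hg.mono (Nat.le_add_left (I₂.map wt).sum (I₁.map wt).sum))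
    omega
  | @slide F r l cs l₁ cs₁ b r' h hcs hcs₁ hf =>
    rw [h.cost_eq]
    have h2 : ((collect (mk l₁ [] (b :: cs₁) :: r')).map wt).sum = ((collect cs).map wt).sum := by
      rw [(hcs.collect.map wt).sum_eq]
      simp; ring
    have h3 := Nat.mul_le_mul_left l₁ (hg.mono (Nat.le_add_left ((collect cs₁).map wt).sum
      (b.items.map wt).sum))
    have e := hcs.cost_eq g wt
    rw [cost_mk, cost_cons g wt b r'] at e
    rw [List.cons_append, List.nil_append, cost_mk, cost_mk, cost_mk, h2, e, cost_cons g wt b cs₁]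
    simp only [List.map_nil, List.sum_nil, collect_cons, List.map_append, List.sum_append,
      zero_add]
    omega
  | @inside F r l I cs B s h hop ih =>
    rw [h.cost_eq, List.cons_append, List.nil_append, cost_mk, cost_mk,
      (hop.collect_perm.map wt).sum_eq]
    omega

/-- There is positive demand below every edge, so its traffic is at least one. The estimate serves
twice: for `condense`, and for the sizes of the lengths in the output. -/
lemma totLen_le_cost {Q : ℕ} (hQ : 0 < Q) {F : List TBranch} (hF : AllSub (LeafOK Q) F) :
    totLen F ≤ cost (· ⌈/⌉ Q) Prod.snd F := by
  induction F using forest_induction with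
  | nil => simp
  | cons l I cs r h1 h2 =>
    simp only [AllSub_cons, kids_mk] at hF
    have h0 : 0 < amount (I ++ collect cs) := by
      have := collect_ne_nil (F := [.mk l I cs]) (Q := Q) (by simpa using ⟨hF.1, hF.2.1⟩)
        (by simp)
      simpa using this
    have h3 : 0 < amount (I ++ collect cs) ⌈/⌉ Q := by
      by_contra h
      have : amount (I ++ collect cs) ⌈/⌉ Q ≤ 0 := by omega
      rw [ceilDiv_le_iff_le_mul hQ] at this
      omega
    have h4 := Nat.mul_le_mul_left l (show 1 ≤ _ from h3)
    simp only [amount, List.map_append, List.sum_append] at h4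
    simp only [cost_mk, totLen_cons, len_mk, kids_mk]
    have := h1 hF.2.1
    have := h2 hF.2.2
    omega

lemma cost_addLen_eq {Q : ℕ} (l : ℕ) (F : List TBranch) :
    cost (· ⌈/⌉ Q) Prod.snd (addLen l F) = l * trafficSum Q F + cost (· ⌈/⌉ Q) Prod.snd F := by
  induction F with
  | nil => simp
  | cons b r ih =>
    cases b with | mk l' I cs =>
    simp only [addLen, cost_mk, trafficSum_cons, ih, TBranch.traffic, items_mk, amount_append]
    simp only [amount]
    ring

/-- The side conditions of the operations are made for this. A contracted edge has traffic one, and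
the edges below it had at least one; `unzip` replaces the traffic of the stem by an equal sum; a
united leaf still has traffic one. -/
lemma HStep.cost_snd_le {Q : ℕ} (hQ : 0 < Q) {F B r : List TBranch}
    (h : HStep Q F B r) (hF : AllSub (LeafOK Q) F) :
    cost (· ⌈/⌉ Q) Prod.snd (B ++ r) ≤ cost (· ⌈/⌉ Q) Prod.snd F := by
  induction h with
  | @condense F r l cs h hcs hf =>
    rw [h.allSub_iff] at hF
    simp only [AllSub_cons, kids_mk] at hF
    rw [h.cost_eq]
    have := totLen_le_cost hQ hF.2.1
    simp only [amount] at hf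
    simp [hf]
    omega
  | @unzip F r l cs h hcs hf =>
    simp only [amount] at hf
    simp [h.cost_eq, cost_addLen_eq, hf]
  | group h hn hlo hhi =>
    simp [h.cost_eq]
    omega
  | @unite F r l₁ l₂ I₁ I₂ h hd =>
    rw [h.allSub_iff] at hF
    simp only [AllSub_cons, kids_mk] at hF
    have h1 := (hF.1.1 rfl)
    have h2 := (hF.2.2.1.1 rfl)
    simp only [its_mk] at h1 h2
    have e1 := (ceilDiv_eq_one_iff (n := amount I₁) hQ).2 h1
    have e2 := (ceilDiv_eq_one_iff (n := amount I₂) hQ).2 h2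
    have e3 := (ceilDiv_eq_one_iff (n := amount I₁ + amount I₂) hQ).2 ⟨by omega, hd⟩
    simp only [amount] at e1 e2 e3
    simp [h.cost_eq, e1, e2, e3, add_assoc]
  | @slide F r l cs l₁ cs₁ b r' h hcs hcs₁ hf =>
    rw [h.cost_eq]
    have h2 : ((collect (mk l₁ [] (b :: cs₁) :: r')).map Prod.snd).sum =
        ((collect cs).map Prod.snd).sum := by
      rw [(hcs.collect.map Prod.snd).sum_eq]
      simp; ring
    -- With `b` below it, the edge that receives `b` has at least its old traffic and at most that
    -- of the stem; these two are equal by `hf`.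
    have h3 : ((collect (b :: cs₁)).map Prod.snd).sum ⌈/⌉ Q =
        ((collect cs₁).map Prod.snd).sum ⌈/⌉ Q := by
      refine le_antisymm ?_ ((subadd_ceilDiv hQ).mono (by simp))
      refine le_trans ((subadd_ceilDiv hQ).mono ?_) hf.le
      rw [hcs.collect.amount_eq]
      simp [amount]
      omega
    have e := hcs.cost_eq (· ⌈/⌉ Q) Prod.snd
    rw [cost_mk, cost_cons _ _ b r'] at e
    rw [List.cons_append, List.nil_append, cost_mk, cost_mk, cost_mk, h2, e, cost_cons _ _ b cs₁]
    simp only [List.map_nil, List.sum_nil, zero_add, h3]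
    omega
  | @inside F r l I cs B s h hop ih =>
    rw [h.allSub_iff] at hF
    simp only [AllSub_cons, kids_mk] at hF
    rw [h.cost_eq, List.cons_append, List.nil_append, cost_mk, cost_mk,
      (hop.collect_perm.map Prod.snd).sum_eq]
    have := ih hF.2.1
    omega

/-! ## Simplification -/

/-- Extract a leaf of least demand. -/
def extractMin : List TBranch → Option (TBranch × List TBranch)
  | [] => none
  | .mk l I [] :: r =>
    match extractMin r with
    | none => some (.mk l I [], r)
    | some (m, r') => if amount I ≤ amount m.its then some (.mk l I [], r)
        else some (m, .mk l I [] :: r')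
  | .mk l I (c :: cs) :: r =>
    match extractMin r with
    | none => none
    | some (m, r') => some (m, .mk l I (c :: cs) :: r')

/-- Unite two leaves or group three leaves. -/
def normStep (Q : ℕ) (F : List TBranch) : Option (TBranch × List TBranch) :=
  match extractMin F with
  | none => none
  | some (a, F₁) =>
    match extractMin F₁ with
    | none => none
    | some (b, F₂) =>
      if amount a.its + amount b.its ≤ Q then
        some (.mk (a.len + b.len) (a.its ++ b.its) [], F₂)
      else
        match extractMin F₂ with
        | none => none
        | some (c, F₃) =>
          match F₃ with
          | [] => none
          | x :: F₄ =>
            if 2 * Q ≤ amount a.its + amount b.its + amount c.its then none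
            else some (.mk 0 [] [a, b, c], x :: F₄)

lemma extractMin_none {F : List TBranch} (h : extractMin F = none) : ∀ b ∈ F, b.kids ≠ [] := by
  induction F with
  | nil => simp
  | cons b r ih =>
    rcases b with ⟨l, I, _ | ⟨c, cs⟩⟩
    · unfold extractMin at h
      split at h
      · simp at h
      · split_ifs at h
    · unfold extractMin at h
      split at h
      · rename_i h'
        simpa using ih h'
      · simp at h

lemma extractMin_some {F : List TBranch} {m : TBranch} {r : List TBranch}
    (h : extractMin F = some (m, r)) : m.kids = [] ∧ F.Perm (m :: r) ∧
      ∀ b ∈ F, b.kids = [] → amount m.its ≤ amount b.its := by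
  induction F generalizing m r with
  | nil => simp [extractMin] at h
  | cons b t ih =>
    rcases b with ⟨l, I, _ | ⟨c, cs⟩⟩
    · unfold extractMin at h
      split at h
      · rename_i h'
        simp only [Option.some.injEq, Prod.mk.injEq] at h
        obtain ⟨rfl, rfl⟩ := h
        refine ⟨rfl, .refl _, ?_⟩
        simp only [List.mem_cons, forall_eq_or_imp, le_refl, implies_true, true_and]
        intro b hb hk
        exact absurd hk (extractMin_none h' b hb)
      · rename_i m' r' h'
        obtain ⟨h1, h2, h3⟩ := ih h'
        split_ifs at h with hle
        · simp only [Option.some.injEq, Prod.mk.injEq] at h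
          obtain ⟨rfl, rfl⟩ := h
          refine ⟨rfl, .refl _, ?_⟩
          simp only [List.mem_cons, forall_eq_or_imp, le_refl, implies_true, true_and]
          intro b hb hk
          exact hle.trans (h3 b hb hk)
        · simp only [Option.some.injEq, Prod.mk.injEq] at h
          obtain ⟨rfl, rfl⟩ := h
          refine ⟨h1, (h2.cons _).trans (.swap _ _ _), ?_⟩
          simp only [List.mem_cons, forall_eq_or_imp, its_mk]
          exact ⟨fun _ => by omega, h3⟩
    · unfold extractMin at h
      split at h
      · simp at h
      · rename_i m' r' h'
        obtain ⟨h1, h2, h3⟩ := ih h'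
        simp only [Option.some.injEq, Prod.mk.injEq] at h
        obtain ⟨rfl, rfl⟩ := h
        refine ⟨h1, (h2.cons _).trans (.swap _ _ _), ?_⟩
        simpa using h3

/-- No two leaves can be united, no three leaves can be grouped. -/
def Compact (Q : ℕ) (F : List TBranch) : Prop :=
  (∀ a b r, F.Perm (a :: b :: r) → a.kids = [] → b.kids = [] →
    Q < amount a.its + amount b.its) ∧
  ∀ a b c r, F.Perm (a :: b :: c :: r) → a.kids = [] → b.kids = [] → c.kids = [] → r ≠ [] →
    2 * Q ≤ amount a.its + amount b.its + amount c.its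

/-- Taking one entry away can remove only one of two others, even if their values coincide. -/
lemma mem_or_mem_of_perm {α : Type*} {a x y : α} {F r : List α} (h : (a :: F).Perm (x :: y :: r)) :
    x ∈ F ∨ y ∈ F := by
  by_cases hx : x = a
  · subst hx
    right
    exact ((List.perm_cons _).1 h).mem_iff.2 (by simp)
  · left
    have := h.mem_iff.2 (show x ∈ x :: y :: r by simp)
    simpa [hx] using this

lemma mem_of_perm_three {α : Type*} {a b x y z : α} {F r : List α}
    (h : (a :: b :: F).Perm (x :: y :: z :: r)) : x ∈ F ∨ y ∈ F ∨ z ∈ F := by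
  by_cases hx : x = a
  · subst hx
    exact .inr (mem_or_mem_of_perm ((List.perm_cons _).1 h))
  · have hx' : x ∈ b :: F := by
      have := h.mem_iff.2 (show x ∈ x :: y :: z :: r by simp)
      simpa only [List.mem_cons, hx, false_or] using this
    by_cases hb : x = b
    · subst hb
      exact .inr (mem_or_mem_of_perm ((List.perm_cons _).1 ((List.Perm.swap _ _ _).trans h)))
    · exact .inl (by simpa [hb] using hx')

/-- At least one of `x`, `y` is still present after the removal of `a` and so has at least the
demand of `b`; the other one has at least that of `a`. -/
lemma le_of_extractMin_two {F F₁ F₂ : List TBranch} {a b : TBranch}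
    (h₁ : extractMin F = some (a, F₁)) (h₂ : extractMin F₁ = some (b, F₂)) {x y : TBranch}
    {r : List TBranch} (hF : F.Perm (x :: y :: r)) (hx : x.kids = []) (hy : y.kids = []) :
    amount a.its + amount b.its ≤ amount x.its + amount y.its := by
  obtain ⟨-, p1, m1⟩ := extractMin_some h₁
  obtain ⟨-, p2, m2⟩ := extractMin_some h₂
  have hx1 := m1 x (hF.mem_iff.2 (by simp)) hx
  have hy1 := m1 y (hF.mem_iff.2 (by simp)) hy
  rcases mem_or_mem_of_perm (p1.symm.trans hF) with h | h
  · have := m2 x h hx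
    omega
  · have := m2 y h hy
    omega

/-- It suffices to test the least leaves. The two least minimize the demand of a pair, and of any
three leaves one is at least the third least while the other two hold at least as much as the least
pair. -/
lemma compact_of_normStep {Q : ℕ} {F : List TBranch} (h : normStep Q F = none) : Compact Q F := by
  unfold normStep at h
  split at h
  · rename_i h0
    have := extractMin_none h0
    exact ⟨fun a b r hF ha => absurd ha (this a (hF.mem_iff.2 (by simp))),
      fun a b c r hF ha => absurd ha (this a (hF.mem_iff.2 (by simp)))⟩
  rename_i a F₁ h1
  obtain ⟨ka, p1, m1⟩ := extractMin_some h1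
  split at h
  · rename_i h0
    have := extractMin_none h0
    refine ⟨fun x y r hF hx hy => ?_, fun x y z r hF hx hy => ?_⟩ <;>
    rcases mem_or_mem_of_perm (p1.symm.trans hF) with h | h
    · exact absurd hx (this _ h)
    · exact absurd hy (this _ h)
    · exact absurd hx (this _ h)
    · exact absurd hy (this _ h)
  rename_i b F₂ h2
  obtain ⟨kb, p2, m2⟩ := extractMin_some h2
  split_ifs at h with hab
  have hpair : ∀ x y r, F.Perm (x :: y :: r) → x.kids = [] → y.kids = [] →
      Q < amount x.its + amount y.its := fun x y r hF hx hy =>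
    lt_of_lt_of_le (by omega) (le_of_extractMin_two h1 h2 hF hx hy)
  refine ⟨hpair, ?_⟩
  intro x y z r hF hx hy hz hr
  have h3 : (a :: b :: F₂).Perm (x :: y :: z :: r) :=
    ((p2.cons a).symm.trans p1.symm).trans hF
  have hxy := le_of_extractMin_two h1 h2 hF hx hy
  have hxz := le_of_extractMin_two h1 h2 (hF.trans ((List.Perm.swap _ _ _).cons x)) hx hz
  have hyz := le_of_extractMin_two h1 h2
    (hF.trans ((List.Perm.swap _ _ _).trans ((List.Perm.swap _ _ _).cons y))) hy hz
  split at h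
  · rename_i h0
    have := extractMin_none h0
    rcases mem_of_perm_three h3 with h | h | h
    · exact absurd hx (this _ h)
    · exact absurd hy (this _ h)
    · exact absurd hz (this _ h)
  rename_i c F₃ h4
  obtain ⟨kc, p3, m3⟩ := extractMin_some h4
  split at h
  -- Here `F` consists of exactly three branches, so there is no fourth one.
  · have l1 := p3.length_eq
    have l2 := h3.length_eq
    simp at l1 l2
    exact absurd (List.length_eq_zero_iff.1 (by omega)) hr
  · split_ifs at h with hq
    rcases mem_of_perm_three h3 with h | h | h
    · have := m3 _ h hx
      omega
    · have := m3 _ h hy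
      omega
    · have := m3 _ h hz
      omega

/-- What a step of the normalization does. -/
lemma normStep_some {Q : ℕ} {F : List TBranch} {w : TBranch} {r : List TBranch}
    (h : normStep Q F = some (w, r)) :
    (∃ l₁ l₂ I₁ I₂, F.Perm (.mk l₁ I₁ [] :: .mk l₂ I₂ [] :: r) ∧
      amount I₁ + amount I₂ ≤ Q ∧ w = .mk (l₁ + l₂) (I₁ ++ I₂) []) ∨
    (∃ l₁ l₂ l₃ I₁ I₂ I₃, F.Perm (.mk l₁ I₁ [] :: .mk l₂ I₂ [] :: .mk l₃ I₃ [] :: r) ∧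
      w = .mk 0 [] [.mk l₁ I₁ [], .mk l₂ I₂ [], .mk l₃ I₃ []] ∧ r ≠ [] ∧
      amount I₁ + amount I₂ + amount I₃ < 2 * Q ∧
      ∀ x y r, F.Perm (x :: y :: r) → x.kids = [] → y.kids = [] →
        Q < amount x.its + amount y.its) := by
  unfold normStep at h
  split at h
  · simp at h
  rename_i a F₁ h1
  obtain ⟨ka, p1, m1⟩ := extractMin_some h1
  split at h
  · simp at h
  rename_i b F₂ h2
  obtain ⟨kb, p2, m2⟩ := extractMin_some h2
  have p12 := p1.trans (p2.cons a)
  obtain ⟨l₁, I₁, c₁⟩ := a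
  obtain ⟨l₂, I₂, c₂⟩ := b
  simp only [kids_mk] at ka kb
  subst ka kb
  split_ifs at h with hab
  · simp only [Option.some.injEq, Prod.mk.injEq] at h
    obtain ⟨rfl, rfl⟩ := h
    exact .inl ⟨l₁, l₂, I₁, I₂, p12, hab, rfl⟩
  · have hpair : ∀ x y r, F.Perm (x :: y :: r) → x.kids = [] → y.kids = [] →
        Q < amount x.its + amount y.its := fun x y r hF hx hy =>
      lt_of_lt_of_le (by omega) (le_of_extractMin_two h1 h2 hF hx hy)
    split at h
    · simp at h
    rename_i c F₃ h3
    obtain ⟨kc, p3, m3⟩ := extractMin_some h3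
    have p123 := p12.trans ((p3.cons _).cons _)
    obtain ⟨l₃, I₃, c₃⟩ := c
    simp only [kids_mk] at kc
    subst kc
    split at h
    · simp at h
    split_ifs at h with hq
    simp only [Option.some.injEq, Prod.mk.injEq] at h
    obtain ⟨rfl, rfl⟩ := h
    exact .inr ⟨l₁, l₂, l₃, I₁, I₂, I₃, p123, rfl, by simp, by simpa using hq, hpair⟩

/-- Uniting removes one sibling and grouping removes two, so `norm` terminates. -/
lemma normStep_length {Q : ℕ} {F : List TBranch} {w : TBranch} {r : List TBranch}
    (h : normStep Q F = some (w, r)) : ([w] ++ r).length < F.length := by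
  rcases normStep_some h with ⟨_, _, _, _, hF, -⟩ | ⟨_, _, _, _, _, _, hF, -⟩ <;>
  · rw [hF.length_eq]
    simp

/-- Unite and group leaves as long as possible. In `(ch, sm)`, the branches `ch` are new. -/
def norm (Q : ℕ) (ch sm : List TBranch) : List TBranch × List TBranch :=
  match _h : normStep Q (ch ++ sm) with
  | none => (ch, sm)
  | some (w, r) => norm Q [w] r
termination_by (ch ++ sm).length
decreasing_by exact normStep_length _h

lemma norm_of_none {Q : ℕ} {ch sm : List TBranch} (h : normStep Q (ch ++ sm) = none) :
    norm Q ch sm = (ch, sm) := by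
  rw [norm]
  split
  · rfl
  · simp_all

lemma norm_of_some {Q : ℕ} {ch sm : List TBranch} {w : TBranch} {r : List TBranch}
    (h : normStep Q (ch ++ sm) = some (w, r)) : norm Q ch sm = norm Q [w] r := by
  rw [norm]
  split
  · simp_all
  · simp_all

theorem norm_induction {Q : ℕ} {P : List TBranch → List TBranch → Prop}
    (done : ∀ ch sm, normStep Q (ch ++ sm) = none → P ch sm)
    (step : ∀ ch sm w r, normStep Q (ch ++ sm) = some (w, r) → P [w] r → P ch sm)
    (ch sm : List TBranch) : P ch sm := by
  match h : normStep Q (ch ++ sm) with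
  | none => exact done ch sm h
  | some (w, r) => exact step ch sm w r h (norm_induction done step [w] r)
termination_by (ch ++ sm).length
decreasing_by exact normStep_length h

/-- Extract a branch that is not a leaf and has traffic at least `f`. -/
def extractNode (Q f : ℕ) : List TBranch → Option (TBranch × List TBranch)
  | [] => none
  | b :: r =>
    if b.kids ≠ [] ∧ f ≤ b.traffic Q then some (b, r)
    else
      match extractNode Q f r with
      | none => none
      | some (m, r') => some (m, b :: r')

/-- Condense, unzip, or slide and unzip at a branch, if possible. -/
def finish (Q l : ℕ) (cs : List TBranch) : List TBranch :=
  if amount (collect cs) ≤ Q then [.mk (l + totLen cs) (collect cs) []]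
  else if trafficSum Q cs ≤ amount (collect cs) ⌈/⌉ Q then addLen l cs
  else
    match extractNode Q (amount (collect cs) ⌈/⌉ Q) cs with
    -- The empty list signals that no operation applies at the stem; for the lists that occur, all
    -- other outcomes are nonempty.
    | none => []
    -- `w` has the traffic of the stem, so all its siblings can slide below it; its parent then has
    -- one child and is spliced out. Branches that become siblings have to be normalized again, and
    -- this may make `unzip` possible.
    | some (w, r) =>
      if trafficSum Q ((norm Q [] (r ++ w.kids)).1 ++ (norm Q [] (r ++ w.kids)).2) ≤
          amount (collect cs) ⌈/⌉ Q then
        addLen (l + w.len) ((norm Q [] (r ++ w.kids)).1 ++ (norm Q [] (r ++ w.kids)).2)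
      else [.mk (l + w.len) [] ((norm Q [] (r ++ w.kids)).1 ++ (norm Q [] (r ++ w.kids)).2)]

/-- Simplify the branches; the result consists of new branches and of unchanged ones. -/
def simplify (Q : ℕ) : List TBranch → List TBranch × List TBranch
  | [] => ([], [])
  | .mk l I [] :: r => ((simplify Q r).1, .mk l I [] :: (simplify Q r).2)
  | .mk l I (c :: cs) :: r =>
    match norm Q (simplify Q (c :: cs)).1 (simplify Q (c :: cs)).2 with
    | (c₁, s₁) =>
      match finish Q l (c₁ ++ s₁) with
      | y :: ys => (y :: ys ++ (simplify Q r).1, (simplify Q r).2)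
      | [] =>
        -- Nothing happens at the stem, so the branch counts as unchanged exactly if nothing has
        -- changed below it.
        match c₁ with
        | [] => ((simplify Q r).1, .mk l I s₁ :: (simplify Q r).2)
        | x :: xs => (.mk l I (x :: xs ++ s₁) :: (simplify Q r).1, (simplify Q r).2)

lemma extractNode_none {Q f : ℕ} {F : List TBranch} (h : extractNode Q f F = none) :
    ∀ b ∈ F, b.kids ≠ [] → b.traffic Q < f := by
  induction F with
  | nil => simp
  | cons b r ih =>
    rw [extractNode] at h
    split_ifs at h with hb
    split at h
    · rename_i h'
      simp only [List.mem_cons, forall_eq_or_imp]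
      exact ⟨fun hk => by simpa [hk] using hb, ih h'⟩
    · simp at h

lemma extractNode_some {Q f : ℕ} {F : List TBranch} {m : TBranch} {r : List TBranch}
    (h : extractNode Q f F = some (m, r)) :
    F.Perm (m :: r) ∧ m.kids ≠ [] ∧ f ≤ m.traffic Q := by
  induction F generalizing m r with
  | nil => simp [extractNode] at h
  | cons b t ih =>
    rw [extractNode] at h
    split_ifs at h with hb
    · simp only [Option.some.injEq, Prod.mk.injEq] at h
      obtain ⟨rfl, rfl⟩ := h
      exact ⟨.refl _, hb⟩
    · split at h
      · simp at h
      · rename_i m' r' h'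
        simp only [Option.some.injEq, Prod.mk.injEq] at h
        obtain ⟨rfl, rfl⟩ := h
        exact ⟨((ih h').1.cons _).trans (.swap _ _ _), (ih h').2⟩

/-! ### Reachability -/

/-- `F'` results from `F` by one safe operation. -/
def Step (Q : ℕ) (F F' : List TBranch) : Prop := ∃ B r, HStep Q F B r ∧ F' = B ++ r

lemma steps_collect_perm {Q : ℕ} {F F' : List TBranch} (h : Relation.ReflTransGen (Step Q) F F') :
    (collect F).Perm (collect F') := by
  induction h with
  | refl => exact .refl _
  | tail _ h ih =>
    obtain ⟨B, r, h, rfl⟩ := h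
    exact ih.trans h.collect_perm

lemma steps_leafOK {Q : ℕ} (hQ : 0 < Q) {F F' : List TBranch}
    (h : Relation.ReflTransGen (Step Q) F F') (hF : AllSub (LeafOK Q) F) :
    AllSub (LeafOK Q) F' := by
  induction h with
  | refl => exact hF
  | tail _ h ih =>
    obtain ⟨B, r, h, rfl⟩ := h
    exact h.leafOK hQ ih

lemma steps_cost_le {Q : ℕ} {g : ℕ → ℕ} (hg : Subadd g) (wt) {F F' : List TBranch}
    (h : Relation.ReflTransGen (Step Q) F F') : cost g wt F ≤ cost g wt F' := by
  induction h with
  | refl => exact le_rfl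
  | tail _ h ih =>
    obtain ⟨B, r, h, rfl⟩ := h
    exact ih.trans (h.cost_le hg wt)

lemma steps_cost_snd_le {Q : ℕ} (hQ : 0 < Q) {F F' : List TBranch}
    (h : Relation.ReflTransGen (Step Q) F F') (hF : AllSub (LeafOK Q) F) :
    cost (· ⌈/⌉ Q) Prod.snd F' ≤ cost (· ⌈/⌉ Q) Prod.snd F := by
  induction h with
  | refl => exact le_rfl
  | tail h' h ih =>
    obtain ⟨B, r, h, rfl⟩ := h
    exact (h.cost_snd_le hQ (steps_leafOK hQ h' hF)).trans ih

lemma steps_erase {Q : ℕ} {F F' : List TBranch} (h : Relation.ReflTransGen (Step Q) F F') :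
    Relation.ReflTransGen (SafeOp Q) (F.map erase) (F'.map erase) := by
  induction h with
  | refl => exact .refl
  | tail _ h ih =>
    obtain ⟨B, r, h, rfl⟩ := h
    exact ih.tail h.safeOp

/-- Safe operations turn `F` into `ch ++ sm`, where `sm` is a part of `F` that has not been
touched; there are none of them if `ch` is empty. -/
def Reach (Q : ℕ) (F ch sm : List TBranch) : Prop :=
  (ch = [] ∧ sm = F) ∨
  (ch ≠ [] ∧ ∀ F₀ ctx sm' : List TBranch, F₀.Perm (F ++ ctx) → sm'.Perm (sm ++ ctx) →
    Relation.TransGen (Step Q) F₀ (ch ++ sm'))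

/-- Safe operations turn the branch `b` into the branches `ys`. -/
def Changes (Q : ℕ) (b : TBranch) (ys : List TBranch) : Prop :=
  ∀ F₀ r r' : List TBranch, F₀.Perm (b :: r) → r'.Perm r →
    Relation.TransGen (Step Q) F₀ (ys ++ r')

lemma Changes.trans {Q : ℕ} {b b' : TBranch} {ys : List TBranch} (h : Changes Q b [b'])
    (h' : Changes Q b' ys) : Changes Q b ys := fun F₀ r r' hF hr =>
  (h F₀ r r hF (.refl _)).trans (h' _ r r' (.refl _) hr)

lemma HStep.changes {Q : ℕ} {b : TBranch} {B : List TBranch} (h : HStep Q [b] B []) :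
    Changes Q b B := fun _ r r' hF hr =>
  .single ⟨B, r', h.context (ctx := r) hF hr, rfl⟩

lemma Changes.inside {Q : ℕ} {cs cs' : List TBranch} (h : Relation.TransGen (Step Q) cs cs')
    (l : ℕ) (I : List Item) : Changes Q (.mk l I cs) [.mk l I cs'] := by
  induction h with
  | single h =>
    obtain ⟨B, s, h, rfl⟩ := h
    exact HStep.changes (.inside (.refl _) h)
  | tail _ h ih =>
    refine ih.trans ?_
    obtain ⟨B, s, h, rfl⟩ := h
    exact HStep.changes (.inside (.refl _) h)

/-- The two cases of `Reach` reflect the role of the order: an operation may return the untouched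
siblings in any order, but without an operation the list has to stay literally the same. -/
lemma Reach.step {Q : ℕ} {F ch sm B r : List TBranch} (h : Reach Q F ch sm)
    (hs : HStep Q (ch ++ sm) B r) (hB : B ≠ []) : Reach Q F B r := by
  refine .inr ⟨hB, fun F₀ ctx sm' hF hr => ?_⟩
  rcases h with ⟨rfl, rfl⟩ | ⟨_, h⟩
  · exact .single ⟨B, sm', hs.context hF hr, rfl⟩
  · refine (h F₀ ctx _ hF (.refl _)).tail ⟨B, sm', hs.context (ctx := ctx) ?_ hr, rfl⟩
    simp

lemma HStep.of_normStep {Q : ℕ} {F : List TBranch} {w : TBranch} {r : List TBranch}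
    (h : normStep Q F = some (w, r)) : HStep Q F [w] r := by
  rcases normStep_some h with ⟨l₁, l₂, I₁, I₂, hF, hd, rfl⟩ |
    ⟨l₁, l₂, l₃, I₁, I₂, I₃, hF, rfl, hr, hd, hp⟩
  · exact .unite hF hd
  · refine .group hF hr ?_ hd
    -- The lower bound in `group` comes for free: the three pairs of leaves exceed `Q` each, and
    -- adding them up counts every leaf twice.
    have h1 := hp _ _ _ hF rfl rfl
    have h2 := hp _ _ _ (hF.trans ((List.Perm.swap _ _ _).cons _)) rfl rfl
    have h3 := hp _ _ _ (hF.trans ((List.Perm.swap _ _ _).trans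
      ((List.Perm.swap _ _ _).cons _))) rfl rfl
    simp only [its_mk] at h1 h2 h3
    omega

lemma Reach.norm {Q : ℕ} {F ch sm : List TBranch} (h : Reach Q F ch sm) :
    Reach Q F (norm Q ch sm).1 (norm Q ch sm).2 := by
  induction ch, sm using norm_induction (Q := Q) with
  | done ch sm hn => rwa [norm_of_none hn]
  | step ch sm w r hs ih =>
    rw [norm_of_some hs]
    exact ih (h.step (HStep.of_normStep hs) (by simp))

lemma compact_norm (Q : ℕ) (ch sm : List TBranch) :
    Compact Q ((norm Q ch sm).1 ++ (norm Q ch sm).2) := by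
  induction ch, sm using norm_induction (Q := Q) with
  | done ch sm hn =>
    rw [norm_of_none hn]
    exact compact_of_normStep hn
  | step ch sm w r hs ih => rwa [norm_of_some hs]

lemma Reach.refl (Q : ℕ) (F : List TBranch) : Reach Q F [] F := .inl ⟨rfl, rfl⟩

lemma Reach.reflTransGen {Q : ℕ} {F ch sm : List TBranch} (h : Reach Q F ch sm) :
    Relation.ReflTransGen (Step Q) F (ch ++ sm) := by
  rcases h with ⟨rfl, rfl⟩ | ⟨_, h⟩
  · exact .refl
  · exact (h F [] sm (by simp) (by simp)).to_reflTransGen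

lemma Reach.cons_same {Q : ℕ} {r ch sm : List TBranch} (h : Reach Q r ch sm) (b : TBranch) :
    Reach Q (b :: r) ch (b :: sm) := by
  rcases h with ⟨rfl, rfl⟩ | ⟨h0, h⟩
  · exact .refl _ _
  · refine .inr ⟨h0, fun F₀ ctx sm' hF hr => h F₀ (b :: ctx) sm' (hF.trans ?_) (hr.trans ?_)⟩
    · exact List.perm_middle.symm
    · exact List.perm_middle.symm

lemma Reach.cons_changed {Q : ℕ} {r ch sm : List TBranch} (h : Reach Q r ch sm) {b : TBranch}
    {ys : List TBranch} (hy : ys ≠ []) (hb : Changes Q b ys) :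
    Reach Q (b :: r) (ys ++ ch) sm := by
  refine .inr ⟨by simp [hy], fun F₀ ctx sm' hF hr => ?_⟩
  rcases h with ⟨rfl, rfl⟩ | ⟨_, h⟩
  · simpa using hb F₀ _ _ hF hr
  · have h1 := h F₀ (b :: ctx) (b :: sm') (hF.trans List.perm_middle.symm)
      ((hr.cons b).trans List.perm_middle.symm)
    have h2 := hb (ch ++ b :: sm') (ch ++ sm') (ch ++ sm') List.perm_middle (.refl _)
    rw [List.append_assoc]
    exact h1.trans h2

/-- The siblings slide one at a time, and the traffic of the receiving edge stays equal to that of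
the stem. When none is left, the stem ends in a vertex with one child, and `unzip` splices it. A
slide puts the branch in front of `cs₁`, so `r` is consumed from its end to arrive at `r ++ cs₁`. -/
lemma slide_changes {Q l l₁ : ℕ} {cs₁ : List TBranch} (hcs₁ : cs₁ ≠ []) (r cs : List TBranch)
    (h : cs.Perm (.mk l₁ [] cs₁ :: r))
    (hf : amount (collect cs) ⌈/⌉ Q ≤ amount (collect cs₁) ⌈/⌉ Q) (hQ : 0 < Q) :
    Changes Q (.mk l [] cs) [.mk (l + l₁) [] (r ++ cs₁)] := by
  induction r using List.reverseRecOn generalizing cs cs₁ with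
  | nil =>
    have hc := h.collect.amount_eq
    simp only [collect_cons, items_mk, List.nil_append, collect_nil, List.append_nil] at hc
    have := HStep.unzip (Q := Q) (F := [.mk l [] cs]) (.refl _) (by rintro rfl; simp at h)
      (by rw [h.trafficSum_eq, hc]; simp [TBranch.traffic])
    have h2 := List.perm_singleton.1 h
    subst h2
    exact HStep.changes this
  | append_singleton r b ih =>
    have h' : cs.Perm (.mk l₁ [] cs₁ :: b :: r) := h.trans (by
      refine List.Perm.cons _ ?_
      exact List.perm_append_comm)
    have hc := h'.collect.amount_eq
    have e : amount (collect cs) ⌈/⌉ Q = amount (collect cs₁) ⌈/⌉ Q :=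
      le_antisymm hf ((subadd_ceilDiv hQ).mono (by rw [hc]; simp))
    have h1 := HStep.changes (HStep.slide (Q := Q) (F := [.mk l [] cs]) (.refl _) h' hcs₁ e)
    refine h1.trans ?_
    have := ih (cs₁ := b :: cs₁) (by simp) (.mk l₁ [] (b :: cs₁) :: r) (.refl _) ?_
    · simpa using this
    · refine le_trans ((subadd_ceilDiv hQ).mono ?_)
        (hf.trans ((subadd_ceilDiv hQ).mono (by simp)))
      rw [hc]
      simp
      omega

lemma addLen_ne_nil {l : ℕ} {cs : List TBranch} (h : cs ≠ []) : addLen l cs ≠ [] := by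
  simpa [addLen_eq] using h

lemma trafficSum_ge {Q : ℕ} (hQ : 0 < Q) (cs : List TBranch) :
    amount (collect cs) ⌈/⌉ Q ≤ trafficSum Q cs := by
  induction cs with
  | nil => simp
  | cons b r ih =>
    have := (subadd_ceilDiv hQ).add_le (amount b.items) (amount (collect r))
    simp only [collect_cons, amount_append, trafficSum_cons, TBranch.traffic]
    omega

lemma finish_changes {Q l : ℕ} (hQ : 0 < Q) {cs : List TBranch} (hcs : cs ≠ [])
    (hok : AllSub (LeafOK Q) cs) (hf : finish Q l cs ≠ []) :
    Changes Q (.mk l [] cs) (finish Q l cs) := by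
  unfold finish at hf ⊢
  split_ifs at hf ⊢ with h1 h2
  · exact HStep.changes (.condense (.refl _) hcs
      ((ceilDiv_eq_one_iff hQ).2 ⟨collect_ne_nil hok hcs, h1⟩))
  · exact HStep.changes (.unzip (.refl _) hcs (le_antisymm (trafficSum_ge hQ cs) h2))
  · split
    · rename_i h; simp [h] at hf
    · rename_i w r h
      obtain ⟨hp, hw, hwf⟩ := extractNode_some h
      have hwk : w.its = [] := by
        rw [hp.allSub_iff] at hok
        exact (AllSub_cons _ _ _ |>.1 hok).1.2 hw
      obtain ⟨l₁, I₁, cs₁⟩ := w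
      simp only [its_mk, kids_mk] at hwk hw
      subst hwk
      simp only [TBranch.traffic, items_mk, List.nil_append] at hwf
      have hs := slide_changes (l := l) hw r cs hp hwf hQ
      have hR := (Reach.refl Q (r ++ cs₁)).norm
      simp only [kids_mk, len_mk]
      set n := norm Q [] (r ++ cs₁)
      have hs' : Changes Q (.mk l [] cs) [.mk (l + l₁) [] (n.1 ++ n.2)] := by
        rcases hR with ⟨h1, h2⟩ | ⟨_, hR⟩
        · rw [h1, h2]
          simpa using hs
        · exact hs.trans (Changes.inside (hR _ [] n.2 (by simp) (by simp)) _ _)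
      have e : amount (collect cs) = amount (collect (n.1 ++ n.2)) := by
        rw [← (steps_collect_perm hR.reflTransGen).amount_eq, hp.collect.amount_eq]
        simp; omega
      show Changes Q _ (if trafficSum Q (n.1 ++ n.2) ≤ _ then addLen _ (n.1 ++ n.2) else _)
      split_ifs with h3
      · refine hs'.trans (HStep.changes (.unzip (.refl _) ?_ ?_))
        · intro h0
          have h4 := collect_ne_nil hok hcs
          rw [e, h0] at h4
          simp at h4
        · rw [e] at h3
          exact le_antisymm (trafficSum_ge hQ _) h3
      · exact hs'

lemma simplify_reach {Q : ℕ} (hQ : 0 < Q) (F : List TBranch) (hF : AllSub (LeafOK Q) F) :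
    Reach Q F (simplify Q F).1 (simplify Q F).2 := by
  induction F using forest_induction with
  | nil =>
    rw [simplify]
    exact .refl _ _
  | cons l I cs r h1 h2 =>
    simp only [AllSub_cons, kids_mk] at hF
    cases cs with
    | nil =>
      rw [simplify]
      exact (h2 hF.2.2).cons_same _
    | cons c cs =>
      have hI : I = [] := hF.1.2 (by simp)
      have hr := (h1 hF.2.1).norm
      rw [simplify]
      have hall := hr.reflTransGen
      generalize norm Q (simplify Q (c :: cs)).1 (simplify Q (c :: cs)).2 = n at hr hall
      obtain ⟨c₁, s₁⟩ := n
      have hb : c₁ ≠ [] → Changes Q (.mk l I (c :: cs)) [.mk l I (c₁ ++ s₁)] := fun h => by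
        rcases hr with hr | hr
        · exact absurd hr.1 h
        · exact Changes.inside (hr.2 _ [] s₁ (by simp) (by simp)) _ _
      simp only
      split
      · rename_i y ys hy
        refine (h2 hF.2.2).cons_changed (by simp) ?_
        have hfin := finish_changes (l := l) hQ (cs := c₁ ++ s₁) ?_ (steps_leafOK hQ hall hF.2.1)
          (by simp [hy])
        · rw [hy, ← hI] at hfin
          by_cases h : c₁ = []
          · have : s₁ = c :: cs := by
              rcases hr with hr | hr
              · exact hr.2
              · exact absurd h hr.1
            simpa [h, this] using hfin
          · exact (hb h).trans hfin
        · intro h0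
          have := collect_ne_nil hF.2.1 (by simp)
          rw [(steps_collect_perm hall).amount_eq] at this
          rw [h0] at this
          simp at this
      · split
        · have : s₁ = c :: cs := by
            rcases hr with hr | hr
            · exact hr.2
            · simp at hr
          rw [this]
          exact (h2 hF.2.2).cons_same _
        · exact (h2 hF.2.2).cons_changed (ys := [_]) (by simp) (hb (by simp))

/-! ### Exhaustion -/

/-- No safe operation is available at the branch `b`. -/
def NodeOK (Q : ℕ) (b : TBranch) : Prop := b.kids ≠ [] →
  Q < amount (collect b.kids) ∧ amount (collect b.kids) ⌈/⌉ Q < trafficSum Q b.kids ∧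
  (∀ w ∈ b.kids, w.kids ≠ [] → w.traffic Q < amount (collect b.kids) ⌈/⌉ Q) ∧ Compact Q b.kids

lemma lt_ceilDiv {Q n k : ℕ} (hQ : 0 < Q) : k < n ⌈/⌉ Q ↔ Q * k < n := by
  have := ceilDiv_le_iff_le_mul (a := Q) (b := n) (c := k) hQ
  omega

lemma traffic_leaf {Q : ℕ} (hQ : 0 < Q) {b : TBranch} (hb : LeafOK Q b) (h : b.kids = []) :
    b.traffic Q = 1 := by
  rw [TBranch.traffic, items_eq, h, ceilDiv_eq_one_iff hQ]
  simpa using hb.1 h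

/-- A grouped vertex is final at once: its demand lies strictly between `Q` and `2Q`, its stem has
traffic two against three for its leaves, none of its children can receive a slide, and it has too
few children for another group. -/
lemma normStep_nodeOK {Q : ℕ} (hQ : 0 < Q) {F : List TBranch} {w : TBranch} {r : List TBranch}
    (h : normStep Q F = some (w, r)) (hF : AllSub (NodeOK Q) F) (hl : AllSub (LeafOK Q) F) :
    AllSub (NodeOK Q) (w :: r) := by
  rcases normStep_some h with ⟨l₁, l₂, I₁, I₂, hp, hd, rfl⟩ |
    ⟨l₁, l₂, l₃, I₁, I₂, I₃, hp, rfl, hr, hd, hpair⟩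
  · rw [hp.allSub_iff] at hF
    simp only [AllSub_cons, kids_mk] at hF ⊢
    exact ⟨by simp [NodeOK], by simp, hF.2.2.2.2⟩
  · rw [hp.allSub_iff] at hF hl
    simp only [AllSub_cons, kids_mk] at hF hl ⊢
    refine ⟨?_, ⟨hF.1, hF.2.1, hF.2.2.1, hF.2.2.2.1, hF.2.2.2.2.1, hF.2.2.2.2.2.1, by simp⟩,
      hF.2.2.2.2.2.2⟩
    have h12 := hpair _ _ _ hp rfl rfl
    simp only [its_mk] at h12
    intro _
    simp only [kids_mk, collect_cons, items_mk, collect_nil, List.append_nil, amount_append,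
      trafficSum_cons, trafficSum_nil]
    have e1 := traffic_leaf hQ hl.1 rfl
    have e2 := traffic_leaf hQ hl.2.2.1 rfl
    have e3 := traffic_leaf hQ hl.2.2.2.2.1 rfl
    refine ⟨by omega, ?_, ?_, ?_, ?_⟩
    · rw [e1, e2, e3]
      have : (amount I₁ + (amount I₂ + amount I₃)) ⌈/⌉ Q ≤ 2 := by
        rw [ceilDiv_le_iff_le_mul hQ]
        omega
      omega
    · simp
    · intro x y s hs hx hy
      refine hpair x y (s ++ r) (hp.trans ?_) hx hy
      exact (hs.append_right r)
    · intro x y z s hs _ _ _ hs0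
      have := hs.length_eq
      simp at this
      exact absurd this hs0

lemma norm_nodeOK {Q : ℕ} (hQ : 0 < Q) (ch sm : List TBranch)
    (hF : AllSub (NodeOK Q) (ch ++ sm)) (hl : AllSub (LeafOK Q) (ch ++ sm)) :
    AllSub (NodeOK Q) ((norm Q ch sm).1 ++ (norm Q ch sm).2) := by
  induction ch, sm using norm_induction (Q := Q) with
  | done ch sm hn => rwa [norm_of_none hn]
  | step ch sm w r hs ih =>
    rw [norm_of_some hs]
    exact ih (normStep_nodeOK hQ hs hF hl) ((HStep.of_normStep hs).leafOK hQ hl)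

lemma norm_steps (Q : ℕ) (ch sm : List TBranch) :
    Relation.ReflTransGen (Step Q) (ch ++ sm) ((norm Q ch sm).1 ++ (norm Q ch sm).2) := by
  induction ch, sm using norm_induction (Q := Q) with
  | done ch sm hn => rw [norm_of_none hn]
  | step ch sm w r hs ih =>
    rw [norm_of_some hs]
    exact .head ⟨_, _, HStep.of_normStep hs, rfl⟩ ih

/-- The branches that arise in the normalization have small traffic, and if the traffic is at most
two, there are none of them. -/
lemma mem_norm {Q : ℕ} (hQ : 0 < Q) (ch sm : List TBranch)
    (hF : AllSub (NodeOK Q) (ch ++ sm)) (hl : AllSub (LeafOK Q) (ch ++ sm)) :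
    ∀ w ∈ (norm Q ch sm).1 ++ (norm Q ch sm).2, w.kids ≠ [] → w ∈ ch ++ sm ∨
      w.traffic Q ≤ 2 ∧ 2 * Q < amount (collect (ch ++ sm)) := by
  induction ch, sm using norm_induction (Q := Q) with
  | done ch sm hn =>
    rw [norm_of_none hn]
    exact fun w h _ => .inl h
  | step ch sm w r hs ih =>
    rw [norm_of_some hs]
    intro x hx hk
    have h1 := ih (normStep_nodeOK hQ hs hF hl) ((HStep.of_normStep hs).leafOK hQ hl) x hx hk
    rw [(HStep.of_normStep hs).collect_perm.amount_eq]
    rcases h1 with h1 | h1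
    · rcases normStep_some hs with ⟨l₁, l₂, I₁, I₂, hp, hd, rfl⟩ |
        ⟨l₁, l₂, l₃, I₁, I₂, I₃, hp, rfl, hr, hd, hpair⟩
      · left
        simp only [List.cons_append, List.nil_append, List.mem_cons] at h1
        rcases h1 with rfl | h1
        · simp at hk
        · exact hp.mem_iff.2 (by simp [h1])
      · simp only [List.cons_append, List.nil_append, List.mem_cons] at h1
        rcases h1 with rfl | h1
        · right
          constructor
          · rw [TBranch.traffic, ceilDiv_le_iff_le_mul hQ]
            simp
            omega
          -- Grouping requires a fourth sibling `y`. The first two leaves exceed `Q`, and so do the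
          -- third leaf and `y`: as a pair if `y` is a leaf, and by `NodeOK` if not. Thus the total
          -- exceeds `2Q`.
          · obtain ⟨y, r', rfl⟩ := List.exists_cons_of_ne_nil hr
            have h12 := hpair _ _ _ hp rfl rfl
            simp only [its_mk] at h12
            have h3 : Q < amount I₃ + amount y.items := by
              by_cases hy : y.kids = []
              · have := hpair (.mk l₃ I₃ []) y (.mk l₁ I₁ [] :: .mk l₂ I₂ [] :: r')
                  (hp.trans ?_) rfl hy
                · rw [items_eq, hy]
                  simpa using this
                · refine .trans ?_ (List.perm_append_comm (l₁ := [_, _]) (l₂ := [_, _])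
                    |>.append_right r')
                  simp
              · rw [hp.allSub_iff] at hF
                simp only [AllSub_cons] at hF
                have := (hF.2.2.2.2.2.2.1 hy).1
                rw [items_eq, amount_append]
                omega
            simp
            omega
        · exact .inl (hp.mem_iff.2 (by simp [h1]))
    · exact .inr h1

/-- One round of sliding is enough. Suppose that afterwards some non-leaf child still had the full
traffic `f ≥ 2`. If it was a sibling of `w`, two branches would hold more than `2 (f - 1) Q ≥ f Q`
together. If it was a child of `w`, its traffic is below that of `w`, which is at most `f`. If it
was created by grouping, its traffic is at most two, but then the demand exceeds `2Q` and `f ≥ 3`.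
-/
lemma compact_nodeOK {Q l : ℕ} (hQ : 0 < Q) {cs : List TBranch} (hok : AllSub (LeafOK Q) cs)
    (hn : AllSub (NodeOK Q) cs) (hcs : cs ≠ []) (hc : Compact Q cs) :
    (finish Q l cs = [] → NodeOK Q (.mk l [] cs)) ∧ AllSub (NodeOK Q) (finish Q l cs) := by
  have hadd : ∀ (l : ℕ) {cs : List TBranch}, AllSub (NodeOK Q) cs →
      AllSub (NodeOK Q) (addLen l cs) := fun l cs h => by
    rw [AllSub_iff] at h ⊢
    rw [addLen_eq]
    intro b hb
    obtain ⟨c, hc, rfl⟩ := List.mem_map.1 hb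
    exact h c hc
  unfold finish
  split_ifs with h1 h2
  · simp [NodeOK]
  · exact ⟨fun h => absurd h (addLen_ne_nil hcs), hadd l hn⟩
  · split
    · rename_i h
      refine ⟨fun _ _ => ⟨by simpa using h1, by simpa using h2, ?_, hc⟩, by simp⟩
      exact extractNode_none h
    · rename_i w r h
      obtain ⟨hp, hw, hwf⟩ := extractNode_some h
      have hn' := hn
      have hok' := hok
      rw [hp.allSub_iff] at hn hok
      simp only [AllSub_cons] at hn hok
      have hwk : w.its = [] := hok.1.2 hw
      have hN : AllSub (NodeOK Q) ([] ++ (r ++ w.kids)) := by simp [hn]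
      have hL : AllSub (LeafOK Q) ([] ++ (r ++ w.kids)) := by simp [hok]
      have hno := norm_nodeOK hQ [] (r ++ w.kids) hN hL
      have hst := norm_steps Q [] (r ++ w.kids)
      have hmem := mem_norm hQ [] (r ++ w.kids) hN hL
      have hco := compact_norm Q [] (r ++ w.kids)
      generalize norm Q [] (r ++ w.kids) = n at *
      have hwi : w.items = collect w.kids := by rw [items_eq, hwk, List.nil_append]
      have e : amount (collect cs) = amount (collect (n.1 ++ n.2)) := by
        rw [← (steps_collect_perm hst).amount_eq, hp.collect.amount_eq]
        simp [hwi]; omega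
      have hne : n.1 ++ n.2 ≠ [] := fun h0 => by
        rw [h0] at e
        have := collect_ne_nil hok' hcs
        simp at e
        omega
      split_ifs with h3
      · exact ⟨fun h => absurd h (addLen_ne_nil hne), hadd _ hno⟩
      · refine ⟨by simp, ?_⟩
        simp only [AllSub_cons, kids_mk, AllSub_nil, and_true]
        refine ⟨fun _ => ?_, hno⟩
        simp only [kids_mk]
        rw [← e]
        refine ⟨by omega, by omega, fun x hx hk => ?_, hco⟩
        have hf1 : 1 < amount (collect cs) ⌈/⌉ Q := by
          rw [lt_ceilDiv hQ]
          omega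
        by_contra hcon
        push Not at hcon
        have key : ∀ y s, cs.Perm (y :: w :: s) → amount (collect cs) ⌈/⌉ Q ≤ y.traffic Q →
            False := fun y s hs hyf => by
          have hsum := hs.collect.amount_eq
          simp only [collect_cons, amount_append] at hsum
          set f := amount (collect cs) ⌈/⌉ Q with hf
          have b1 : Q * (f - 1) < amount y.items := (lt_ceilDiv hQ).1 (by
            rw [TBranch.traffic] at hyf; omega)
          have b2 : Q * (f - 1) < amount w.items := (lt_ceilDiv hQ).1 (by
            rw [TBranch.traffic] at hwf; omega)
          have b3 : amount (collect cs) ≤ Q * f := (ceilDiv_le_iff_le_mul hQ).1 le_rfl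
          obtain ⟨k, hk⟩ : ∃ k, f = k + 2 := ⟨f - 2, by omega⟩
          have hk1 : f - 1 = k + 1 := by omega
          rw [hk1] at b1 b2
          rw [hk] at b3
          have : Q * (k + 2) ≤ 2 * (Q * (k + 1)) := by nlinarith
          omega
        rcases hmem x hx hk with hmem | hmem
        · simp only [List.nil_append, List.mem_append] at hmem
          rcases hmem with hmem | hmem
          · obtain ⟨s, t, rfl⟩ := List.append_of_mem hmem
            exact key x (s ++ t)
              (hp.trans ((List.perm_middle.cons w).trans (.swap _ _ _))) hcon
          · have h5 := (hn.1 hw).2.2.1 x hmem hk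
            have h6 : amount (collect w.kids) ≤ amount (collect cs) := by
              rw [hp.collect.amount_eq]
              simp [hwi]
            have : _ ⌈/⌉ Q ≤ _ ⌈/⌉ Q := (subadd_ceilDiv hQ).mono h6
            omega
        · have h7 : 2 < amount (collect cs) ⌈/⌉ Q := by
            rw [lt_ceilDiv hQ, e, ← (steps_collect_perm hst).amount_eq]
            omega
          omega

lemma simplify_nodeOK {Q : ℕ} (hQ : 0 < Q) (F : List TBranch) (hF : AllSub (LeafOK Q) F) :
    AllSub (NodeOK Q) ((simplify Q F).1 ++ (simplify Q F).2) := by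
  induction F using forest_induction with
  | nil => simp [simplify]
  | cons l I cs r h1 h2 =>
    simp only [AllSub_cons, kids_mk] at hF
    have h2' := h2 hF.2.2
    rw [AllSub_append] at h2'
    cases cs with
    | nil =>
      rw [simplify]
      simp only [AllSub_append, AllSub_cons, kids_mk]
      exact ⟨h2'.1, by simp [NodeOK], by simp, h2'.2⟩
    | cons c cs =>
      have hI : I = [] := hF.1.2 (by simp)
      have hre := simplify_reach hQ _ hF.2.1
      have hall := hre.norm.reflTransGen
      have hno := norm_nodeOK hQ _ _ (h1 hF.2.1) (steps_leafOK hQ hre.reflTransGen hF.2.1)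
      have hco := compact_norm Q (simplify Q (c :: cs)).1 (simplify Q (c :: cs)).2
      rw [simplify]
      generalize norm Q (simplify Q (c :: cs)).1 (simplify Q (c :: cs)).2 = n at *
      obtain ⟨c₁, s₁⟩ := n
      simp only at hall hno hco ⊢
      have hne : c₁ ++ s₁ ≠ [] := fun h0 => by
        have := collect_ne_nil hF.2.1 (by simp)
        rw [(steps_collect_perm hall).amount_eq, h0] at this
        simp at this
      have hfin := compact_nodeOK (l := l) hQ (steps_leafOK hQ hall hF.2.1) hno hne hco
      rw [← hI] at hfin
      split
      · rename_i y ys hy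
        rw [hy] at hfin
        simp only [AllSub_append]
        exact ⟨⟨hfin.2, h2'.1⟩, h2'.2⟩
      · rename_i hy
        have h3 := hfin.1 hy
        split
        · simp only [AllSub_append, AllSub_cons, kids_mk]
          exact ⟨h2'.1, h3, by simpa using hno, h2'.2⟩
        · simp only [AllSub_append, AllSub_cons, kids_mk]
          simp only [AllSub_append, AllSub_cons] at hno
          exact ⟨⟨h3, hno, h2'.1⟩, h2'.2⟩

-- Absence of safe operations in the final tree

/-- The simplified tree. -/
def simplified (Q : ℕ) (F : List TBranch) : List TBranch :=
  (norm Q (simplify Q F).1 (simplify Q F).2).1 ++ (norm Q (simplify Q F).1 (simplify Q F).2).2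

lemma simplified_steps {Q : ℕ} (hQ : 0 < Q) (F : List TBranch) (hF : AllSub (LeafOK Q) F) :
    Relation.ReflTransGen (Step Q) F (simplified Q F) :=
  (simplify_reach hQ F hF).norm.reflTransGen

lemma simplified_nodeOK {Q : ℕ} (hQ : 0 < Q) (F : List TBranch) (hF : AllSub (LeafOK Q) F) :
    AllSub (NodeOK Q) (simplified Q F) :=
  norm_nodeOK hQ _ _ (simplify_nodeOK hQ F hF)
    (steps_leafOK hQ (simplify_reach hQ F hF).reflTransGen hF)

lemma simplified_compact (Q : ℕ) (F : List TBranch) : Compact Q (simplified Q F) :=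
  compact_norm _ _ _

lemma perm_cons_of_erase {F : List TBranch} {x : Branch} {r : List Branch}
    (h : (F.map erase).Perm (x :: r)) :
    ∃ w G, F.Perm (w :: G) ∧ w.erase = x ∧ (G.map erase).Perm r := by
  obtain ⟨w, hw, rfl⟩ := List.mem_map.1 (h.mem_iff.2 (List.mem_cons_self (a := x) (l := r)))
  obtain ⟨s, t, rfl⟩ := List.append_of_mem hw
  refine ⟨w, s ++ t, List.perm_middle, rfl, ?_⟩
  have := (List.perm_middle (l₁ := s) (l₂ := t) (a := w)).map erase
  exact (List.perm_cons _).1 (this.symm.trans h)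

lemma leaf_of_erase {w : TBranch} {l d : ℕ} (h : w.erase = leaf l d) :
    w.kids = [] ∧ amount w.its = d ∧ w.len = l := by
  obtain ⟨l', I, ks⟩ := w
  simp only [erase_mk, Branch.mk.injEq, List.map_eq_nil_iff] at h
  exact ⟨h.2.2, h.2.1, h.1⟩

/-- Each property excludes one operation: demand above `Q` excludes `condense`, the strict
inequality for the sum of traffics `unzip`, the one for single children `slide`, and the two halves
of `Compact` exclude `unite` and `group`. -/
theorem exhausted_of_nodeOK {Q : ℕ} (hQ : 0 < Q) {F : List TBranch} (hn : AllSub (NodeOK Q) F)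
    (hl : AllSub (LeafOK Q) F) (hc : Compact Q F) : Exhausted Q (F.map erase) := by
  intro bs' h
  generalize hbs : F.map erase = bs at h
  induction h generalizing F with
  | @condense bs r l d cs h hcs hf =>
    subst hbs
    obtain ⟨w, G, hF, hw, -⟩ := perm_cons_of_erase h
    obtain ⟨l', I, ks⟩ := w
    rw [hF.allSub_iff] at hn hl
    simp only [AllSub_cons, kids_mk] at hn hl
    rw [← hw, traffic_erase, TBranch.traffic, ceilDiv_eq_one_iff hQ] at hf
    simp only [erase_mk, Branch.mk.injEq] at hw
    have hk : ks ≠ [] := by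
      rintro rfl
      simp at hw
      exact hcs hw.2.2
    have := (hn.1 hk).1
    simp at hf this
    omega
  | @unzip bs r l cs h hcs hf =>
    subst hbs
    obtain ⟨w, G, hF, hw, -⟩ := perm_cons_of_erase h
    obtain ⟨l', I, ks⟩ := w
    rw [hF.allSub_iff] at hn hl
    simp only [AllSub_cons, kids_mk] at hn hl
    rw [← hw, traffic_erase, TBranch.traffic] at hf
    simp only [erase_mk, Branch.mk.injEq] at hw
    have hk : ks ≠ [] := by
      rintro rfl
      simp at hw
      exact hcs hw.2.2
    rw [← hw.2.2, trafficSum_erase, items_mk, show I = [] from hl.1.2 hk] at hf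
    have := (hn.1 hk).2.1
    simp at hf this
    omega
  | group h hr hlo hhi =>
    subst hbs
    obtain ⟨a, G, hF, ha, h⟩ := perm_cons_of_erase h
    obtain ⟨b, G₂, hF₂, hb, h⟩ := perm_cons_of_erase h
    obtain ⟨c, G₃, hF₃, hc', h⟩ := perm_cons_of_erase h
    obtain ⟨ka, da, -⟩ := leaf_of_erase ha
    obtain ⟨kb, db, -⟩ := leaf_of_erase hb
    obtain ⟨kc, dc, -⟩ := leaf_of_erase hc'
    have := hc.2 a b c G₃ (hF.trans ((hF₂.trans (hF₃.cons _)).cons _)) ka kb kc (by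
      rintro rfl
      exact hr (by simpa using h.length_eq.symm))
    omega
  | unite h hd =>
    subst hbs
    obtain ⟨a, G, hF, ha, h⟩ := perm_cons_of_erase h
    obtain ⟨b, G₂, hF₂, hb, h⟩ := perm_cons_of_erase h
    obtain ⟨ka, da, -⟩ := leaf_of_erase ha
    obtain ⟨kb, db, -⟩ := leaf_of_erase hb
    have := hc.1 a b G₂ (hF.trans (hF₂.cons _)) ka kb
    omega
  | @slide bs r l d cs l₁ d₁ cs₁ b r' h hcs hcs₁ hf =>
    subst hbs
    obtain ⟨w, G, hF, hw, -⟩ := perm_cons_of_erase h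
    obtain ⟨l', I, ks⟩ := w
    rw [hF.allSub_iff] at hn hl
    simp only [AllSub_cons, kids_mk] at hn hl
    rw [← hw, traffic_erase, TBranch.traffic, items_mk] at hf
    simp only [erase_mk, Branch.mk.injEq] at hw
    rw [← hw.2.2] at hcs
    obtain ⟨w₁, G₁, hF₁, hw₁, -⟩ := perm_cons_of_erase hcs
    have hk : ks ≠ [] := by
      rintro rfl
      simp at hF₁
    have hk₁ : w₁.kids ≠ [] := by
      intro h0
      obtain ⟨l₂, I₂, ks₂⟩ := w₁
      simp only [kids_mk] at h0
      subst h0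
      simp at hw₁
      exact hcs₁ hw₁.2.2
    rw [← hw₁, traffic_erase, show I = [] from hl.1.2 hk] at hf
    have := (hn.1 hk).2.2.1 w₁ (hF₁.mem_iff.2 (by simp)) hk₁
    simp at hf this
    omega
  | @inside bs r l d cs cs' h hop ih =>
    subst hbs
    obtain ⟨w, G, hF, hw, -⟩ := perm_cons_of_erase h
    obtain ⟨l', I, ks⟩ := w
    rw [hF.allSub_iff] at hn hl
    simp only [AllSub_cons, kids_mk] at hn hl
    simp only [erase_mk, Branch.mk.injEq] at hw
    refine ih hn.2.1 hl.2.1 ?_ hw.2.2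
    by_cases hk : ks = []
    · subst hk
      constructor <;> simp
    · exact (hn.1 hk).2.2.2

lemma of_branchAt {p : TBranch → Prop} {q : Branch → Prop} (hpq : ∀ w, p w → q w.erase)
    {F : List TBranch} (hF : AllSub p F) {v : Vertex} {b : Branch}
    (h : branchAt (F.map erase) v = some b) : q b := by
  induction v generalizing F with
  | nil => simp [branchAt] at h
  | cons i v ih =>
    rw [AllSub_iff] at hF
    cases v with
    | nil =>
      simp only [branchAt, List.getElem?_map, Option.map_eq_some_iff] at h
      obtain ⟨w, hw, rfl⟩ := h
      exact hpq w (hF w (List.mem_of_getElem? hw)).1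
    | cons j v =>
      simp only [branchAt, List.getElem?_map, Option.bind_eq_some_iff,
        Option.map_eq_some_iff] at h
      obtain ⟨_, ⟨w, hw, rfl⟩, h⟩ := h
      refine ih (hF w (List.mem_of_getElem? hw)).2 ?_
      obtain ⟨l, I, ks⟩ := w
      simpa [Branch.children] using h

/-- Demand of the leaves is less than the capacity. -/
def StrictLeaf (Q : ℕ) (b : TBranch) : Prop := b.kids = [] → amount b.its < Q

theorem simplified_of_nodeOK {Q : ℕ} (hQ : 0 < Q) {F : List TBranch} (hn : AllSub (NodeOK Q) F)
    (hl : AllSub (LeafOK Q) F) (hc : Compact Q F) (hs : AllSub (StrictLeaf Q) F) :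
    Simplified Q (F.map erase) where
  exhausted := exhausted_of_nodeOK hQ hn hl hc
  demand v b h := by
    have h1 := of_branchAt (q := fun b => (b.children ≠ [] → b.dem = 0) ∧
      (b.children = [] → 0 < b.dem)) (fun w hw => ?_) hl h
    · have h2 := of_branchAt (q := fun b => b.children = [] → b.dem < Q) (fun w hw => ?_) hs h
      · exact ⟨h1.1, fun h => ⟨h1.2 h, h2 h⟩⟩
      · obtain ⟨l, I, ks⟩ := w
        simpa [Branch.children, Branch.dem, StrictLeaf] using hw
    · obtain ⟨l, I, ks⟩ := w
      simp only [erase_mk, Branch.children, Branch.dem, ne_eq, List.map_eq_nil_iff]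
      exact ⟨fun h => by simp [show I = [] from hw.2 h], fun h => (hw.1 h).1⟩
  degree v b h := by
    refine of_branchAt (q := fun b => b.children.length ≠ 1) (fun w hw => ?_)
      (p := fun b => NodeOK Q b ∧ LeafOK Q b) ?_ h
    · obtain ⟨l, I, ks⟩ := w
      simp only [erase_mk, Branch.children, List.length_map]
      intro h1
      obtain ⟨c, rfl⟩ := List.length_eq_one_iff.1 h1
      -- A single child would have the traffic of the stem, against the strict inequality.
      have := (hw.1 (by simp)).2.1
      simp [TBranch.traffic] at this
    · have key : ∀ F : List TBranch, AllSub (NodeOK Q) F → AllSub (LeafOK Q) F →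
          AllSub (fun b => NodeOK Q b ∧ LeafOK Q b) F := by
        intro F
        induction F using forest_induction with
        | nil => simp
        | cons l I cs r h1 h2 =>
          simp only [AllSub_cons, kids_mk]
          exact fun h h' => ⟨⟨h.1, h'.1⟩, h1 h.2.1 h'.2.1, h2 h.2.2 h'.2.2⟩
      exact key F hn hl

/-! ## Tours -/

/-- The amount of demand at `v`. -/
def amt (I : List Item) (v : Vertex) : ℕ := amount (I.filter fun x => x.1 = v)

@[simp] lemma amt_nil (v) : amt [] v = 0 := rfl
lemma amt_cons (x : Item) (I : List Item) (v) :
    amt (x :: I) v = (if x.1 = v then x.2 else 0) + amt I v := by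
  unfold amt
  by_cases h : x.1 = v <;> simp [h]
@[simp] lemma amt_append (I J : List Item) (v) : amt (I ++ J) v = amt I v + amt J v := by
  simp [amt]
lemma _root_.List.Perm.amt_eq {I J : List Item} (h : I.Perm J) (v) : amt I v = amt J v :=
  (h.filter _).amount_eq
lemma le_amt {I : List Item} {x : Item} (h : x ∈ I) : x.2 ≤ amt I x.1 := by
  induction I with
  | nil => simp at h
  | cons y I ih =>
    rw [amt_cons]
    rcases List.mem_cons.1 h with rfl | h
    · simp
    · have := ih h
      omega
lemma amt_eq_zero {I : List Item} {v : Vertex} (h : v ∉ I.map Prod.fst) : amt I v = 0 := by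
  induction I with
  | nil => rfl
  | cons y I ih =>
    simp only [List.map_cons, List.mem_cons, not_or] at h
    rw [amt_cons, ih h.2, if_neg (fun h' => h.1 h'.symm)]
lemma amt_of_nodup {I : List Item} (hI : (I.map Prod.fst).Nodup) {x : Item} (h : x ∈ I) :
    amt I x.1 = x.2 := by
  induction I with
  | nil => simp at h
  | cons y I ih =>
    simp only [List.map_cons, List.nodup_cons] at hI
    rw [amt_cons]
    rcases List.mem_cons.1 h with rfl | h
    · simp [amt_eq_zero hI.1]
    · have : y.1 ≠ x.1 := fun e => hI.1 (e ▸ List.mem_map_of_mem h)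
      rw [if_neg this, ih hI.2 h, zero_add]

/-- Demand that is not covered by `S`. -/
def resid (S : List Item) (x : Item) : ℕ := x.2 - amt S x.1

lemma resid_le (S : List Item) (x : Item) : resid S x ≤ x.2 := Nat.sub_le _ _

lemma amount_le_sum_amt {S I : List Item} (h : ∀ y ∈ S, y.1 ∈ I.map Prod.fst) :
    amount S ≤ (I.map fun x => amt S x.1).sum := by
  induction S with
  | nil => simp
  | cons y S ih =>
    have h1 := ih fun z hz => h z (List.mem_cons_of_mem _ hz)
    simp only [amt_cons, amount_cons]
    rw [List.sum_map_add]
    refine add_le_add ?_ h1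
    obtain ⟨x, hx, hxy⟩ := List.mem_map.1 (h y (by simp))
    exact List.single_le_sum (by simp) _ (List.mem_map.2 ⟨x, hx, by simp [hxy]⟩)

/-- As addresses are distinct, an item is all the demand at its vertex. So the truncated differences
cut nothing off, and no covered unit is subtracted twice. -/
lemma resid_sum {S I : List Item} (hI : (I.map Prod.fst).Nodup)
    (hS : ∀ v, amt S v ≤ amt I v) (hsub : ∀ y ∈ S, y.1 ∈ I.map Prod.fst) :
    (I.map (resid S)).sum + amount S ≤ amount I := by
  have h1 := amount_le_sum_amt hsub
  have h2 : (I.map (resid S)).sum + (I.map fun x => amt S x.1).sum = amount I := by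
    rw [← List.sum_map_add]
    refine congrArg _ (List.map_congr_left fun x hx => ?_)
    have := hS x.1
    rw [amt_of_nodup hI hx] at this
    simp only [resid]
    omega
  omega

/-- Covering `R` units lowers the traffic of an edge above them by at least `⌊R / Q⌋`, whatever
other demand is below that edge. So this gain can be credited before the edge is reached. -/
lemma ceilDiv_add_div_le {Q A R D : ℕ} (hQ : 0 < Q) (h : A + R ≤ D) :
    A ⌈/⌉ Q + R / Q ≤ D ⌈/⌉ Q := by
  have h1 : D ≤ Q * (D ⌈/⌉ Q) := (ceilDiv_le_iff_le_mul hQ).1 le_rfl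
  have h2 : Q * (R / Q) ≤ R := Nat.mul_div_le R Q
  have h3 : R / Q ≤ D ⌈/⌉ Q := by
    by_contra hc
    have := Nat.mul_le_mul_left Q (show D ⌈/⌉ Q + 1 ≤ R / Q by omega)
    rw [mul_add] at this
    omega
  have h4 : A ⌈/⌉ Q ≤ D ⌈/⌉ Q - R / Q := by
    rw [ceilDiv_le_iff_le_mul hQ, Nat.mul_sub]
    omega
  omega

lemma cost_mono {g : ℕ → ℕ} (hg : Monotone g) {wt wt' : Item → ℕ} (F : List TBranch)
    (h : ∀ x ∈ collect F, wt x ≤ wt' x) : cost g wt F ≤ cost g wt' F := by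
  induction F using forest_induction with
  | nil => simp
  | cons l I cs r h1 h2 =>
    have hs : ∀ J : List Item, (∀ x ∈ J, wt x ≤ wt' x) → (J.map wt).sum ≤ (J.map wt').sum :=
      fun J hJ => List.sum_le_sum hJ
    simp only [collect_cons, items_mk, List.mem_append] at h
    rw [cost_mk, cost_mk]
    refine add_le_add (add_le_add (Nat.mul_le_mul_left _ (hg (add_le_add ?_ ?_))) ?_) ?_
    · exact hs _ fun x hx => h x (.inl (.inl hx))
    · exact hs _ fun x hx => h x (.inl (.inr hx))
    · exact h1 fun x hx => h x (.inl (.inr hx))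
    · exact h2 fun x hx => h x (.inr hx)

lemma cost_zero {g : ℕ → ℕ} (hg : Subadd g) {wt : Item → ℕ} (F : List TBranch)
    (h : ∀ x ∈ collect F, wt x = 0) : cost g wt F = 0 := by
  have h1 := cost_le_totLen hg wt F
  have h2 : ((collect F).map wt).sum = 0 :=
    List.sum_eq_zero fun n hn => by
      obtain ⟨x, hx, rfl⟩ := List.mem_map.1 hn
      exact h x hx
  rw [h2, hg.zero, mul_zero] at h1
  omega

-- Lengths of tours, and the inductive form of an approximate tour set

/-- Indicator of the vertices at which demand is covered. -/
def ind (t : List Item) (x : Item) : ℕ := if x.1 ∈ t.map Prod.fst then 1 else 0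

/-- Half of the length of a tour through the items of `t`. -/
def St (F : List TBranch) (t : List Item) : ℕ := cost (min · 1) (ind t) F

/-- The addresses of the items of `t` occur in `I`. -/
def Within (t I : List Item) : Prop := ∀ y ∈ t, y.1 ∈ I.map Prod.fst

lemma Within.mono {t I J : List Item} (h : Within t I) (hIJ : ∀ x ∈ I, x ∈ J) : Within t J :=
  fun y hy => by
    obtain ⟨x, hx, e⟩ := List.mem_map.1 (h y hy)
    exact List.mem_map.2 ⟨x, hIJ x hx, e⟩
lemma Within.append {t t' I : List Item} (h : Within t I) (h' : Within t' I) :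
    Within (t ++ t') I := fun y hy => (List.mem_append.1 hy).elim (h y) (h' y)
lemma Within.refl (I : List Item) : Within I I := fun _ hy => List.mem_map_of_mem hy

lemma St_append_le (F : List TBranch) (t t' : List Item) : St F (t ++ t') ≤ St F t + St F t' := by
  have hadd : ∀ J : List Item, (J.map (ind (t ++ t'))).sum ≤
      (J.map (ind t)).sum + (J.map (ind t')).sum := fun J => by
    rw [← List.sum_map_add]
    refine List.sum_le_sum fun x _ => ?_
    unfold ind
    simp only [List.map_append, List.mem_append]
    split_ifs <;> simp_all
  unfold St
  induction F using forest_induction with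
  | nil => simp
  | cons l I cs r h1 h2 =>
    rw [cost_cons, cost_cons _ (ind t), cost_cons _ (ind t')]
    have := Nat.mul_le_mul_left l ((subadd_min.mono (hadd (I ++ collect cs))).trans
      (subadd_min.add_le _ _))
    rw [mul_add] at this
    simp only [len_mk, items_mk, kids_mk]
    omega

/-- Addresses do not repeat, so no edge outside `G` leads to an item of `t`. -/
lemma St_restrict {F G r : List TBranch} (hF : F.Perm (G ++ r))
    (hnd : ((collect F).map Prod.fst).Nodup) {t : List Item} (ht : Within t (collect G)) :
    St F t = St G t := by
  have h1 := (hF.collect.map Prod.fst).nodup_iff.1 hnd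
  rw [collect_append, List.map_append] at h1
  have hdisj := (List.nodup_append.1 h1).2.2
  unfold St
  rw [hF.cost_eq, cost_append, cost_zero subadd_min r, add_zero]
  intro x hx
  unfold ind
  rw [if_neg]
  intro hx'
  obtain ⟨y, hy, e⟩ := List.mem_map.1 hx'
  exact hdisj _ (ht y hy) _ (List.mem_map_of_mem hx) e

lemma St_le_totLen (F : List TBranch) (t : List Item) : St F t ≤ totLen F :=
  (cost_le_totLen subadd_min _ F).trans
    ((Nat.mul_le_mul_left _ (min_le_right _ _)).trans (mul_one _).le)

lemma St_leaf_le {F r : List TBranch} {w : TBranch} (hF : F.Perm (w :: r)) (hw : w.kids = [])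
    (hnd : ((collect F).map Prod.fst).Nodup) {t : List Item} (ht : Within t w.its) :
    St F t ≤ w.len := by
  rw [St_restrict (G := [w]) hF hnd (ht.mono (by simp [items_eq]; tauto))]
  refine (St_le_totLen _ _).trans ?_
  simp [hw]

lemma St_node_le {F r : List TBranch} {w : TBranch} (hF : F.Perm (w :: r))
    (hnd : ((collect F).map Prod.fst).Nodup) {t : List Item} (ht : Within t (collect w.kids)) :
    St F t ≤ w.len + St w.kids t := by
  rw [St_restrict (G := [w]) hF hnd (ht.mono (by simp [items_eq]; tauto))]
  unfold St
  rw [cost_cons, cost_nil, add_zero]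
  refine add_le_add_left ?_ _
  calc _ ≤ w.len * 1 := Nat.mul_le_mul_left _ (min_le_right _ _)
    _ = _ := mul_one _

/-- A nonempty `4/3`-approximate tour set, for branches at a vertex at distance `x` from the
depot. -/
structure Sol (Q x : ℕ) (F : List TBranch) (ts : List (List Item)) : Prop where
  ne : ts ≠ []
  cap : ∀ t ∈ ts, 0 < amount t ∧ amount t ≤ Q
  sub : ∀ t ∈ ts, Within t (collect F)
  amt_le : ∀ v, amt ts.flatten v ≤ amt (collect F) v
  -- This bound plays no role for the approximation; it limits the running time and the size of the
  -- output.
  length_le : ts.flatten.length ≤ 3 * (collect F).length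
  -- All lengths are halved. Every tour pays for the path of length `x`, and the path earns the
  -- guaranteed decrease `⌊covered / Q⌋` of the traffic of its edges. At the depot, where `x = 0`,
  -- the credit disappears.
  approx : 3 * (ts.map fun t => x + St F t).sum + 4 * cost (· ⌈/⌉ Q) (resid ts.flatten) F ≤
    4 * (x * (amount ts.flatten / Q) + cost (· ⌈/⌉ Q) Prod.snd F)

lemma Within.flatten {ts : List (List Item)} {I : List Item} (h : ∀ t ∈ ts, Within t I) :
    Within ts.flatten I := fun y hy => by
  obtain ⟨t, ht, hy⟩ := List.mem_flatten.1 hy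
  exact h t ht y hy

/-- Passing the stem turns the credit for its length into an actual decrease of its traffic, by
`ceilDiv_add_div_le`. -/
lemma Sol.inside {Q x l : ℕ} (hQ : 0 < Q) {cs r : List TBranch} {ts : List (List Item)}
    (h : Sol Q (x + l) cs ts) (hnd : ((collect (.mk l [] cs :: r)).map Prod.fst).Nodup) :
    Sol Q x (.mk l [] cs :: r) ts where
  ne := h.ne
  cap := h.cap
  sub t ht := (h.sub t ht).mono (by simp; tauto)
  amt_le v := (h.amt_le v).trans (by simp)
  length_le := h.length_le.trans (by simp)
  approx := by
    have h1 : (ts.map fun t => x + St (.mk l [] cs :: r) t).sum ≤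
        (ts.map fun t => x + l + St cs t).sum := by
      refine List.sum_le_sum fun t ht => ?_
      have := St_node_le (.refl _) hnd (h.sub t ht)
      simp only [len_mk, kids_mk] at this
      omega
    have h2 : cost (· ⌈/⌉ Q) (resid ts.flatten) r ≤ cost (· ⌈/⌉ Q) Prod.snd r :=
      cost_mono (subadd_ceilDiv hQ).mono _ fun x _ => resid_le _ x
    have hcs : ((collect cs).map Prod.fst).Nodup := by
      rw [collect_cons, List.map_append] at hnd
      exact (List.nodup_append.1 hnd).1
    have h3 := ceilDiv_add_div_le hQ (resid_sum hcs h.amt_le (Within.flatten h.sub))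
    have h4 := Nat.mul_le_mul_left l h3
    have h5 := h.approx
    simp only [cost_mk, List.map_nil, List.sum_nil, zero_add]
    simp only [amount] at h4 h5 ⊢
    rw [mul_add] at h4
    rw [add_mul] at h5
    omega

lemma Sol.cons {Q x : ℕ} (hQ : 0 < Q) {w : TBranch} {r : List TBranch} {ts : List (List Item)}
    (h : Sol Q x r ts) (hnd : ((collect (w :: r)).map Prod.fst).Nodup) :
    Sol Q x (w :: r) ts where
  ne := h.ne
  cap := h.cap
  sub t ht := (h.sub t ht).mono (by simp; tauto)
  amt_le v := (h.amt_le v).trans (by simp)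
  length_le := h.length_le.trans (by simp)
  approx := by
    have h1 : (ts.map fun t => x + St (w :: r) t).sum = (ts.map fun t => x + St r t).sum := by
      refine congrArg _ (List.map_congr_left fun t ht => ?_)
      rw [St_restrict (G := r) (r := [w]) ?_ hnd (h.sub t ht)]
      exact List.perm_append_comm (l₁ := [w])
    have h2 : cost (· ⌈/⌉ Q) (resid ts.flatten) [w] ≤ cost (· ⌈/⌉ Q) Prod.snd [w] :=
      cost_mono (subadd_ceilDiv hQ).mono _ fun x _ => resid_le _ x
    have h5 := h.approx
    have e : ∀ wt, cost (· ⌈/⌉ Q) wt (w :: r) = cost (· ⌈/⌉ Q) wt [w] + cost (· ⌈/⌉ Q) wt r :=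
      fun wt => cost_append _ wt [w] r
    rw [h1, e, e]
    omega

/-- The branches `G` are covered entirely. -/
lemma cost_resid_le {Q : ℕ} (hQ : 0 < Q) {F G r : List TBranch} (hF : F.Perm (G ++ r))
    {S : List Item} (h : ∀ v, amt (collect G) v ≤ amt S v) :
    cost (· ⌈/⌉ Q) (resid S) F + cost (· ⌈/⌉ Q) Prod.snd G ≤ cost (· ⌈/⌉ Q) Prod.snd F := by
  rw [hF.cost_eq, hF.cost_eq, cost_append, cost_append, cost_zero (subadd_ceilDiv hQ) G]
  · have := cost_mono (subadd_ceilDiv hQ).mono (wt := resid S) r fun x _ => resid_le _ x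
    omega
  · intro x hx
    have := (le_amt hx).trans (h x.1)
    unfold resid
    omega

/-- All tour sets at a vertex are obtained in this way: the branches `G` are emptied and contribute
their whole lower bound, `k` counts full loads on the path to the depot, and any decrease in other
branches is ignored. -/
lemma Sol.of_cover {Q x : ℕ} (hQ : 0 < Q) {F G r : List TBranch} {ts : List (List Item)}
    (hF : F.Perm (G ++ r)) (ne : ts ≠ []) (cap : ∀ t ∈ ts, 0 < amount t ∧ amount t ≤ Q)
    (sub : ∀ t ∈ ts, Within t (collect F)) (amt_le : ∀ v, amt ts.flatten v ≤ amt (collect F) v)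
    (length_le : ts.flatten.length ≤ 3 * (collect F).length)
    (hG : ∀ v, amt (collect G) v ≤ amt ts.flatten v) (k : ℕ) (hk : k * Q ≤ amount ts.flatten)
    (h : 3 * (ts.map fun t => x + St F t).sum ≤ 4 * (x * k + cost (· ⌈/⌉ Q) Prod.snd G)) :
    Sol Q x F ts where
  ne := ne
  cap := cap
  sub := sub
  amt_le := amt_le
  length_le := length_le
  approx := by
    have h1 := cost_resid_le hQ hF hG
    have h2 := Nat.mul_le_mul_left x ((Nat.le_div_iff_mul_le hQ).2 hk)
    omega

/-! ### Splitting items -/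

/-- Split off items of total amount `q`. -/
def splitItems (q : ℕ) : List Item → List Item × List Item
  | [] => ([], [])
  | x :: I =>
    if x.2 ≤ q then (x :: (splitItems (q - x.2) I).1, (splitItems (q - x.2) I).2)
    else ([(x.1, q)], (x.1, x.2 - q) :: I)

lemma amt_splitItems (q : ℕ) (I : List Item) (v : Vertex) :
    amt (splitItems q I).1 v + amt (splitItems q I).2 v = amt I v := by
  induction I generalizing q with
  | nil => rfl
  | cons x I ih =>
    rw [splitItems]
    split_ifs with h
    · have := ih (q - x.2)
      simp only [amt_cons]
      omega
    · simp only [amt_cons, amt_nil]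
      split_ifs <;> omega

lemma amount_splitItems (q : ℕ) (I : List Item) :
    amount (splitItems q I).1 + amount (splitItems q I).2 = amount I := by
  induction I generalizing q with
  | nil => rfl
  | cons x I ih =>
    rw [splitItems]
    split_ifs with h
    · have := ih (q - x.2)
      simp only [amount_cons]
      omega
    · simp only [amount_cons, amount_nil]
      omega

lemma amount_splitItems_fst (q : ℕ) (I : List Item) :
    amount (splitItems q I).1 = min q (amount I) := by
  induction I generalizing q with
  | nil => simp [splitItems]
  | cons x I ih =>
    rw [splitItems]
    split_ifs with h
    · have := ih (q - x.2)
      simp only [amount_cons]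
      omega
    · simp only [amount_cons, amount_nil]
      omega

lemma within_splitItems (q : ℕ) (I : List Item) :
    Within (splitItems q I).1 I ∧ Within (splitItems q I).2 I := by
  induction I generalizing q with
  | nil => simp [splitItems, Within]
  | cons x I ih =>
    rw [splitItems]
    obtain ⟨h1, h2⟩ := ih (q - x.2)
    split_ifs with h
    · refine ⟨fun y hy => ?_, fun y hy => ?_⟩
      · rcases List.mem_cons.1 hy with rfl | hy
        · simp
        · exact List.mem_cons_of_mem _ (h1 y hy)
      · exact List.mem_cons_of_mem _ (h2 y hy)
    · refine ⟨fun y hy => ?_, fun y hy => ?_⟩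
      · rcases List.mem_cons.1 hy with rfl | hy
        · simp
        · simp at hy
      · rcases List.mem_cons.1 hy with rfl | hy
        · simp
        · exact List.mem_cons_of_mem _ (List.mem_map_of_mem hy)

/-- Only the item at which the cut falls can be duplicated. -/
lemma length_splitItems (q : ℕ) (I : List Item) :
    (splitItems q I).1.length + (splitItems q I).2.length ≤ I.length + 1 := by
  induction I generalizing q with
  | nil => simp [splitItems]
  | cons x I ih =>
    rw [splitItems]
    have := ih (q - x.2)
    split_ifs with h <;> simp <;> omega

/-! ### Sorting the branches at a vertex -/

def insertLen (b : TBranch) : List TBranch → List TBranch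
  | [] => [b]
  | c :: r => if b.len ≤ c.len then b :: c :: r else c :: insertLen b r

/-- The leaves, sorted by their lengths, and the other branches. -/
def part : List TBranch → List TBranch × List TBranch
  | [] => ([], [])
  | .mk l I [] :: r => (insertLen (.mk l I []) (part r).1, (part r).2)
  | .mk l I (c :: cs) :: r => ((part r).1, .mk l I (c :: cs) :: (part r).2)

lemma insertLen_perm (b : TBranch) (F : List TBranch) : (insertLen b F).Perm (b :: F) := by
  induction F with
  | nil => exact .refl _
  | cons c r ih =>
    rw [insertLen]
    split_ifs
    · exact .refl _
    · exact (ih.cons c).trans (.swap _ _ _)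

lemma insertLen_sorted (b : TBranch) {F : List TBranch}
    (h : F.Pairwise fun b c => b.len ≤ c.len) :
    (insertLen b F).Pairwise fun b c => b.len ≤ c.len := by
  induction F with
  | nil => simp [insertLen]
  | cons c r ih =>
    rw [List.pairwise_cons] at h
    rw [insertLen]
    split_ifs with hbc
    · refine List.pairwise_cons.2 ⟨?_, List.pairwise_cons.2 h⟩
      intro d hd
      rcases List.mem_cons.1 hd with rfl | hd
      · exact hbc
      · exact hbc.trans (h.1 d hd)
    · refine List.pairwise_cons.2 ⟨?_, ih h.2⟩
      intro d hd
      rcases List.mem_cons.1 ((insertLen_perm b r).mem_iff.1 hd) with rfl | hd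
      · omega
      · exact h.1 d hd

lemma part_spec (F : List TBranch) : F.Perm ((part F).1 ++ (part F).2) ∧
    (∀ b ∈ (part F).1, b.kids = []) ∧ (∀ b ∈ (part F).2, b.kids ≠ []) ∧
    (part F).1.Pairwise fun b c => b.len ≤ c.len := by
  induction F with
  | nil => simp [part]
  | cons b r ih =>
    obtain ⟨h1, h2, h3, h4⟩ := ih
    rcases b with ⟨l, I, _ | ⟨c, cs⟩⟩
    · rw [part]
      refine ⟨(h1.cons _).trans ?_, ?_, h3, insertLen_sorted _ h4⟩
      · exact ((insertLen_perm _ _).symm.append_right _)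
      · intro b hb
        rcases List.mem_cons.1 ((insertLen_perm _ _).mem_iff.1 hb) with rfl | hb
        · rfl
        · exact h2 b hb
    · rw [part]
      refine ⟨(h1.cons _).trans List.perm_middle.symm, h2, ?_, h4⟩
      intro b hb
      rcases List.mem_cons.1 hb with rfl | hb
      · simp
      · exact h3 b hb

lemma sizeOf_kids_lt {cs : List TBranch} {n : TBranch} (h : n ∈ (part cs).2) :
    sizeOf n.kids < sizeOf cs := by
  have h1 : n ∈ cs := (part_spec cs).1.mem_iff.2 (List.mem_append_right _ h)
  have h2 := List.sizeOf_lt_of_mem h1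
  obtain ⟨l, I, ks⟩ := n
  simp only [kids_mk]
  have : sizeOf ks < sizeOf (TBranch.mk l I ks) := by
    simp
  omega

-- The search for tours

/-- Tours that cover a long chain, where the first one leaves room for `r` units. -/
def chain (Q r : ℕ) (cs : List TBranch) : List Item × List (List Item) :=
  match (part cs).1 with
  -- The leaves are sorted, so the shortest one, `c`, is the one visited twice. The tour through `a`
  -- takes as much of `c` as its capacity minus the reserved `r` allows.
  | c :: b :: a :: _ =>
    (a.its ++ (splitItems (Q - r - amount a.its) c.its).1,
      [b.its ++ (splitItems (Q - r - amount a.its) c.its).2])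
  -- The tour through the longer leaf `a` is filled up with a part of `s`. The rest of `s` joins the
  -- first tour of the smaller chain, which therefore reserves room for it on top of `r`.
  | s :: a :: [] =>
    match _h : (part cs).2 with
    | [] => ([], [])
    | n :: _ =>
      match chain Q (r + amount (splitItems (Q - amount a.its) s.its).2) n.kids with
      | (t, ts) => ((splitItems (Q - amount a.its) s.its).2 ++ t,
          (a.its ++ (splitItems (Q - amount a.its) s.its).1) :: ts)
  | _ => ([], [])
termination_by sizeOf cs
decreasing_by exact sizeOf_kids_lt (by rw [_h]; simp)

/-- Tours for three leaves of total demand at least `2 * Q`. -/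
def triple (Q x : ℕ) (c b a : TBranch) : List (List Item) :=
  if 2 * c.len ≤ x then
    [a.its ++ (splitItems (Q - amount a.its) c.its).1,
      b.its ++ (splitItems (Q - amount b.its) (splitItems (Q - amount a.its) c.its).2).1]
  else [a.its, b.its, c.its]

/-- Tours at a vertex at distance `x` from the depot. -/
def findHere (Q x : ℕ) (cs : List TBranch) : List (List Item) :=
  match part cs with
  | (_, n₁ :: n₂ :: _) =>
    (chain Q 0 n₁.kids).1 :: (chain Q 0 n₁.kids).2 ++
      (chain Q 0 n₂.kids).1 :: (chain Q 0 n₂.kids).2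
  -- Exactly three leaves may form a `2`-chain, so this pattern has to come before the one for three
  -- leaves.
  | ([_, _, _], []) => []
  | (c :: b :: a :: _, _) => triple Q x c b a
  | ([s, a], _) => if x ≤ s.len then [a.its, s.its] else []
  | _ => []

/-- Search for tours, for branches at a vertex at distance `x` from the depot. -/
def find (Q x : ℕ) : List TBranch → List (List Item)
  | [] => []
  -- A leaf filled up to `Q` by `condense` or `unite` is served by a tour of its own.
  | .mk _ I [] :: r => if Q ≤ amount I then [I] else find Q x r
  | .mk l _ (c :: cs) :: r =>
    match find Q (x + l) (c :: cs) with
    | t :: ts => t :: ts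
    | [] =>
      match findHere Q (x + l) (c :: cs) with
      | t :: ts => t :: ts
      | [] => find Q x r

-- Demand of long chains and tours that serve them

/-- `LC Q x p cs`: the branches `cs` at a vertex at distance `x` from the depot are those of a long
`p`-chain. -/
inductive LC (Q : ℕ) : ℕ → ℕ → List TBranch → Prop
  | two {x : ℕ} {cs : List TBranch} {c b a : TBranch} (h : part cs = ([c, b, a], []))
      (hlo : 3 * Q < 2 * amount (collect cs)) (hhi : amount (collect cs) ≤ 2 * Q) : LC Q x 2 cs
  | succ {x p : ℕ} {cs : List TBranch} {s a n : TBranch} (h : part cs = ([s, a], [n]))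
      (hlo : Q < amount s.its + amount a.its) (hhi : 2 * (amount s.its + amount a.its) ≤ 3 * Q)
      (hD : amount (collect cs) ≤ (p + 1) * Q) (hlong : s.len < x)
      (hn : LC Q (x + n.len) p n.kids) : LC Q x (p + 1) cs

lemma items_of_leaf {w : TBranch} (h : w.kids = []) : w.items = w.its := by
  rw [items_eq, h]
  simp

lemma items_of_node {Q : ℕ} {w : TBranch} (h : w.kids ≠ []) (hl : LeafOK Q w) :
    w.items = collect w.kids := by
  rw [items_eq, hl.2 h]
  simp

/-- A `2`-chain exceeds `1.5 Q` and every further level adds more than `Q`, so the demand lies in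
`((p - 1/2) Q, p Q]`. The half load is what counts when two chains meet. -/
lemma LC.demand {Q x p : ℕ} {cs : List TBranch} (h : LC Q x p cs) :
    2 ≤ p ∧ 2 * (p * Q) < 2 * amount (collect cs) + Q ∧ amount (collect cs) ≤ p * Q := by
  induction h with
  | two h hlo hhi => exact ⟨le_rfl, by omega, hhi⟩
  | @succ x p cs s a n h hlo hhi hD hlong hn ih =>
    refine ⟨by omega, ?_, hD⟩
    obtain ⟨h1, h2, -⟩ := part_spec cs
    rw [h] at h1 h2
    have e := h1.collect.amount_eq
    simp only [List.cons_append, List.nil_append, collect_cons, amount_append, collect_nil,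
      amount_nil, items_of_leaf (h2 s (by simp)), items_of_leaf (h2 a (by simp)),
      items_eq n] at e
    rw [add_mul]
    omega

lemma LC.ceilDiv {Q x p : ℕ} (hQ : 0 < Q) {cs : List TBranch} (h : LC Q x p cs) :
    amount (collect cs) ⌈/⌉ Q = p := by
  obtain ⟨h0, h1, h2⟩ := h.demand
  refine le_antisymm ((ceilDiv_le_iff_le_mul hQ).2 (by rwa [mul_comm])) ?_
  obtain ⟨k, rfl⟩ : ∃ k, p = k + 1 := ⟨p - 1, by omega⟩
  refine (lt_ceilDiv hQ).2 ?_
  rw [add_mul] at h1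
  rw [mul_comm Q k]
  omega

lemma cost_leaf {Q : ℕ} (hQ : 0 < Q) {w : TBranch} (h : w.kids = []) (hl : LeafOK Q w)
    (r : List TBranch) :
    cost (· ⌈/⌉ Q) Prod.snd (w :: r) = w.len + cost (· ⌈/⌉ Q) Prod.snd r := by
  have := traffic_leaf hQ hl h
  rw [TBranch.traffic, amount] at this
  rw [cost_cons, this, h]
  simp

lemma cost_node {Q : ℕ} {w : TBranch} (h : w.kids ≠ []) (hl : LeafOK Q w)
    (r : List TBranch) :
    cost (· ⌈/⌉ Q) Prod.snd (w :: r) = w.len * (amount (collect w.kids) ⌈/⌉ Q) +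
      cost (· ⌈/⌉ Q) Prod.snd w.kids + cost (· ⌈/⌉ Q) Prod.snd r := by
  rw [cost_cons, items_of_node h hl, amount]

lemma nodup_kids {F : List TBranch} {w : TBranch} (hw : w ∈ F)
    (hnd : ((collect F).map Prod.fst).Nodup) : ((collect w.kids).map Prod.fst).Nodup := by
  obtain ⟨s, t, rfl⟩ := List.append_of_mem hw
  simp only [collect_append, collect_cons, items_eq w, List.map_append] at hnd
  exact (List.nodup_append.1 (List.nodup_append.1 (List.nodup_append.1 hnd).2.1).1).2.1

lemma its_length_pos {Q : ℕ} {w : TBranch} (h : w.kids = []) (hl : LeafOK Q w) :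
    0 < w.its.length := by
  have := (hl.1 h).1
  by_contra h0
  have : w.its = [] := List.length_eq_zero_iff.1 (by omega)
  simp_all

/-- The surplus `2x` carries the induction. Write edges for their lengths. A `2`-chain costs `3 (2x
+ a + b + 2c) + 2x`, which is at most `8x + 4 (a + b + c)` because `c` is the shortest leaf edge.
One more level adds a tour and visits `s` twice. After inserting the induction hypothesis at
distance `x + n`, the claim reduces to `2s ≤ a + x + 2n`, which follows from `s ≤ a` and from `s <
x`, that is, from the chain being long. The assumption on `r` says that the free capacity of the `p`
tours suffices for the reserved room. -/
lemma chain_spec {Q : ℕ} (hQ : 0 < Q) {x p : ℕ} {cs : List TBranch} (h : LC Q x p cs)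
    (hl : AllSub (LeafOK Q) cs) (hn : AllSub (NodeOK Q) cs) (hc : Compact Q cs)
    (hnd : ((collect cs).map Prod.fst).Nodup) {r : ℕ} (hr : r + amount (collect cs) ≤ p * Q) :
    (0 < amount (chain Q r cs).1 ∧ amount (chain Q r cs).1 + r ≤ Q) ∧
    (∀ t ∈ (chain Q r cs).2, 0 < amount t ∧ amount t ≤ Q) ∧
    (Within (chain Q r cs).1 (collect cs) ∧ ∀ t ∈ (chain Q r cs).2, Within t (collect cs)) ∧
    (∀ v, amt (chain Q r cs).1 v + amt (chain Q r cs).2.flatten v = amt (collect cs) v) ∧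
    amount (chain Q r cs).1 + amount (chain Q r cs).2.flatten = amount (collect cs) ∧
    (chain Q r cs).1.length + (chain Q r cs).2.flatten.length ≤ 2 * (collect cs).length ∧
    3 * (x + St cs (chain Q r cs).1 + ((chain Q r cs).2.map fun t => x + St cs t).sum) + 2 * x ≤
      4 * (x * p + cost (· ⌈/⌉ Q) Prod.snd cs) := by
  induction h generalizing r with
  | @two x cs c b a h hlo hhi =>
    obtain ⟨h1, h2, -, h4⟩ := part_spec cs
    rw [h] at h1 h2 h4
    rw [chain, h]
    simp only
    simp only [List.append_nil] at h1
    have kc := h2 c (by simp)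
    have kb := h2 b (by simp)
    have ka := h2 a (by simp)
    have hl' := hl
    rw [h1.allSub_iff] at hl'
    simp only [AllSub_cons] at hl'
    have lc := hl'.1.1 kc
    have lb := hl'.2.2.1.1 kb
    have la := hl'.2.2.2.2.1.1 ka
    simp only [List.pairwise_cons, List.mem_cons, List.not_mem_nil, or_false] at h4
    have l1 := h4.1 b (by simp)
    have l2 := h4.1 a (by simp)
    have e : ∀ v, amt (collect cs) v = amt c.its v + (amt b.its v + amt a.its v) := fun v => by
      rw [h1.collect.amt_eq]
      simp [items_of_leaf, kc, kb, ka]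
    have e' := h1.collect.amount_eq
    have e'' := h1.collect.length_eq
    simp only [collect_cons, items_of_leaf kc, items_of_leaf kb, items_of_leaf ka, collect_nil,
      List.append_nil, amount_append, List.length_append] at e' e''
    have pcb := hc.1 c b [a] h1 kc kb
    have pca := hc.1 c a [b] (h1.trans ((List.Perm.swap _ _ _).cons _)) kc ka
    have q1 := amount_splitItems_fst (Q - r - amount a.its) c.its
    have q2 := amount_splitItems (Q - r - amount a.its) c.its
    obtain ⟨w1, w2⟩ := within_splitItems (Q - r - amount a.its) c.its
    have q3 := length_splitItems (Q - r - amount a.its) c.its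
    have q4 := amt_splitItems (Q - r - amount a.its) c.its
    have q5 := its_length_pos kc hl'.1
    generalize splitItems (Q - r - amount a.its) c.its = P at *
    have hp2 : cs.Perm (b :: c :: [a]) := h1.trans (.swap _ _ _)
    have hp3 : cs.Perm (a :: c :: [b]) := h1.trans
      (((List.Perm.swap _ _ _).cons _).trans (.swap _ _ _))
    have sa := St_leaf_le hp3 ka hnd (Within.refl _)
    have sb := St_leaf_le hp2 kb hnd (Within.refl _)
    have s1 := St_leaf_le h1 kc hnd w1
    have s2 := St_leaf_le h1 kc hnd w2
    have s3 := St_append_le cs a.its P.1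
    have s4 := St_append_le cs b.its P.2
    have hcost := h1.cost_eq (· ⌈/⌉ Q) Prod.snd
    rw [cost_leaf hQ kc hl'.1, cost_leaf hQ kb hl'.2.2.1, cost_leaf hQ ka hl'.2.2.2.2.1,
      cost_nil] at hcost
    have sub : ∀ w : TBranch, w.kids = [] → w ∈ cs → ∀ y ∈ w.its, y ∈ collect cs := by
      intro w hw hm y hy
      rw [collect_eq]
      exact List.mem_flatMap.2 ⟨w, hm, by rwa [items_of_leaf hw]⟩
    have ma := sub a ka (h1.mem_iff.2 (by simp))
    have mb := sub b kb (h1.mem_iff.2 (by simp))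
    have mc := sub c kc (h1.mem_iff.2 (by simp))
    simp only [amount_append, List.mem_singleton, forall_eq, List.flatten_cons, List.flatten_nil,
      List.append_nil, amt_append, List.length_append, List.map_cons, List.map_nil, List.sum_cons,
      List.sum_nil]
    refine ⟨⟨by omega, by omega⟩, ⟨by omega, by omega⟩,
      ⟨((Within.refl _).mono ma).append (w1.mono mc), ((Within.refl _).mono mb).append (w2.mono mc)⟩,
      fun v => ?_, by omega, by omega, ?_⟩
    · have := q4 v
      rw [e v]
      omega
    · rw [hcost]
      omega
  | @succ x p cs s a n h hlo hhi hD hlong hln ih =>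
    obtain ⟨h1, h2, h3, h4⟩ := part_spec cs
    rw [h] at h1 h2 h3 h4
    have hln' := hln.ceilDiv hQ
    rw [chain, h]
    simp only
    simp only [List.cons_append, List.nil_append] at h1
    have ks := h2 s (by simp)
    have ka := h2 a (by simp)
    have kn := h3 n (by simp)
    have hl' := hl
    have hn' := hn
    rw [h1.allSub_iff] at hl' hn'
    simp only [AllSub_cons] at hl' hn'
    have ls := hl'.1.1 ks
    have la := hl'.2.2.1.1 ka
    simp only [List.pairwise_cons, List.mem_cons, List.not_mem_nil, or_false] at h4
    have l1 := h4.1 a (by simp)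
    have e : ∀ v, amt (collect cs) v = amt s.its v + (amt a.its v + amt (collect n.kids) v) :=
        fun v => by
      rw [h1.collect.amt_eq]
      simp [items_of_leaf, ks, ka, items_of_node kn hl'.2.2.2.2.1]
    have e' := h1.collect.amount_eq
    have e'' := h1.collect.length_eq
    simp only [collect_cons, items_of_leaf ks, items_of_leaf ka, items_of_node kn hl'.2.2.2.2.1,
      collect_nil, List.append_nil, amount_append, List.length_append] at e' e''
    have q1 := amount_splitItems_fst (Q - amount a.its) s.its
    have q2 := amount_splitItems (Q - amount a.its) s.its
    obtain ⟨w1, w2⟩ := within_splitItems (Q - amount a.its) s.its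
    have q3 := length_splitItems (Q - amount a.its) s.its
    have q4 := amt_splitItems (Q - amount a.its) s.its
    have q5 := its_length_pos ks hl'.1
    generalize splitItems (Q - amount a.its) s.its = P at *
    have hp2 : cs.Perm (a :: s :: [n]) := h1.trans (.swap _ _ _)
    have hp3 : cs.Perm (n :: s :: [a]) := h1.trans
      (((List.Perm.swap _ _ _).cons _).trans (.swap _ _ _))
    -- The tour through `a` carries exactly `Q`, as the two leaves exceed `Q`. So one load less
    -- remains for one tour less, even with the rest of `s` added to the reserve.
    have ih' := ih hl'.2.2.2.2.2.1 hn'.2.2.2.2.2.1 (hn'.2.2.2.2.1 kn).2.2.2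
      (nodup_kids (h1.mem_iff.2 (by simp)) hnd) (r := r + amount P.2) (by
        rw [add_mul] at hr
        omega)
    generalize chain Q (r + amount P.2) n.kids = C at *
    obtain ⟨⟨i1, i2⟩, i3, ⟨i4, i5⟩, i6, i7, i8, i9⟩ := ih'
    have sa := St_leaf_le hp2 ka hnd (Within.refl _)
    have s1 := St_leaf_le h1 ks hnd w1
    have s2 := St_leaf_le h1 ks hnd w2
    have s3 := St_append_le cs a.its P.1
    have s4 := St_append_le cs P.2 C.1
    have s5 := St_node_le hp3 hnd i4
    have s6 : (C.2.map fun t => x + St cs t).sum ≤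
        (C.2.map fun t => x + n.len + St n.kids t).sum := by
      refine List.sum_le_sum fun t ht => ?_
      have := St_node_le hp3 hnd (i5 t ht)
      omega
    have hcost := h1.cost_eq (· ⌈/⌉ Q) Prod.snd
    rw [cost_leaf hQ ks hl'.1, cost_leaf hQ ka hl'.2.2.1, cost_node kn hl'.2.2.2.2.1,
      cost_nil, hln'] at hcost
    have sub : ∀ w : TBranch, w ∈ cs → ∀ y ∈ w.items, y ∈ collect cs := by
      intro w hm y hy
      rw [collect_eq]
      exact List.mem_flatMap.2 ⟨w, hm, hy⟩
    have ma := sub a (h1.mem_iff.2 (by simp))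
    have ms := sub s (h1.mem_iff.2 (by simp))
    have mn := sub n (h1.mem_iff.2 (by simp))
    rw [items_of_leaf ka] at ma
    rw [items_of_leaf ks] at ms
    rw [items_of_node kn hl'.2.2.2.2.1] at mn
    simp only [amount_append, List.mem_cons, forall_eq_or_imp, List.flatten_cons,
      amt_append, List.length_append, List.map_cons, List.sum_cons]
    refine ⟨⟨by omega, by omega⟩, ⟨⟨by omega, by omega⟩, i3⟩,
      ⟨(w2.mono ms).append (i4.mono mn),
        ((Within.refl _).mono ma).append (w1.mono ms), fun t ht => (i5 t ht).mono mn⟩,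
      fun v => ?_, by omega, by omega, ?_⟩
    · have := q4 v
      have := i6 v
      rw [e v]
      omega
    · rw [hcost, mul_add x, mul_one]
      rw [add_mul] at i9
      omega

/-! ### The tours at a vertex -/

lemma mem_collect {F : List TBranch} {w : TBranch} (h : w ∈ F) : ∀ y ∈ w.items, y ∈ collect F := by
  intro y hy
  rw [collect_eq]
  exact List.mem_flatMap.2 ⟨w, h, hy⟩

lemma within_leaf {F r : List TBranch} {w : TBranch} (h : F.Perm (w :: r)) (hw : w.kids = [])
    {t : List Item} (ht : Within t w.its) : Within t (collect F) :=
  ht.mono fun y hy => mem_collect (w := w) (h.mem_iff.2 (by simp)) y (by rwa [items_of_leaf hw])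

/-- The demands exceed `(p₁ - 1/2) Q` and `(p₂ - 1/2) Q`, so there are `p₁ + p₂ - 1` full loads for
`p₁ + p₂` tours. The missing load is worth `4x` on the path to the depot, and each chain contributes
a surplus of at least `2x`. -/
lemma sol_two_chains {Q x p₁ p₂ : ℕ} (hQ : 0 < Q) {F r : List TBranch} {n₁ n₂ : TBranch}
    (hF : F.Perm (n₁ :: n₂ :: r)) (k₁ : n₁.kids ≠ []) (k₂ : n₂.kids ≠ [])
    (h₁ : LC Q (x + n₁.len) p₁ n₁.kids) (h₂ : LC Q (x + n₂.len) p₂ n₂.kids)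
    (hl : AllSub (LeafOK Q) F) (hn : AllSub (NodeOK Q) F)
    (hnd : ((collect F).map Prod.fst).Nodup) :
    Sol Q x F ((chain Q 0 n₁.kids).1 :: (chain Q 0 n₁.kids).2 ++
      (chain Q 0 n₂.kids).1 :: (chain Q 0 n₂.kids).2) := by
  rw [hF.allSub_iff] at hl hn
  simp only [AllSub_cons] at hl hn
  have c₁ := chain_spec hQ h₁ hl.2.1 hn.2.1 (hn.1 k₁).2.2.2
    (nodup_kids (hF.mem_iff.2 (by simp)) hnd) (r := 0) (by simpa using h₁.demand.2.2)
  have c₂ := chain_spec hQ h₂ hl.2.2.2.1 hn.2.2.2.1 (hn.2.2.1 k₂).2.2.2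
    (nodup_kids (hF.mem_iff.2 (by simp)) hnd) (r := 0) (by simpa using h₂.demand.2.2)
  have d₁ := h₁.demand
  have d₂ := h₂.demand
  have e₁ := h₁.ceilDiv hQ
  have e₂ := h₂.ceilDiv hQ
  generalize chain Q 0 n₁.kids = C at *
  generalize chain Q 0 n₂.kids = D at *
  obtain ⟨⟨i1, i2⟩, i3, ⟨i4, i5⟩, i6, i7, i8, i9⟩ := c₁
  obtain ⟨⟨j1, j2⟩, j3, ⟨j4, j5⟩, j6, j7, j8, j9⟩ := c₂
  have it₁ := items_of_node k₁ hl.1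
  have it₂ := items_of_node k₂ hl.2.2.1
  have m₁ := mem_collect (F := F) (w := n₁) (hF.mem_iff.2 (by simp))
  have m₂ := mem_collect (F := F) (w := n₂) (hF.mem_iff.2 (by simp))
  rw [it₁] at m₁
  rw [it₂] at m₂
  have hF' : F.Perm (n₂ :: n₁ :: r) := hF.trans (.swap _ _ _)
  have hlen := hF.collect.length_eq
  simp only [collect_cons, it₁, it₂, List.length_append] at hlen
  refine .of_cover hQ (G := [n₁, n₂]) (r := r) hF (by simp) ?_ ?_ ?_ ?_ ?_ (p₁ + p₂ - 1) ?_ ?_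
  · intro t ht
    simp only [List.cons_append, List.mem_cons, List.mem_append] at ht
    rcases ht with rfl | ht | rfl | ht
    · exact ⟨i1, i2⟩
    · exact i3 t ht
    · exact ⟨j1, j2⟩
    · exact j3 t ht
  · intro t ht
    simp only [List.cons_append, List.mem_cons, List.mem_append] at ht
    rcases ht with rfl | ht | rfl | ht
    · exact i4.mono m₁
    · exact (i5 t ht).mono m₁
    · exact j4.mono m₂
    · exact (j5 t ht).mono m₂
  · intro v
    have := i6 v
    have := j6 v
    rw [hF.collect.amt_eq]
    simp only [List.cons_append, List.flatten_cons, List.flatten_append, amt_append, collect_cons,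
      it₁, it₂]
    omega
  · simp only [List.cons_append, List.flatten_cons, List.flatten_append, List.length_append]
    omega
  · intro v
    have := i6 v
    have := j6 v
    simp only [List.cons_append, List.flatten_cons, List.flatten_append, amt_append, collect_cons,
      it₁, it₂, collect_nil, amt_nil]
    omega
  · simp only [List.cons_append, List.flatten_cons, List.flatten_append, amount_append]
    have : (p₁ + p₂ - 1) * Q = p₁ * Q + p₂ * Q - Q := by
      rw [Nat.sub_mul, add_mul, one_mul]
    omega
  · have s1 : (C.2.map fun t => x + St F t).sum ≤
        (C.2.map fun t => x + n₁.len + St n₁.kids t).sum := by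
      refine List.sum_le_sum fun t ht => ?_
      have := St_node_le hF hnd (i5 t ht)
      omega
    have s2 : (D.2.map fun t => x + St F t).sum ≤
        (D.2.map fun t => x + n₂.len + St n₂.kids t).sum := by
      refine List.sum_le_sum fun t ht => ?_
      have := St_node_le hF' hnd (j5 t ht)
      omega
    have s3 := St_node_le hF hnd i4
    have s4 := St_node_le hF' hnd j4
    simp only [List.cons_append, List.map_cons, List.map_append, List.sum_cons, List.sum_append]
    rw [cost_node k₁ hl.1, cost_node k₂ hl.2.2.1, cost_nil, e₁, e₂]
    rw [add_mul] at i9 j9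
    have : x * (p₁ + p₂ - 1) = x * p₁ + x * p₂ - x := by
      rw [Nat.mul_sub, mul_add, mul_one]
    have h5 : x ≤ x * p₁ := Nat.le_mul_of_pos_right x (by omega)
    omega

/-- Write edges for their lengths, with `c` the shortest. If `2c ≤ x`, two full tours empty `a` and
`b` and take parts of `c`; nothing is credited for the edge `c`, and `3 (2x + a + b + 2c) ≤ 4 (2x +
a + b)` amounts to `6c ≤ 2x + a + b`. If `2c > x`, three tours take one leaf each, and `3 (3x + a +
b + c) ≤ 4 (2x + a + b + c)` amounts to `x ≤ a + b + c`. -/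
lemma sol_triple {Q x : ℕ} (hQ : 0 < Q) {F r : List TBranch} {c b a : TBranch}
    (hF : F.Perm (c :: b :: a :: r)) (kc : c.kids = []) (kb : b.kids = []) (ka : a.kids = [])
    (hcb : c.len ≤ b.len) (hca : c.len ≤ a.len)
    (hD : 2 * Q ≤ amount c.its + amount b.its + amount a.its)
    (hl : AllSub (LeafOK Q) F) (hnd : ((collect F).map Prod.fst).Nodup) :
    Sol Q x F (triple Q x c b a) := by
  rw [hF.allSub_iff] at hl
  simp only [AllSub_cons] at hl
  have lc := hl.1.1 kc
  have lb := hl.2.2.1.1 kb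
  have la := hl.2.2.2.2.1.1 ka
  have pb : F.Perm (b :: c :: a :: r) := hF.trans (.swap _ _ _)
  have pa : F.Perm (a :: c :: b :: r) := hF.trans
    (((List.Perm.swap _ _ _).cons _).trans (.swap _ _ _))
  have pab : F.Perm ([a, b] ++ (c :: r)) := pa.trans ((List.Perm.swap _ _ _).cons _)
  have sa := St_leaf_le pa ka hnd (Within.refl _)
  have sb := St_leaf_le pb kb hnd (Within.refl _)
  have sc := St_leaf_le hF kc hnd (Within.refl _)
  have wa := within_leaf pa ka (Within.refl _)
  have wb := within_leaf pb kb (Within.refl _)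
  have wc := within_leaf hF kc (Within.refl _)
  have e : ∀ v, amt (collect F) v =
      amt c.its v + (amt b.its v + (amt a.its v + amt (collect r) v)) := fun v => by
    rw [hF.collect.amt_eq]
    simp [items_of_leaf, kc, kb, ka]
  have e'' := hF.collect.length_eq
  simp only [collect_cons, items_of_leaf kc, items_of_leaf ka, items_of_leaf kb,
    List.length_append] at e''
  have q5 := its_length_pos kc hl.1
  unfold triple
  split_ifs with hx
  · have q1 := amount_splitItems_fst (Q - amount a.its) c.its
    have q2 := amount_splitItems (Q - amount a.its) c.its
    obtain ⟨w1, w2⟩ := within_splitItems (Q - amount a.its) c.its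
    have q3 := length_splitItems (Q - amount a.its) c.its
    have q4 := amt_splitItems (Q - amount a.its) c.its
    generalize splitItems (Q - amount a.its) c.its = P at *
    have t1 := amount_splitItems_fst (Q - amount b.its) P.2
    have t2 := amount_splitItems (Q - amount b.its) P.2
    obtain ⟨v1, v2⟩ := within_splitItems (Q - amount b.its) P.2
    have t3 := length_splitItems (Q - amount b.its) P.2
    have t4 := amt_splitItems (Q - amount b.its) P.2
    generalize splitItems (Q - amount b.its) P.2 = R at *
    have v1' : Within R.1 c.its := fun y hy => by
      obtain ⟨z, hz, e⟩ := List.mem_map.1 (v1 y hy)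
      exact e ▸ w2 z hz
    have s1 := St_leaf_le hF kc hnd w1
    have s2 := St_leaf_le hF kc hnd v1'
    have s3 := St_append_le F a.its P.1
    have s4 := St_append_le F b.its R.1
    refine .of_cover hQ (G := [a, b]) (r := c :: r) pab (by simp) ?_ ?_ ?_ ?_ ?_ 2 ?_ ?_
    · simp only [List.mem_cons, List.not_mem_nil, or_false, forall_eq_or_imp, forall_eq,
        amount_append]
      omega
    · simp only [List.mem_cons, List.not_mem_nil, or_false, forall_eq_or_imp, forall_eq]
      exact ⟨wa.append (within_leaf hF kc w1), wb.append (within_leaf hF kc v1')⟩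
    · intro v
      have := q4 v
      have := t4 v
      rw [e v]
      simp only [List.flatten_cons, List.flatten_nil, List.append_nil, amt_append]
      omega
    · simp only [List.flatten_cons, List.flatten_nil, List.append_nil, List.length_append]
      omega
    · intro v
      simp only [List.flatten_cons, List.flatten_nil, List.append_nil, amt_append, collect_cons,
        collect_nil, items_of_leaf ka, items_of_leaf kb]
      omega
    · simp only [List.flatten_cons, List.flatten_nil, List.append_nil, amount_append]
      omega
    · simp only [List.map_cons, List.map_nil, List.sum_cons, List.sum_nil]
      rw [cost_leaf hQ ka hl.2.2.2.2.1, cost_leaf hQ kb hl.2.2.1, cost_nil]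
      omega
  · refine .of_cover hQ (G := [c, b, a]) (r := r) hF (by simp) ?_ ?_ ?_ ?_ ?_ 2 ?_ ?_
    · simp only [List.mem_cons, List.not_mem_nil, or_false, forall_eq_or_imp, forall_eq]
      exact ⟨la, lb, lc⟩
    · simp only [List.mem_cons, List.not_mem_nil, or_false, forall_eq_or_imp, forall_eq]
      exact ⟨wa, wb, wc⟩
    · intro v
      rw [e v]
      simp only [List.flatten_cons, List.flatten_nil, List.append_nil, amt_append]
      omega
    · simp only [List.flatten_cons, List.flatten_nil, List.append_nil, List.length_append]
      omega
    · intro v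
      simp only [List.flatten_cons, List.flatten_nil, List.append_nil, amt_append, collect_cons,
        collect_nil, items_of_leaf ka, items_of_leaf kb, items_of_leaf kc]
      omega
    · simp only [List.flatten_cons, List.flatten_nil, List.append_nil, amount_append]
      omega
    · simp only [List.map_cons, List.map_nil, List.sum_cons, List.sum_nil]
      rw [cost_leaf hQ kc hl.1, cost_leaf hQ kb hl.2.2.1, cost_leaf hQ ka hl.2.2.2.2.1, cost_nil]
      omega

/-- One full load is covered by two tours: `3 (2x + s + a) ≤ 4 (x + s + a)` holds because both leaf
edges have length at least `x`. -/
lemma sol_pair {Q x : ℕ} (hQ : 0 < Q) {F r : List TBranch} {s a : TBranch}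
    (hF : F.Perm (s :: a :: r)) (ks : s.kids = []) (ka : a.kids = [])
    (hsa : s.len ≤ a.len) (hx : x ≤ s.len) (hD : Q < amount s.its + amount a.its)
    (hl : AllSub (LeafOK Q) F) (hnd : ((collect F).map Prod.fst).Nodup) :
    Sol Q x F [a.its, s.its] := by
  rw [hF.allSub_iff] at hl
  simp only [AllSub_cons] at hl
  have ls := hl.1.1 ks
  have la := hl.2.2.1.1 ka
  have pa : F.Perm (a :: s :: r) := hF.trans (.swap _ _ _)
  have sa := St_leaf_le pa ka hnd (Within.refl _)
  have ss := St_leaf_le hF ks hnd (Within.refl _)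
  have wa := within_leaf pa ka (Within.refl _)
  have ws := within_leaf hF ks (Within.refl _)
  have e'' := hF.collect.length_eq
  simp only [collect_cons, items_of_leaf ks, items_of_leaf ka, List.length_append] at e''
  refine .of_cover hQ (G := [s, a]) (r := r) hF (by simp) ?_ ?_ ?_ ?_ ?_ 1 ?_ ?_
  · simp only [List.mem_cons, List.not_mem_nil, or_false, forall_eq_or_imp, forall_eq]
    exact ⟨la, ls⟩
  · simp only [List.mem_cons, List.not_mem_nil, or_false, forall_eq_or_imp, forall_eq]
    exact ⟨wa, ws⟩
  · intro v
    rw [hF.collect.amt_eq]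
    simp only [List.flatten_cons, List.flatten_nil, List.append_nil, amt_append, collect_cons,
      items_of_leaf ka, items_of_leaf ks]
    omega
  · simp only [List.flatten_cons, List.flatten_nil, List.append_nil, List.length_append]
    omega
  · intro v
    simp only [List.flatten_cons, List.flatten_nil, List.append_nil, amt_append, collect_cons,
      collect_nil, items_of_leaf ka, items_of_leaf ks]
    omega
  · simp only [List.flatten_cons, List.flatten_nil, List.append_nil, amount_append]
    omega
  · simp only [List.map_cons, List.map_nil, List.sum_cons, List.sum_nil]
    rw [cost_leaf hQ ks hl.1, cost_leaf hQ ka hl.2.2.1, cost_nil]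
    omega

lemma sol_leaf {Q x : ℕ} (hQ : 0 < Q) {r : List TBranch} {l : ℕ} {I : List Item}
    (hI : Q ≤ amount I) (hl : AllSub (LeafOK Q) (.mk l I [] :: r))
    (hnd : ((collect (.mk l I [] :: r)).map Prod.fst).Nodup) :
    Sol Q x (.mk l I [] :: r) [I] := by
  simp only [AllSub_cons] at hl
  have la := hl.1.1 rfl
  simp only [its_mk] at la
  have sa := St_leaf_le (.refl _) rfl hnd (Within.refl _)
  simp only [its_mk, len_mk] at sa
  refine .of_cover hQ (G := [.mk l I []]) (r := r) (.refl _) (by simp) ?_ ?_ ?_ ?_ ?_ 1 ?_ ?_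
  · simpa using la
  · simp only [List.mem_singleton, forall_eq]
    exact (Within.refl _).mono (by simp; tauto)
  · intro v
    simp
  · simp; omega
  · simp
  · simpa using hI
  · rw [cost_leaf hQ rfl hl.1, cost_nil]
    simp
    omega

/-- Let `f ≥ 2` be the traffic of the stem; leaves have traffic one. With no other children, `f`
below the number of leaves forces at least three, and exactly three give `f = 2`, demand at most
`2Q`, and more than `1.5 Q` by adding up pairs: a `2`-chain. With one chain of traffic `p`, the
inequalities `p < f < p +` (number of leaves) force at least two leaves; exactly two give `f = p +
1`, and their demand is at most `1.5 Q` because the chain holds more than `(p - 1/2) Q`. Further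
leaves allow `sol_triple`, since there are then four children; a second chain allows
`sol_two_chains`. -/
lemma findHere_spec {Q x : ℕ} (hQ : 0 < Q) {l : ℕ} {cs : List TBranch} (hcs : cs ≠ [])
    (hN : NodeOK Q (.mk l [] cs))
    (hl : AllSub (LeafOK Q) cs) (hn : AllSub (NodeOK Q) cs)
    (hnd : ((collect cs).map Prod.fst).Nodup)
    (hLC : ∀ w ∈ cs, w.kids ≠ [] → ∃ p, LC Q (x + w.len) p w.kids) :
    (findHere Q x cs ≠ [] → Sol Q x cs (findHere Q x cs)) ∧
    (findHere Q x cs = [] → ∃ p, LC Q x p cs) := by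
  obtain ⟨n1, n2, n3, n4⟩ := hN hcs
  simp only [kids_mk] at n1 n2 n3 n4
  obtain ⟨h1, h2, h3, h4⟩ := part_spec cs
  have hlp := hl
  rw [h1.allSub_iff] at hlp
  have lf : ∀ b ∈ (part cs).1, b.traffic Q = 1 := fun b hb =>
    traffic_leaf hQ ((AllSub_iff _ _ |>.1 hlp) b (List.mem_append_left _ hb)).1 (h2 b hb)
  have hf : 1 < amount (collect cs) ⌈/⌉ Q := by
    rw [lt_ceilDiv hQ]; omega
  have hts := h1.trafficSum_eq Q
  unfold findHere
  rcases hpc : part cs with ⟨lv, nd⟩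
  rw [hpc] at h1 h2 h3 h4 lf hts
  simp only at h1 h2 h3 h4 lf hts
  rcases nd with _ | ⟨n₁, _ | ⟨n₂, nd⟩⟩
  · -- no node
    rcases lv with _ | ⟨c, _ | ⟨b, _ | ⟨a, _ | ⟨d, lv⟩⟩⟩⟩
    · simp at h1
      exact absurd h1 hcs
    · rw [hts] at n2
      simp [lf] at n2
      omega
    · rw [hts] at n2
      simp [lf] at n2
      omega
    · simp only [List.append_nil] at h1 hts
      refine ⟨fun h => absurd rfl h, fun _ => ⟨2, .two hpc ?_ ?_⟩⟩
      · have p1 := n4.1 c b [a] h1 (h2 c (by simp)) (h2 b (by simp))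
        have p2 := n4.1 c a [b] (h1.trans ((List.Perm.swap _ _ _).cons _)) (h2 c (by simp))
          (h2 a (by simp))
        have p3 := n4.1 b a [c] (h1.trans ((List.Perm.swap _ _ _).trans
          ((List.Perm.swap _ _ _).cons _))) (h2 b (by simp)) (h2 a (by simp))
        rw [h1.collect.amount_eq]
        simp only [collect_cons, items_of_leaf (h2 c (by simp)), items_of_leaf (h2 b (by simp)),
          items_of_leaf (h2 a (by simp)), collect_nil, amount_append, amount_nil]
        omega
      · rw [hts] at n2
        simp [lf] at n2
        have : amount (collect cs) ⌈/⌉ Q ≤ 2 := by omega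
        rw [ceilDiv_le_iff_le_mul hQ] at this
        omega
    · simp only [List.append_nil] at h1
      simp only [List.pairwise_cons] at h4
      have hD := n4.2 c b a (d :: lv) h1 (h2 c (by simp)) (h2 b (by simp)) (h2 a (by simp))
        (by simp)
      refine ⟨fun _ => sol_triple hQ h1 (h2 c (by simp)) (h2 b (by simp)) (h2 a (by simp))
        (h4.1 b (by simp)) (h4.1 a (by simp)) hD hl hnd, fun h => ?_⟩
      simp only [triple] at h
      split_ifs at h
  · -- one node
    obtain ⟨p, hp⟩ := hLC n₁ (h1.mem_iff.2 (by simp)) (h3 n₁ (by simp))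
    have hln : LeafOK Q n₁ := ((AllSub_iff _ _ |>.1 hl) n₁ (h1.mem_iff.2 (by simp))).1
    have hft : n₁.traffic Q = p := by
      rw [TBranch.traffic, items_of_node (h3 n₁ (by simp)) hln, hp.ceilDiv hQ]
    have hlt := n3 n₁ (h1.mem_iff.2 (by simp)) (h3 n₁ (by simp))
    rcases lv with _ | ⟨c, _ | ⟨b, _ | ⟨a, lv⟩⟩⟩
    · rw [hts] at n2
      simp [hft] at n2
      omega
    · rw [hts] at n2
      simp [lf, hft] at n2
      omega
    · simp only [List.cons_append, List.nil_append] at h1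
      simp only [List.pairwise_cons] at h4
      have hD := n4.1 c b [n₁] h1 (h2 c (by simp)) (h2 b (by simp))
      simp only
      split_ifs with hx
      · exact ⟨fun _ => sol_pair hQ h1 (h2 c (by simp)) (h2 b (by simp)) (h4.1 b (by simp)) hx hD
          hl hnd, fun h => by simp at h⟩
      · refine ⟨fun h => absurd rfl h, fun _ => ⟨p + 1, ?_⟩⟩
        rw [hts] at n2
        simp [lf, hft] at n2
        have e : amount (collect cs) ⌈/⌉ Q = p + 1 := by omega
        have hD' : amount (collect cs) ≤ (p + 1) * Q := by
          rw [mul_comm]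
          exact (ceilDiv_le_iff_le_mul hQ).1 e.le
        refine .succ hpc hD ?_ hD' (by omega) hp
        have hd := hp.demand
        have e' := h1.collect.amount_eq
        simp only [collect_cons, items_of_leaf (h2 c (by simp)), items_of_leaf (h2 b (by simp)),
          items_of_node (h3 n₁ (by simp)) hln, collect_nil, amount_append, amount_nil] at e'
        rw [add_mul] at hD'
        omega
    · simp only [List.pairwise_cons] at h4
      have hD := n4.2 c b a (lv ++ [n₁]) (by simpa using h1) (h2 c (by simp)) (h2 b (by simp))
        (h2 a (by simp)) (by simp)
      have hsol := sol_triple (x := x) hQ (r := lv ++ [n₁]) (by simpa using h1) (h2 c (by simp))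
        (h2 b (by simp)) (h2 a (by simp)) (h4.1 b (by simp)) (h4.1 a (by simp)) hD hl hnd
      exact ⟨fun _ => hsol, fun h => absurd h hsol.ne⟩
  · -- two nodes
    have hp : cs.Perm (n₁ :: n₂ :: (lv ++ nd)) := h1.trans
      (List.perm_middle.trans ((List.perm_middle).cons _))
    obtain ⟨p₁, hp₁⟩ := hLC n₁ (hp.mem_iff.2 (by simp)) (h3 n₁ (by simp))
    obtain ⟨p₂, hp₂⟩ := hLC n₂ (hp.mem_iff.2 (by simp)) (h3 n₂ (by simp))
    have hsol := sol_two_chains hQ hp (h3 n₁ (by simp)) (h3 n₂ (by simp)) hp₁ hp₂ hl hn hnd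
    exact ⟨fun _ => hsol, fun h => by simp at h⟩

/-- A vertex is examined only after the search below it has failed, and then its non-leaf children
are already known to be long chains. -/
theorem find_spec {Q : ℕ} (hQ : 0 < Q) (F : List TBranch) (x : ℕ)
    (hl : AllSub (LeafOK Q) F) (hn : AllSub (NodeOK Q) F)
    (hnd : ((collect F).map Prod.fst).Nodup) :
    (find Q x F ≠ [] → Sol Q x F (find Q x F)) ∧
    (find Q x F = [] → AllSub (StrictLeaf Q) F ∧
      ∀ w ∈ F, w.kids ≠ [] → ∃ p, LC Q (x + w.len) p w.kids) := by
  induction F using forest_induction generalizing x with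
  | nil => simp [find]
  | cons l I cs r h1 h2 =>
    have hnd₁ := nodup_kids (w := .mk l I cs) (by simp) hnd
    have hnd₂ : ((collect r).map Prod.fst).Nodup := by
      rw [collect_cons, List.map_append] at hnd
      exact (List.nodup_append.1 hnd).2.1
    have hl' := hl
    have hn' := hn
    simp only [AllSub_cons, kids_mk] at hl' hn'
    obtain ⟨s1, s2⟩ := h2 x hl'.2.2 hn'.2.2 hnd₂
    cases cs with
    | nil =>
      rw [find]
      split_ifs with hq
      · exact ⟨fun _ => sol_leaf hQ hq hl hnd, fun h => by simp at h⟩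
      · refine ⟨fun h => (s1 h).cons hQ hnd, fun h => ⟨?_, ?_⟩⟩
        · simp only [AllSub_cons, kids_mk]
          refine ⟨fun _ => ?_, by simp, (s2 h).1⟩
          simp only [its_mk]
          omega
        · simp only [List.mem_cons, forall_eq_or_imp, kids_mk]
          exact ⟨fun h => absurd rfl h, (s2 h).2⟩
    | cons c cs =>
      have hI : I = [] := hl'.1.2 (by simp)
      subst hI
      obtain ⟨t1, t2⟩ := h1 (x + l) hl'.2.1 hn'.2.1 hnd₁
      rw [find]
      split
      · rename_i t ts ht
        rw [ht] at t1
        exact ⟨fun _ => (t1 (by simp)).inside hQ hnd, fun h => by simp at h⟩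
      · rename_i ht
        obtain ⟨u1, u2⟩ := findHere_spec (x := x + l) hQ (by simp) hn'.1 hl'.2.1 hn'.2.1 hnd₁
          (t2 ht).2
        split
        · rename_i t ts hts
          rw [hts] at u1
          exact ⟨fun _ => (u1 (by simp)).inside hQ hnd, fun h => by simp at h⟩
        · rename_i hts
          refine ⟨fun h => (s1 h).cons hQ hnd, fun h => ⟨?_, ?_⟩⟩
          · rw [AllSub_cons]
            exact ⟨fun h => by simp at h, (t2 ht).1, (s2 h).1⟩
          · simp only [List.mem_cons, forall_eq_or_imp, kids_mk]
            exact ⟨fun _ => u2 hts, (s2 h).2⟩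

/-! ### Long chains -/

lemma erase_leaf {w : TBranch} (h : w.kids = []) : w.erase = leaf w.len (amount w.its) := by
  obtain ⟨l, I, ks⟩ := w
  simp only [kids_mk] at h
  subst h
  simp

lemma children_erase (w : TBranch) : w.erase.children = w.kids.map erase := by
  obtain ⟨l, I, ks⟩ := w
  simp [Branch.children]

/-- Every branch of a chain has to be simplified by itself; a list of one branch is trivially
`Compact`, so this follows from the conditions at the vertices. Both conclusions are carried along
because the outer chain needs the inner one as a chain and as a long chain. -/
lemma LC.isLongChain {Q x p : ℕ} (hQ : 0 < Q) {cs : List TBranch} (h : LC Q x p cs) :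
    ∀ (a : ℕ) (b : TBranch), b.kids = cs → x = a + b.len → AllSub (LeafOK Q) [b] →
      AllSub (NodeOK Q) [b] → AllSub (StrictLeaf Q) [b] →
      IsLongChain Q a p b.erase ∧ IsChain Q p b.erase := by
  have hsimp : ∀ b : TBranch, AllSub (LeafOK Q) [b] → AllSub (NodeOK Q) [b] →
      AllSub (StrictLeaf Q) [b] → Simplified Q [b.erase] := fun b hl hn hs => by
    refine simplified_of_nodeOK hQ (F := [b]) hn hl ⟨?_, ?_⟩ hs
    · intro a b r h
      have := h.length_eq
      simp at this
    · intro a b c r h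
      have := h.length_eq
      simp at this
  have htr : ∀ (x p : ℕ) (b : TBranch), LC Q x p b.kids → b.kids ≠ [] → AllSub (LeafOK Q) [b] →
      b.erase.traffic Q = p := fun x p b h hk hl => by
    rw [traffic_erase, TBranch.traffic, items_of_node hk (AllSub_cons _ _ _ |>.1 hl).1,
      h.ceilDiv hQ]
  induction h with
  | @two x cs c b a h hlo hhi =>
    rintro a' B rfl rfl hl hn hs
    obtain ⟨h1, h2, -, -⟩ := part_spec B.kids
    rw [h] at h1 h2
    simp only [List.append_nil] at h1
    have hk : B.kids ≠ [] := fun h0 => by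
      have := h1.length_eq
      simp [h0] at this
    have hch : IsChain Q 2 B.erase := by
      refine .two (hsimp B hl hn hs) (htr _ 2 B (.two (x := 0) h hlo hhi) hk hl)
        (l₁ := c.len) (d₁ := amount c.its) (l₂ := b.len) (d₂ := amount b.its) (l₃ := a.len)
        (d₃ := amount a.its) ?_ ?_ ?_
      · rw [children_erase]
        have := h1.map erase
        simpa [erase_leaf (h2 c (by simp)), erase_leaf (h2 b (by simp)),
          erase_leaf (h2 a (by simp))] using this
      all_goals
        have e := h1.collect.amount_eq
        simp only [collect_cons, items_of_leaf (h2 c (by simp)), items_of_leaf (h2 b (by simp)),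
          items_of_leaf (h2 a (by simp)), collect_nil, amount_append, amount_nil] at e
        omega
    exact ⟨.two hch, hch⟩
  | @succ x p cs s a n h hlo hhi hD hlong hn ih =>
    rintro a' B rfl rfl hl hno hs
    obtain ⟨h1, h2, h3, h4⟩ := part_spec B.kids
    rw [h] at h1 h2 h3 h4
    simp only [List.cons_append, List.nil_append] at h1
    have hk : B.kids ≠ [] := fun h0 => by
      have := h1.length_eq
      simp [h0] at this
    have hl' := (AllSub_cons _ _ _ |>.1 hl).2.1
    have hno' := (AllSub_cons _ _ _ |>.1 hno).2.1
    have hs' := (AllSub_cons _ _ _ |>.1 hs).2.1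
    rw [h1.allSub_iff] at hl' hno' hs'
    simp only [AllSub_cons] at hl' hno' hs'
    obtain ⟨i1, i2⟩ := ih (a' + B.len) n rfl rfl (by simp [hl']) (by simp [hno']) (by simp [hs'])
    have hperm : B.erase.children.Perm
        [n.erase, leaf a.len (amount a.its), leaf s.len (amount s.its)] := by
      rw [children_erase]
      have h5 : B.kids.Perm [n, a, s] := h1.trans (List.reverse_perm [n, a, s])
      have := h5.map erase
      simpa [erase_leaf (h2 s (by simp)), erase_leaf (h2 a (by simp))] using this
    have hch : IsChain Q (p + 1) B.erase :=
      .succ (hsimp B hl hno hs) (htr _ _ B (.succ h hlo hhi hD hlong hn) hk hl) hperm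
        (by omega) (by omega) i2
    refine ⟨.succ hch hperm ?_ ?_ ?_, hch⟩
    · simp only [List.pairwise_cons] at h4
      exact h4.1 a (by simp)
    · obtain ⟨l, I, ks⟩ := B
      simpa [Branch.len] using hlong
    · obtain ⟨l, I, ks⟩ := B
      simpa [Branch.len] using i1

/-! ## Tracking the original vertices -/

/-- Attach to each leaf its address and its demand; `u` is the address of the parent, and the first
branch has position `i`. -/
def initF (u : Vertex) (i : ℕ) : List Branch → List TBranch
  | [] => []
  | .mk l d [] :: r => .mk l [(u ++ [i], d)] [] :: initF u (i + 1) r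
  | .mk l _ (c :: cs) :: r => .mk l [] (initF (u ++ [i]) 0 (c :: cs)) :: initF u (i + 1) r

theorem branch_induction {P : List Branch → Prop} (nil : P [])
    (leaf : ∀ l d r, P r → P (.mk l d [] :: r))
    (node : ∀ l d c cs r, P (c :: cs) → P r → P (.mk l d (c :: cs) :: r)) : ∀ F, P F
  | [] => nil
  | .mk l d [] :: r => leaf l d r (branch_induction nil leaf node r)
  | .mk l d (c :: cs) :: r => node l d c cs r (branch_induction nil leaf node (c :: cs))
      (branch_induction nil leaf node r)

lemma branchAt_succ (b : Branch) (r : List Branch) (k : ℕ) (a : Vertex) :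
    branchAt (b :: r) ((k + 1) :: a) = branchAt r (k :: a) := by
  cases a <;> simp [branchAt]

lemma branchAt_zero (b : Branch) (r : List Branch) (k : ℕ) (a : Vertex) :
    branchAt (b :: r) (0 :: k :: a) = branchAt b.children (k :: a) := by
  simp [branchAt]

lemma demandAtLeaves_cons {Q : ℕ} {l d : ℕ} {cs r : List Branch}
    (h : DemandAtLeaves Q (.mk l d cs :: r)) : (cs ≠ [] → d = 0) ∧ (cs = [] → 0 < d ∧ d < Q) ∧
      DemandAtLeaves Q cs ∧ DemandAtLeaves Q r := by
  have h0 := h [0] (.mk l d cs) (by simp [branchAt])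
  refine ⟨h0.1, h0.2, fun v b hv => ?_, fun v b hv => ?_⟩
  · cases v with
    | nil => simp [branchAt] at hv
    | cons k a => exact h (0 :: k :: a) b (by rw [branchAt_zero]; exact hv)
  · cases v with
    | nil => simp [branchAt] at hv
    | cons k a => exact h ((k + 1) :: a) b (by rw [branchAt_succ]; exact hv)

lemma erase_initF {Q : ℕ} {bs : List Branch} (h : DemandAtLeaves Q bs) (u : Vertex) (i : ℕ) :
    (initF u i bs).map erase = bs := by
  induction bs using branch_induction generalizing u i with
  | nil => simp [initF]
  | leaf l d r ih =>
    obtain ⟨-, -, -, h4⟩ := demandAtLeaves_cons h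
    simp [initF, ih h4]
  | node l d c cs r ih1 ih2 =>
    obtain ⟨h1, -, h3, h4⟩ := demandAtLeaves_cons h
    simp [initF, ih1 h3, ih2 h4, h1]

lemma leafOK_initF {Q : ℕ} {bs : List Branch} (h : DemandAtLeaves Q bs) (u : Vertex) (i : ℕ) :
    AllSub (LeafOK Q) (initF u i bs) := by
  induction bs using branch_induction generalizing u i with
  | nil => simp [initF]
  | leaf l d r ih =>
    obtain ⟨-, h2, -, h4⟩ := demandAtLeaves_cons h
    have := h2 rfl
    simp [initF, ih h4, LeafOK]
    omega
  | node l d c cs r ih1 ih2 =>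
    obtain ⟨-, -, h3, h4⟩ := demandAtLeaves_cons h
    rw [initF]
    simp only [AllSub_cons, kids_mk]
    refine ⟨⟨fun h0 => ?_, fun _ => rfl⟩, ih1 h3 _ _, ih2 h4 _ _⟩
    have := congrArg (List.map erase) h0
    rw [kids_mk, erase_initF h3] at this
    simp at this

lemma mem_initF {bs : List Branch} {u : Vertex} {i : ℕ} {x : Item}
    (hx : x ∈ collect (initF u i bs)) :
    ∃ j a b, x.1 = u ++ (i + j) :: a ∧ branchAt bs (j :: a) = some b ∧ b.dem = x.2 := by
  induction bs using branch_induction generalizing u i with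
  | nil => simp [initF] at hx
  | leaf l d r ih =>
    rw [initF] at hx
    simp only [collect_cons, items_mk, collect_nil, List.append_nil, List.mem_append,
      List.mem_singleton] at hx
    rcases hx with rfl | hx
    · exact ⟨0, [], .mk l d [], by simp, by simp [branchAt], rfl⟩
    · obtain ⟨j, a, b, h1, h2, h3⟩ := ih hx
      exact ⟨j + 1, a, b, by rw [h1]; simp; omega, by rw [branchAt_succ, h2], h3⟩
  | node l d c cs r ih1 ih2 =>
    rw [initF] at hx
    simp only [collect_cons, items_mk, List.nil_append, List.mem_append] at hx
    rcases hx with hx | hx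
    · obtain ⟨j, a, b, h1, h2, h3⟩ := ih1 hx
      exact ⟨0, j :: a, b, by rw [h1]; simp, by rw [branchAt_zero]; exact h2, h3⟩
    · obtain ⟨j, a, b, h1, h2, h3⟩ := ih2 hx
      exact ⟨j + 1, a, b, by rw [h1]; simp; omega, by rw [branchAt_succ, h2], h3⟩

lemma nodup_initF (bs : List Branch) (u : Vertex) (i : ℕ) :
    ((collect (initF u i bs)).map Prod.fst).Nodup := by
  induction bs using branch_induction generalizing u i with
  | nil => simp [initF]
  | leaf l d r ih =>
    rw [initF]
    simp only [collect_cons, items_mk, collect_nil, List.append_nil, List.map_cons,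
      List.singleton_append, List.nodup_cons]
    refine ⟨fun h => ?_, ih _ _⟩
    obtain ⟨x, hx, e⟩ := List.mem_map.1 h
    obtain ⟨j, a, b, h1, -, -⟩ := mem_initF hx
    rw [h1] at e
    simp at e
    omega
  | node l d c cs r ih1 ih2 =>
    rw [initF]
    simp only [collect_cons, items_mk, List.nil_append, List.map_append]
    refine List.nodup_append.2 ⟨ih1 _ _, ih2 _ _, ?_⟩
    intro v hv w hw
    obtain ⟨x, hx, rfl⟩ := List.mem_map.1 hv
    obtain ⟨y, hy, rfl⟩ := List.mem_map.1 hw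
    obtain ⟨j, a, b, h1, -, -⟩ := mem_initF hx
    obtain ⟨j', a', b', h1', -, -⟩ := mem_initF hy
    rw [h1, h1']
    simp
    omega

/-- The lower bound of a branch involves the demand below its stem, hence the joint induction.
Removing demand consumes addresses from the front, whereas items carry them in full, hence the shift
by `u`. -/
lemma residual_initF {Q : ℕ} {bs : List Branch} (h : DemandAtLeaves Q bs) (c : Vertex → ℕ)
    (u : Vertex) (i : ℕ) :
    totalDemand (removeDemandFrom (fun a => c (u ++ a)) i bs) =
      ((collect (initF u i bs)).map fun x => x.2 - c x.1).sum ∧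
    lowerBound Q (removeDemandFrom (fun a => c (u ++ a)) i bs) =
      2 * cost (· ⌈/⌉ Q) (fun x => x.2 - c x.1) (initF u i bs) := by
  induction bs using branch_induction generalizing u i with
  | nil => simp [initF, removeDemandFrom, totalDemand, lowerBound]
  | leaf l d r ih =>
    obtain ⟨-, -, -, h4⟩ := demandAtLeaves_cons h
    obtain ⟨i1, i2⟩ := ih h4 u (i + 1)
    simp [initF, removeDemandFrom, totalDemand, lowerBound, Branch.removeDemand, i1, i2,
      Branch.lb, Branch.demand]
    ring
  | node l d b cs r ih1 ih2 =>
    obtain ⟨h1, -, h3, h4⟩ := demandAtLeaves_cons h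
    obtain ⟨i1, i2⟩ := ih1 h3 (u ++ [i]) 0
    obtain ⟨j1, j2⟩ := ih2 h4 u (i + 1)
    simp only [List.append_assoc, List.singleton_append] at i1 i2
    rw [initF, removeDemandFrom, Branch.removeDemand, totalDemand, lowerBound, Branch.demand,
      Branch.lb, i1, i2, j1, j2, h1 (by simp)]
    simp
    ring

/-! ## Walks -/

/-- The closed walk from `u` that visits all vertices of `S` below `u`, without its first vertex. -/
def walk (S : List Item) (u : Vertex) (i : ℕ) : List Branch → List Vertex
  | [] => []
  | .mk _ _ [] :: r =>
    if u ++ [i] ∈ S.map Prod.fst then (u ++ [i]) :: u :: walk S u (i + 1) r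
    else walk S u (i + 1) r
  | .mk _ _ (c :: cs) :: r =>
    match walk S (u ++ [i]) 0 (c :: cs) with
    | [] => walk S u (i + 1) r
    | w :: ws => (u ++ [i]) :: (w :: ws ++ u :: walk S u (i + 1) r)

/-- A walk below `u` returns to `u`, so the walks in different subtrees can be concatenated. -/
lemma walk_last (S : List Item) (bs : List Branch) (u : Vertex) (i : ℕ) :
    ∃ p, u :: walk S u i bs = p ++ [u] := by
  induction bs using branch_induction generalizing i with
  | nil => exact ⟨[], by simp [walk]⟩
  | leaf l d r ih =>
    obtain ⟨p, hp⟩ := ih (i + 1)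
    rw [walk]
    split_ifs
    · exact ⟨u :: (u ++ [i]) :: p, by simp [hp]⟩
    · exact ⟨p, hp⟩
  | node l d c cs r ih1 ih2 =>
    obtain ⟨p, hp⟩ := ih2 (i + 1)
    rw [walk]
    split
    · exact ⟨p, hp⟩
    · rename_i w ws _
      exact ⟨u :: (u ++ [i]) :: (w :: ws ++ p), by simp [hp]⟩

/-- A subtree is skipped exactly if it contains no address of `S`. This is the weight zero in `St`,
so the length of the walk is exactly `2 * St`. -/
lemma walk_eq_nil (S : List Item) (bs : List Branch) (u : Vertex) (i : ℕ) :
    walk S u i bs = [] ↔ ((collect (initF u i bs)).map (ind S)).sum = 0 := by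
  induction bs using branch_induction generalizing u i with
  | nil => simp [initF, walk]
  | leaf l d r ih =>
    rw [walk, initF]
    split_ifs with h
    · simp only [false_iff]
      simp [ind, h]
    · rw [ih]
      simp [ind, h]
  | node l d c cs r ih1 ih2 =>
    rw [walk, initF]
    split
    · rename_i h
      rw [ih1] at h
      rw [ih2]
      simp [h]
    · rename_i w ws h
      simp only [reduceCtorEq, false_iff]
      intro h0
      simp only [collect_cons, items_mk, List.nil_append, List.map_append, List.sum_append,
        Nat.add_eq_zero_iff] at h0
      rw [(ih1 _ _).2 h0.1] at h
      simp at h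

lemma mem_walk {S : List Item} {bs : List Branch} {u : Vertex} {i : ℕ} {x : Item}
    (hx : x ∈ collect (initF u i bs)) (hS : x.1 ∈ S.map Prod.fst) : x.1 ∈ walk S u i bs := by
  induction bs using branch_induction generalizing u i with
  | nil => simp [initF] at hx
  | leaf l d r ih =>
    rw [initF] at hx
    simp only [collect_cons, items_mk, collect_nil, List.append_nil, List.mem_append,
      List.mem_singleton] at hx
    rw [walk]
    rcases hx with rfl | hx
    · rw [if_pos hS]
      simp
    · have := ih hx
      split_ifs <;> simp [this]
  | node l d c cs r ih1 ih2 =>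
    rw [initF] at hx
    simp only [collect_cons, items_mk, List.nil_append, List.mem_append] at hx
    rw [walk]
    rcases hx with hx | hx
    · have := ih1 hx
      split
      · rename_i h
        simp [h] at this
      · rename_i w ws h
        rw [h] at this
        exact List.mem_cons_of_mem _ (List.mem_append_left _ this)
    · have := ih2 hx
      split
      · exact this
      · exact List.mem_cons_of_mem _ (List.mem_append_right _ (List.mem_cons_of_mem _ this))

/-- The branches `F` are those at the vertex `u` of the tree `B`, from the position `i` on. -/
def SubAt (B : List Branch) (u : Vertex) (i : ℕ) (F : List Branch) : Prop :=
  ∀ k a, branchAt B (u ++ (i + k) :: a) = branchAt F (k :: a)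

lemma SubAt.tail {B : List Branch} {u : Vertex} {i : ℕ} {b : Branch} {r : List Branch}
    (h : SubAt B u i (b :: r)) : SubAt B u (i + 1) r := fun k a => by
  have := h (k + 1) a
  rw [branchAt_succ] at this
  rw [← this]
  congr 3
  omega

lemma SubAt.children {B : List Branch} {u : Vertex} {i : ℕ} {b : Branch} {r : List Branch}
    (h : SubAt B u i (b :: r)) : SubAt B (u ++ [i]) 0 b.children := fun k a => by
  have := h 0 (k :: a)
  rw [branchAt_zero] at this
  rw [← this]
  simp

lemma SubAt.head {B : List Branch} {u : Vertex} {i : ℕ} {b : Branch} {r : List Branch}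
    (h : SubAt B u i (b :: r)) : branchAt B (u ++ [i]) = some b := by
  have := h 0 []
  simpa [branchAt] using this

lemma adj_down {B : List Branch} {u : Vertex} {i : ℕ} {b : Branch}
    (h : branchAt B (u ++ [i]) = some b) : Adj B u (u ++ [i]) :=
  .inl ⟨⟨i, rfl⟩, by rw [h]; rfl⟩

lemma adj_up {B : List Branch} {u : Vertex} {i : ℕ} {b : Branch}
    (h : branchAt B (u ++ [i]) = some b) : Adj B (u ++ [i]) u :=
  .inr ⟨⟨i, rfl⟩, by rw [h]; rfl⟩

lemma edgeLen_down {B : List Branch} {u : Vertex} {i : ℕ} {b : Branch}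
    (h : branchAt B (u ++ [i]) = some b) : edgeLen B u (u ++ [i]) = b.len := by
  simp [edgeLen, stemLen, h]

lemma edgeLen_up {B : List Branch} {u : Vertex} {i : ℕ} {b : Branch}
    (h : branchAt B (u ++ [i]) = some b) : edgeLen B (u ++ [i]) u = b.len := by
  simp [edgeLen, stemLen, h]

lemma walk_chain {B : List Branch} (S : List Item) {bs : List Branch} {u : Vertex} {i : ℕ}
    (h : SubAt B u i bs) : (u :: walk S u i bs).IsChain (Adj B) := by
  induction bs using branch_induction generalizing u i with
  | nil => simp [walk]
  | leaf l d r ih =>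
    rw [walk]
    split_ifs
    · exact .cons_cons (adj_down h.head) (.cons_cons (adj_up h.head) (ih h.tail))
    · exact ih h.tail
  | node l d c cs r ih1 ih2 =>
    rw [walk]
    have h1 := ih1 h.children
    obtain ⟨p, hp⟩ := walk_last S (c :: cs) (u ++ [i]) 0
    split
    · exact ih2 h.tail
    · rename_i w ws hw
      rw [hw] at h1 hp
      refine .cons_cons (adj_down h.head) ?_
      rw [← List.cons_append, hp, List.append_assoc, List.singleton_append, List.isChain_split]
      rw [hp] at h1
      exact ⟨h1, .cons_cons (adj_up h.head) (ih2 h.tail)⟩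

lemma routeCost_append (B : List Branch) (p : List Vertex) (u : Vertex) (q : List Vertex) :
    routeCost B (p ++ u :: q) = routeCost B (p ++ [u]) + routeCost B (u :: q) := by
  induction p with
  | nil => simp [routeCost]
  | cons v p ih =>
    cases p with
    | nil => simp [routeCost]
    | cons w p =>
      simp only [List.cons_append, routeCost] at ih ⊢
      rw [ih]
      ring

lemma walk_cost {B : List Branch} (S : List Item) {bs : List Branch} {u : Vertex} {i : ℕ}
    (h : SubAt B u i bs) : routeCost B (u :: walk S u i bs) = 2 * St (initF u i bs) S := by
  unfold St
  induction bs using branch_induction generalizing u i with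
  | nil => simp [walk, initF, routeCost]
  | leaf l d r ih =>
    rw [walk, initF, cost_mk]
    split_ifs with h0
    · rw [routeCost, routeCost, edgeLen_down h.head, edgeLen_up h.head, ih h.tail]
      simp [ind, h0, Branch.len]
      ring
    · rw [ih h.tail]
      simp [ind, h0]
  | node l d c cs r ih1 ih2 =>
    rw [walk, initF, cost_mk]
    have h1 := ih1 h.children
    obtain ⟨p, hp⟩ := walk_last S (c :: cs) (u ++ [i]) 0
    have hnil := walk_eq_nil S (c :: cs) (u ++ [i]) 0
    split
    · rename_i hw
      rw [hw, routeCost] at h1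
      · rw [ih2 h.tail, hnil.1 hw]
        have h2 : cost (min · 1) (ind S) (initF (u ++ [i]) 0 (c :: cs)) = 0 := by
          omega
        simp only [List.map_nil, List.sum_nil, add_zero, Nat.zero_min, mul_zero, zero_add, h2]
      · simp
    · rename_i w ws hw
      rw [hw] at h1 hp hnil
      have hpos : min ((List.map (ind S) (collect (initF (u ++ [i]) 0 (c :: cs)))).sum) 1 = 1 := by
        have : (List.map (ind S) (collect (initF (u ++ [i]) 0 (c :: cs)))).sum ≠ 0 := fun h0 => by
          simpa using hnil.2 h0
        omega
      rw [routeCost, ← List.cons_append, hp, List.append_assoc, List.singleton_append,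
        routeCost_append, routeCost, edgeLen_down h.head, edgeLen_up h.head, ih2 h.tail, ← hp, h1]
      simp only [List.map_nil, List.sum_nil, zero_add, hpos, Branch.len]
      ring

/-! ## The result of the algorithm -/

/-- The tree that results from the simplification. -/
def resultTree (Q : ℕ) (bs : List Branch) : List TBranch := simplified Q (initF [] 0 bs)

/-- The tours that are found. -/
def resultTours (Q : ℕ) (bs : List Branch) : List Tour :=
  (find Q 0 (resultTree Q bs)).map fun t => ⟨[] :: walk t [] 0 bs, t⟩

section
variable {Q : ℕ} {bs : List Branch}

lemma resultTree_steps (hQ : 0 < Q) (h : DemandAtLeaves Q bs) :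
    Relation.ReflTransGen (Step Q) (initF [] 0 bs) (resultTree Q bs) :=
  simplified_steps hQ _ (leafOK_initF h _ _)

lemma resultTree_leafOK (hQ : 0 < Q) (h : DemandAtLeaves Q bs) :
    AllSub (LeafOK Q) (resultTree Q bs) :=
  steps_leafOK hQ (resultTree_steps hQ h) (leafOK_initF h _ _)

lemma resultTree_nodeOK (hQ : 0 < Q) (h : DemandAtLeaves Q bs) :
    AllSub (NodeOK Q) (resultTree Q bs) :=
  simplified_nodeOK hQ _ (leafOK_initF h _ _)

lemma resultTree_collect (hQ : 0 < Q) (h : DemandAtLeaves Q bs) :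
    (collect (initF [] 0 bs)).Perm (collect (resultTree Q bs)) :=
  steps_collect_perm (resultTree_steps hQ h)

lemma resultTree_nodup (hQ : 0 < Q) (h : DemandAtLeaves Q bs) :
    ((collect (resultTree Q bs)).map Prod.fst).Nodup :=
  ((resultTree_collect hQ h).map _).nodup_iff.1 (nodup_initF bs [] 0)

theorem result_simplifies (hQ : 0 < Q) (h : DemandAtLeaves Q bs) :
    Simplifies Q bs ((resultTree Q bs).map erase) := by
  have := steps_erase (resultTree_steps hQ h)
  rw [erase_initF h] at this
  exact ⟨this, exhausted_of_nodeOK hQ (resultTree_nodeOK hQ h) (resultTree_leafOK hQ h)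
    (simplified_compact Q _)⟩

lemma covered_eq (f : List Item → List Vertex) (ts : List (List Item)) (v : Vertex) :
    covered (ts.map fun t => ⟨f t, t⟩) v = amt ts.flatten v := by
  unfold covered
  rw [List.map_map]
  induction ts with
  | nil => rfl
  | cons t ts ih =>
    rw [List.map_cons, List.sum_cons, ih, List.flatten_cons, amt_append]
    rfl

/-- Going back to the input, the lengths of the tours and the residual lower bound do not increase
(`steps_cost_le` for two choices of `g`), and the lower bound does not decrease
(`steps_cost_snd_le`). So the inequality from the simplified tree survives; the factor two on both
sides undoes the halving. -/
theorem result_isApprox (hQ : 0 < Q) (h : DemandAtLeaves Q bs)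
    (hs : Sol Q 0 (resultTree Q bs) (find Q 0 (resultTree Q bs))) :
    IsApproxTourSet Q bs (resultTours Q bs) := by
  have hsub : SubAt bs [] 0 bs := fun k a => by simp
  have hc := resultTree_collect hQ h
  have hcov := covered_eq (fun t => [] :: walk t [] 0 bs) (find Q 0 (resultTree Q bs))
  refine ⟨?_, ?_, ?_, ?_, ?_⟩
  · simpa [resultTours] using hs.ne
  · intro t ht
    obtain ⟨S, hS, rfl⟩ := List.mem_map.1 ht
    obtain ⟨p, hp⟩ := walk_last S bs [] 0
    refine ⟨rfl, ?_, walk_chain S hsub, ?_, (hs.cap S hS).2⟩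
    · show ([] :: walk S [] 0 bs).getLast? = _
      rw [hp]
      simp
    · intro x hx
      obtain ⟨y, hy, e⟩ := List.mem_map.1 (hs.sub S hS x hx)
      refine List.mem_cons_of_mem _ ?_
      rw [← e]
      exact mem_walk (hc.mem_iff.2 hy) (by rw [e]; exact List.mem_map_of_mem hx)
  · intro t ht
    obtain ⟨S, hS, rfl⟩ := List.mem_map.1 ht
    exact (hs.cap S hS).1
  · intro v
    refine (hcov v).le.trans ((hs.amt_le v).trans ?_)
    rw [← hc.amt_eq]
    by_cases hv : v ∈ (collect (initF [] 0 bs)).map Prod.fst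
    · obtain ⟨x, hx, rfl⟩ := List.mem_map.1 hv
      rw [amt_of_nodup (nodup_initF bs [] 0) hx]
      obtain ⟨j, a, b, h1, h2, h3⟩ := mem_initF hx
      rw [h1]
      simp [demandAt, h2, h3]
    · rw [amt_eq_zero hv]
      omega
  · have h1 : totalCost bs (resultTours Q bs) ≤
        2 * ((find Q 0 (resultTree Q bs)).map fun t => 0 + St (resultTree Q bs) t).sum := by
      unfold totalCost resultTours
      rw [List.map_map, ← List.sum_map_mul_left]
      refine List.sum_le_sum fun t _ => ?_
      have := steps_cost_le subadd_min (ind t) (resultTree_steps hQ h)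
      have e := walk_cost t hsub
      simp only [Function.comp_apply, zero_add]
      rw [e]
      exact Nat.mul_le_mul_left _ this
    have h2 : lowerBound Q (residual bs (resultTours Q bs)) =
        2 * cost (· ⌈/⌉ Q) (resid (find Q 0 (resultTree Q bs)).flatten) (initF [] 0 bs) := by
      have := (residual_initF (Q := Q) h (covered (resultTours Q bs)) [] 0).2
      simp only [List.nil_append] at this
      unfold residual
      rw [this]
      congr 2
      funext x
      exact congrArg _ (hcov x.1)
    have h3 := steps_cost_le (subadd_ceilDiv hQ) (resid (find Q 0 (resultTree Q bs)).flatten)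
      (resultTree_steps hQ h)
    have h4 := lowerBound_erase Q (initF [] 0 bs)
    rw [erase_initF h] at h4
    have h5 := steps_cost_snd_le hQ (resultTree_steps hQ h) (leafOK_initF h _ _)
    have h6 := hs.approx
    rw [h2, h4]
    omega

theorem result_spec (hQ : 0 < Q) (h : DemandAtLeaves Q bs) :
    IsApproxTourSet Q bs (resultTours Q bs) ∨
      (resultTours Q bs = [] ∧ Simplified Q ((resultTree Q bs).map erase) ∧
        ∀ b ∈ (resultTree Q bs).map erase,
          b.traffic Q = 1 ∨ ∃ p', IsLongChain Q 0 p' b) := by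
  have hl := resultTree_leafOK hQ h
  have hn := resultTree_nodeOK hQ h
  obtain ⟨h1, h2⟩ := find_spec hQ (resultTree Q bs) 0 hl hn (resultTree_nodup hQ h)
  by_cases hf : find Q 0 (resultTree Q bs) = []
  · right
    obtain ⟨hs, hLC⟩ := h2 hf
    refine ⟨by simp [resultTours, hf],
      simplified_of_nodeOK hQ hn hl (simplified_compact Q _) hs, ?_⟩
    intro b hb
    obtain ⟨w, hw, rfl⟩ := List.mem_map.1 hb
    have hl' := AllSub_iff _ _ |>.1 hl w hw
    have hn' := AllSub_iff _ _ |>.1 hn w hw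
    have hs' := AllSub_iff _ _ |>.1 hs w hw
    by_cases hk : w.kids = []
    · left
      rw [traffic_erase, traffic_leaf hQ hl'.1 hk]
    · right
      obtain ⟨p, hp⟩ := hLC w hw hk
      exact ⟨p, (hp.isLongChain hQ 0 w rfl rfl (by simp [hl']) (by simp [hn'])
        (by simp [hs'])).1⟩
  · exact .inl (result_isApprox hQ h (h1 hf))

end

/-! ## Reasoning about programs -/

theorem Eval.det {P : Program} {env : List Val} {e : Expr} {x y : Val} {s t : ℕ}
    (h : Eval P env e x s) (h' : Eval P env e y t) : x = y ∧ s = t := by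
  induction h generalizing y t with
  | var h =>
    cases h' with
    | var h' => exact ⟨Option.some.inj (h.symm.trans h'), rfl⟩
  | num => cases h'; exact ⟨rfl, rfl⟩
  | pair _ _ ih₁ ih₂ =>
    cases h' with
    | pair a b =>
      obtain ⟨rfl, rfl⟩ := ih₁ a
      obtain ⟨rfl, rfl⟩ := ih₂ b
      exact ⟨rfl, rfl⟩
  | fst _ ih =>
    cases h' with
    | fst a =>
      obtain ⟨h, rfl⟩ := ih a
      cases h
      exact ⟨rfl, rfl⟩
  | snd _ ih =>
    cases h' with
    | snd a =>
      obtain ⟨h, rfl⟩ := ih a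
      cases h
      exact ⟨rfl, rfl⟩
  | add _ _ ih₁ ih₂ =>
    cases h' with
    | add a b =>
      obtain ⟨h, rfl⟩ := ih₁ a
      obtain ⟨h', rfl⟩ := ih₂ b
      cases h
      cases h'
      exact ⟨rfl, rfl⟩
  | sub _ _ ih₁ ih₂ =>
    cases h' with
    | sub a b =>
      obtain ⟨h, rfl⟩ := ih₁ a
      obtain ⟨h', rfl⟩ := ih₂ b
      cases h
      cases h'
      exact ⟨rfl, rfl⟩
  | letIn _ _ ih₁ ih₂ =>
    cases h' with
    | letIn a b =>
      obtain ⟨rfl, rfl⟩ := ih₁ a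
      obtain ⟨rfl, rfl⟩ := ih₂ b
      exact ⟨rfl, rfl⟩
  | ifPair_pair _ _ ih₁ ih₂ =>
    cases h' with
    | ifPair_pair a b =>
      obtain ⟨-, rfl⟩ := ih₁ a
      obtain ⟨rfl, rfl⟩ := ih₂ b
      exact ⟨rfl, rfl⟩
    | ifPair_num a b => cases (ih₁ a).1
  | ifPair_num _ _ ih₁ ih₂ =>
    cases h' with
    | ifPair_pair a b => cases (ih₁ a).1
    | ifPair_num a b =>
      obtain ⟨-, rfl⟩ := ih₁ a
      obtain ⟨rfl, rfl⟩ := ih₂ b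
      exact ⟨rfl, rfl⟩
  | ifLe_true _ _ hmn _ ih₁ ih₂ ih₃ =>
    cases h' with
    | ifLe_true a b c d =>
      obtain ⟨-, rfl⟩ := ih₁ a
      obtain ⟨-, rfl⟩ := ih₂ b
      obtain ⟨rfl, rfl⟩ := ih₃ d
      exact ⟨rfl, rfl⟩
    | ifLe_false a b c d =>
      cases (ih₁ a).1
      cases (ih₂ b).1
      omega
  | ifLe_false _ _ hmn _ ih₁ ih₂ ih₃ =>
    cases h' with
    | ifLe_true a b c d =>
      cases (ih₁ a).1
      cases (ih₂ b).1
      omega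
    | ifLe_false a b c d =>
      obtain ⟨-, rfl⟩ := ih₁ a
      obtain ⟨-, rfl⟩ := ih₂ b
      obtain ⟨rfl, rfl⟩ := ih₃ d
      exact ⟨rfl, rfl⟩
  | call hf _ _ ih₁ ih₂ =>
    cases h' with
    | call hf' a b =>
      cases hf.symm.trans hf'
      obtain ⟨rfl, rfl⟩ := ih₁ a
      obtain ⟨rfl, rfl⟩ := ih₂ b
      exact ⟨rfl, rfl⟩

/-- The evaluation of `e` terminates, with a value and a number of steps that satisfy `K`. -/
def Run (P : Program) (env : List Val) (e : Expr) (K : Val → ℕ → Prop) : Prop :=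
  ∃ x t, Eval P env e x t ∧ K x t

/-- The call of the function `f` terminates, with a value and a number of steps that satisfy `K`. -/
def Call (P : Program) (f : ℕ) (a : Val) (K : Val → ℕ → Prop) : Prop :=
  ∃ body, P[f]? = some body ∧ Run P [a] body K

/-- The value is a pair that satisfies `K`. -/
def OnPair (v : Val) (K : Val → Val → Prop) : Prop := ∃ x y, v = .pair x y ∧ K x y

/-- The value is a number that satisfies `K`. -/
def OnNum (v : Val) (K : ℕ → Prop) : Prop := ∃ n, v = .num n ∧ K n

/-- Case distinction on a value. -/
def CasePair : Val → Prop → Prop → Prop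
  | .pair _ _, A, _ => A
  | .num _, _, B => B

/-- Case distinction on an inequality. -/
def CaseLe (m n : ℕ) (A B : Prop) : Prop := (m ≤ n ∧ A) ∨ (n < m ∧ B)

lemma run_fst (P : Program) (env : List Val) (e : Expr) (K : Val → ℕ → Prop) :
    Run P env (.fst e) K ↔ Run P env e fun v t => OnPair v fun x _ => K x (t + 1) := by
  constructor
  · rintro ⟨x, t, h, hK⟩
    cases h with
    | fst h => exact ⟨_, _, h, _, _, rfl, hK⟩
  · rintro ⟨v, t, h, x, y, rfl, hK⟩
    exact ⟨_, _, .fst h, hK⟩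

lemma run_snd (P : Program) (env : List Val) (e : Expr) (K : Val → ℕ → Prop) :
    Run P env (.snd e) K ↔ Run P env e fun v t => OnPair v fun _ y => K y (t + 1) := by
  constructor
  · rintro ⟨x, t, h, hK⟩
    cases h with
    | snd h => exact ⟨_, _, h, _, _, rfl, hK⟩
  · rintro ⟨v, t, h, x, y, rfl, hK⟩
    exact ⟨_, _, .snd h, hK⟩

lemma run_var (P : Program) (env : List Val) (i : ℕ) (K : Val → ℕ → Prop) :
    Run P env (.var i) K ↔ ∃ x, env[i]? = some x ∧ K x 1 := by
  constructor
  · rintro ⟨x, t, ⟨h⟩, hK⟩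
    exact ⟨_, h, hK⟩
  · rintro ⟨x, h, hK⟩
    exact ⟨_, _, .var h, hK⟩

lemma run_num (P : Program) (env : List Val) (n : ℕ) (K : Val → ℕ → Prop) :
    Run P env (.num n) K ↔ K (.num n) 1 := by
  constructor
  · rintro ⟨x, t, ⟨⟩, hK⟩
    exact hK
  · exact fun h => ⟨_, _, .num, h⟩

lemma run_pair (P : Program) (env : List Val) (e e' : Expr) (K : Val → ℕ → Prop) :
    Run P env (.pair e e') K ↔
      Run P env e fun x t => Run P env e' fun y s => K (.pair x y) (t + s + 1) := by
  constructor
  · rintro ⟨x, t, h, hK⟩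
    cases h with
    | pair h h' => exact ⟨_, _, h, _, _, h', hK⟩
  · rintro ⟨x, t, h, y, s, h', hK⟩
    exact ⟨_, _, .pair h h', hK⟩

lemma run_add (P : Program) (env : List Val) (e e' : Expr) (K : Val → ℕ → Prop) :
    Run P env (.add e e') K ↔ Run P env e fun x t => OnNum x fun m =>
      Run P env e' fun y s => OnNum y fun n => K (.num (m + n)) (t + s + 1) := by
  constructor
  · rintro ⟨x, t, h, hK⟩
    cases h with
    | add h h' => exact ⟨_, _, h, _, rfl, _, _, h', _, rfl, hK⟩
  · rintro ⟨x, t, h, m, rfl, y, s, h', n, rfl, hK⟩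
    exact ⟨_, _, .add h h', hK⟩

lemma run_sub (P : Program) (env : List Val) (e e' : Expr) (K : Val → ℕ → Prop) :
    Run P env (.sub e e') K ↔ Run P env e fun x t => OnNum x fun m =>
      Run P env e' fun y s => OnNum y fun n => K (.num (m - n)) (t + s + 1) := by
  constructor
  · rintro ⟨x, t, h, hK⟩
    cases h with
    | sub h h' => exact ⟨_, _, h, _, rfl, _, _, h', _, rfl, hK⟩
  · rintro ⟨x, t, h, m, rfl, y, s, h', n, rfl, hK⟩
    exact ⟨_, _, .sub h h', hK⟩

lemma run_letIn (P : Program) (env : List Val) (e e' : Expr) (K : Val → ℕ → Prop) :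
    Run P env (.letIn e e') K ↔
      Run P env e fun x t => Run P (x :: env) e' fun y s => K y (t + s + 1) := by
  constructor
  · rintro ⟨x, t, h, hK⟩
    cases h with
    | letIn h h' => exact ⟨_, _, h, _, _, h', hK⟩
  · rintro ⟨x, t, h, y, s, h', hK⟩
    exact ⟨_, _, .letIn h h', hK⟩

lemma run_ifPair (P : Program) (env : List Val) (e e₁ e₂ : Expr) (K : Val → ℕ → Prop) :
    Run P env (.ifPair e e₁ e₂) K ↔ Run P env e fun x t => CasePair x
      (Run P env e₁ fun y s => K y (t + s + 1)) (Run P env e₂ fun y s => K y (t + s + 1)) := by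
  constructor
  · rintro ⟨x, t, h, hK⟩
    cases h with
    | ifPair_pair h h' => exact ⟨_, _, h, _, _, h', hK⟩
    | ifPair_num h h' => exact ⟨_, _, h, _, _, h', hK⟩
  · rintro ⟨_ | _, t, h, y, s, h', hK⟩
    · exact ⟨_, _, .ifPair_num h h', hK⟩
    · exact ⟨_, _, .ifPair_pair h h', hK⟩

lemma run_ifLe (P : Program) (env : List Val) (e e' e₁ e₂ : Expr) (K : Val → ℕ → Prop) :
    Run P env (.ifLe e e' e₁ e₂) K ↔ Run P env e fun x t => OnNum x fun m =>
      Run P env e' fun y s => OnNum y fun n => CaseLe m n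
        (Run P env e₁ fun z r => K z (t + s + r + 1))
        (Run P env e₂ fun z r => K z (t + s + r + 1)) := by
  constructor
  · rintro ⟨x, t, h, hK⟩
    cases h with
    | ifLe_true h h' hmn h'' =>
      exact ⟨_, _, h, _, rfl, _, _, h', _, rfl, .inl ⟨hmn, _, _, h'', hK⟩⟩
    | ifLe_false h h' hmn h'' =>
      exact ⟨_, _, h, _, rfl, _, _, h', _, rfl, .inr ⟨hmn, _, _, h'', hK⟩⟩
  · rintro ⟨x, t, h, m, rfl, y, s, h', n, rfl, ⟨hmn, z, r, h'', hK⟩ | ⟨hmn, z, r, h'', hK⟩⟩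
    · exact ⟨_, _, .ifLe_true h h' hmn h'', hK⟩
    · exact ⟨_, _, .ifLe_false h h' hmn h'', hK⟩

lemma run_call (P : Program) (env : List Val) (f : ℕ) (e : Expr) (K : Val → ℕ → Prop) :
    Run P env (.call f e) K ↔
      Run P env e fun a t => Call P f a fun x s => K x (t + s + 1) := by
  constructor
  · rintro ⟨x, t, h, hK⟩
    cases h with
    | call hf h h' => exact ⟨_, _, h, _, hf, _, _, h', hK⟩
  · rintro ⟨a, t, h, body, hf, x, s, h', hK⟩
    exact ⟨_, _, .call hf h h', hK⟩

lemma onPair_pair (x y : Val) (K : Val → Val → Prop) : OnPair (.pair x y) K ↔ K x y := by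
  constructor
  · rintro ⟨_, _, h, hK⟩
    cases h
    exact hK
  · exact fun h => ⟨_, _, rfl, h⟩

lemma onNum_num (n : ℕ) (K : ℕ → Prop) : OnNum (.num n) K ↔ K n := by
  constructor
  · rintro ⟨_, h, hK⟩
    cases h
    exact hK
  · exact fun h => ⟨_, rfl, h⟩

lemma caseLe_iff (m n : ℕ) (A B : Prop) : CaseLe m n A B ↔ if m ≤ n then A else B := by
  unfold CaseLe
  split_ifs with h
  · simp [h]
  · simp [h, not_le.1 h]

/-- The rules for the symbolic execution of expressions. -/
theorem run_rules (P : Program) (K : Val → ℕ → Prop) :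
    (∀ a env, Run P (a :: env) (.var 0) K ↔ K a 1) ∧
    (∀ a b env, Run P (a :: b :: env) (.var 1) K ↔ K b 1) ∧
    (∀ a b c env, Run P (a :: b :: c :: env) (.var 2) K ↔ K c 1) ∧
    (∀ a b c d env, Run P (a :: b :: c :: d :: env) (.var 3) K ↔ K d 1) ∧
    (∀ a b c d e env, Run P (a :: b :: c :: d :: e :: env) (.var 4) K ↔ K e 1) ∧
    (∀ env n, Run P env (.num n) K ↔ K (.num n) 1) ∧
    (∀ env e, Run P env (.fst e) K ↔
      Run P env e fun v t => OnPair v fun x _ => K x (t + 1)) ∧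
    (∀ env e, Run P env (.snd e) K ↔
      Run P env e fun v t => OnPair v fun _ y => K y (t + 1)) ∧
    (∀ env e e', Run P env (.pair e e') K ↔
      Run P env e fun x t => Run P env e' fun y s => K (.pair x y) (t + s + 1)) ∧
    (∀ env e e', Run P env (.add e e') K ↔ Run P env e fun x t => OnNum x fun m =>
      Run P env e' fun y s => OnNum y fun n => K (.num (m + n)) (t + s + 1)) ∧
    (∀ env e e', Run P env (.sub e e') K ↔ Run P env e fun x t => OnNum x fun m =>
      Run P env e' fun y s => OnNum y fun n => K (.num (m - n)) (t + s + 1)) ∧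
    (∀ env e e', Run P env (.letIn e e') K ↔
      Run P env e fun x t => Run P (x :: env) e' fun y s => K y (t + s + 1)) ∧
    (∀ env e e₁ e₂, Run P env (.ifPair e e₁ e₂) K ↔ Run P env e fun x t => CasePair x
      (Run P env e₁ fun y s => K y (t + s + 1)) (Run P env e₂ fun y s => K y (t + s + 1))) ∧
    (∀ env e e' e₁ e₂, Run P env (.ifLe e e' e₁ e₂) K ↔ Run P env e fun x t => OnNum x fun m =>
      Run P env e' fun y s => OnNum y fun n => CaseLe m n
        (Run P env e₁ fun z r => K z (t + s + r + 1))
        (Run P env e₂ fun z r => K z (t + s + r + 1))) ∧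
    (∀ env f e, Run P env (.call f e) K ↔
      Run P env e fun a t => Call P f a fun x s => K x (t + s + 1)) :=
  ⟨by simp [run_var], by simp [run_var], by simp [run_var], by simp [run_var], by simp [run_var],
    fun _ _ => run_num .., fun _ _ => run_fst .., fun _ _ => run_snd ..,
    fun _ _ _ => run_pair .., fun _ _ _ => run_add .., fun _ _ _ => run_sub ..,
    fun _ _ _ => run_letIn .., fun _ _ _ _ => run_ifPair .., fun _ _ _ _ _ => run_ifLe ..,
    fun _ _ _ => run_call ..⟩

/-- The rules for the inspection of values. -/
theorem val_rules :
    (∀ x y K, OnPair (.pair x y) K ↔ K x y) ∧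
    (∀ n K, OnNum (.num n) K ↔ K n) ∧
    (∀ x y A B, CasePair (.pair x y) A B ↔ A) ∧
    (∀ n A B, CasePair (.num n) A B ↔ B) :=
  ⟨onPair_pair, onNum_num, fun _ _ _ _ => .rfl, fun _ _ _ => .rfl⟩

lemma caseLe_of_le {m n : ℕ} (h : m ≤ n) (A B : Prop) : CaseLe m n A B ↔ A := by
  simp [caseLe_iff, h]

lemma caseLe_of_lt {m n : ℕ} (h : n < m) (A B : Prop) : CaseLe m n A B ↔ B := by
  simp [caseLe_iff, h]

/-- The function `f` maps `a` to `v` in at most `n` steps. -/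
def Spec (P : Program) (f : ℕ) (a v : Val) (n : ℕ) : Prop :=
  ∃ t ≤ n, ∀ K, Call P f a K ↔ K v t

/-- As evaluation is deterministic, one successful run describes the call for every continuation
`K`. In this form it is a rewriting rule, and `simp` can execute the bodies of programs
symbolically. -/
lemma Spec.of_run {P : Program} {f : ℕ} {a v : Val} {n : ℕ} {body : Expr}
    (hf : P[f]? = some body) (h : Run P [a] body fun y t => y = v ∧ t ≤ n) : Spec P f a v n := by
  obtain ⟨y, t, h, rfl, hn⟩ := h
  refine ⟨t, hn, fun K => ⟨?_, fun hK => ⟨_, hf, _, _, h, hK⟩⟩⟩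
  rintro ⟨b, hf', y', t', h', hK⟩
  cases hf.symm.trans hf'
  obtain ⟨rfl, rfl⟩ := h.det h'
  exact hK

lemma Spec.mono {P : Program} {f : ℕ} {a v : Val} {m n : ℕ} (h : Spec P f a v m) (hmn : m ≤ n) :
    Spec P f a v n :=
  let ⟨t, ht, h⟩ := h
  ⟨t, ht.trans hmn, h⟩

lemma Spec.computes {P : Program} {a v : Val} {n : ℕ} (h : Spec P 0 a v n) :
    ∃ t ≤ n + 2, P.Computes a v t := by
  obtain ⟨t, ht, h⟩ := h
  obtain ⟨body, hf, y, s, he, rfl, rfl⟩ := (h fun y s => y = v ∧ s = t).2 ⟨rfl, rfl⟩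
  -- The two additional steps are the outer call and its argument.
  exact ⟨_, by omega, .call hf (.var rfl) he⟩

/-! ## Encodings of the intermediate data -/

def encItem (x : Item) : Val := .pair (encodeVertex x.1) (.num x.2)

mutual
def encT : TBranch → Val
  | .mk l I cs => .pair (.num l) (.pair (encodeList encItem I) (encF cs))
def encF : List TBranch → Val
  | [] => .num 0
  | b :: r => .pair (encT b) (encF r)
end

def encOpt : Option (TBranch × List TBranch) → Val
  | none => .num 0
  | some (m, r) => .pair (encT m) (encF r)

lemma encF_eq (F : List TBranch) : encF F = encodeList encT F := by
  induction F with
  | nil => rw [encF, encodeList]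
  | cons b r ih => rw [encF, encodeList, ih]

lemma encF_nil : encF [] = .num 0 := by rw [encF]

lemma encF_cons (b : TBranch) (r : List TBranch) :
    encF (b :: r) = .pair (encT b) (encF r) := by rw [encF]

lemma encT_mk (l : ℕ) (I : List Item) (cs : List TBranch) :
    encT (.mk l I cs) = .pair (.num l) (.pair (encodeList encItem I) (encF cs)) := by rw [encT]

lemma encOpt_none : encOpt none = .num 0 := rfl

lemma encOpt_some (m : TBranch) (r : List TBranch) :
    encOpt (some (m, r)) = .pair (encT m) (encF r) := rfl

/-- The number of nodes. -/
def nodes : List TBranch → ℕ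
  | [] => 0
  | .mk _ _ cs :: r => 1 + nodes cs + nodes r

lemma nodes_nil : nodes [] = 0 := by rw [nodes]

lemma nodes_mk (l : ℕ) (I : List Item) (cs r : List TBranch) :
    nodes (.mk l I cs :: r) = 1 + nodes cs + nodes r := by rw [nodes]

lemma nodes_cons (b : TBranch) (r : List TBranch) :
    nodes (b :: r) = 1 + nodes b.kids + nodes r := by
  cases b
  rw [nodes_mk, kids_mk]

lemma nodes_append (F G : List TBranch) : nodes (F ++ G) = nodes F + nodes G := by
  induction F with
  | nil => simp [nodes_nil]
  | cons b r ih =>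
    rw [List.cons_append, nodes_cons, nodes_cons, ih]
    omega

lemma length_le_nodes (F : List TBranch) : F.length ≤ nodes F := by
  induction F with
  | nil => simp
  | cons b r ih =>
    rw [List.length_cons, nodes_cons]
    omega

lemma its_length_le {b : TBranch} {F : List TBranch} (h : b ∈ F) :
    b.its.length ≤ (collect F).length := by
  induction F with
  | nil => simp at h
  | cons c r ih =>
    rw [collect_cons, List.length_append]
    rcases List.mem_cons.1 h with rfl | h
    · cases b
      simp
      omega
    · have := ih h
      omega

/-! ## The program -/

def fMain : ℕ := 0
def fAppend : ℕ := 1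
def fCollect : ℕ := 2
def fAmount : ℕ := 3
def fTotLen : ℕ := 4
def fCeilDiv : ℕ := 5
def fTraffic : ℕ := 6
def fTrafficSum : ℕ := 7
def fAddLen : ℕ := 8
def fExtractMin : ℕ := 9
def fNormStep : ℕ := 10
def fNorm : ℕ := 11
def fNormAll : ℕ := 12
def fExtractNode : ℕ := 13
def fFinish : ℕ := 14
def fSimplify : ℕ := 15
def fInit : ℕ := 16
def fSplit : ℕ := 17
def fInsertLen : ℕ := 18
def fPart : ℕ := 19
def fChain : ℕ := 20
def fTriple : ℕ := 21
def fFindHere : ℕ := 22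
def fFind : ℕ := 23
def fEqVertex : ℕ := 24
def fMem : ℕ := 25
def fWalk : ℕ := 26
def fTours : ℕ := 27
def fErase : ℕ := 28

def bMain : Expr :=
  .letIn (.call fInit (.pair (.num 0) (.pair (.num 0) (.snd (.var 0)))))
    (.letIn (.call fNormAll (.pair (.fst (.var 1)) (.call fSimplify (.pair (.fst (.var 1)) (.var 0)))))
      (.pair (.call fErase (.var 0))
        (.call fTours (.pair (.snd (.var 2))
          (.call fFind (.pair (.fst (.var 2)) (.pair (.num 0) (.var 0))))))))

def bAppend : Expr :=
  .ifPair (.fst (.var 0))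
    (.pair (.fst (.fst (.var 0))) (.call fAppend (.pair (.snd (.fst (.var 0))) (.snd (.var 0)))))
    (.snd (.var 0))

def bCollect : Expr :=
  .ifPair (.var 0)
    (.call fAppend (.pair (.fst (.snd (.fst (.var 0)))) (.call fAppend (.pair
      (.call fCollect (.snd (.snd (.fst (.var 0))))) (.call fCollect (.snd (.var 0)))))))
    (.num 0)

def bAmount : Expr :=
  .ifPair (.var 0) (.add (.snd (.fst (.var 0))) (.call fAmount (.snd (.var 0)))) (.num 0)

def bTotLen : Expr :=
  .ifPair (.var 0)
    (.add (.add (.fst (.fst (.var 0))) (.call fTotLen (.snd (.snd (.fst (.var 0))))))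
      (.call fTotLen (.snd (.var 0))))
    (.num 0)

/-- Division is done by repeated subtraction. The number of rounds is the quotient, a traffic, which
is polynomially bounded even though the demands are not. -/
def bCeilDiv : Expr :=
  .ifLe (.fst (.var 0)) (.num 0) (.num 0)
    (.add (.num 1)
      (.call fCeilDiv (.pair (.sub (.fst (.var 0)) (.snd (.var 0))) (.snd (.var 0)))))

def bTraffic : Expr :=
  .call fCeilDiv (.pair (.call fAmount (.call fAppend (.pair (.fst (.snd (.snd (.var 0))))
    (.call fCollect (.snd (.snd (.snd (.var 0)))))))) (.fst (.var 0)))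

def bTrafficSum : Expr :=
  .ifPair (.snd (.var 0))
    (.add (.call fTraffic (.pair (.fst (.var 0)) (.fst (.snd (.var 0)))))
      (.call fTrafficSum (.pair (.fst (.var 0)) (.snd (.snd (.var 0))))))
    (.num 0)

def bAddLen : Expr :=
  .ifPair (.snd (.var 0))
    (.pair (.pair (.add (.fst (.var 0)) (.fst (.fst (.snd (.var 0)))))
        (.snd (.fst (.snd (.var 0)))))
      (.call fAddLen (.pair (.fst (.var 0)) (.snd (.snd (.var 0))))))
    (.num 0)

def bExtractMin : Expr :=
  .ifPair (.var 0)
    (.letIn (.call fExtractMin (.snd (.var 0)))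
      (.ifPair (.snd (.snd (.fst (.var 1))))
        (.ifPair (.var 0)
          (.pair (.fst (.var 0)) (.pair (.fst (.var 1)) (.snd (.var 0))))
          (.num 0))
        (.ifPair (.var 0)
          (.ifLe (.call fAmount (.fst (.snd (.fst (.var 1)))))
            (.call fAmount (.fst (.snd (.fst (.var 0)))))
            (.var 1)
            (.pair (.fst (.var 0)) (.pair (.fst (.var 1)) (.snd (.var 0)))))
          (.var 1))))
    (.num 0)

def bNormStep : Expr :=
  .letIn (.call fExtractMin (.snd (.var 0)))
    (.ifPair (.var 0)
      (.letIn (.call fExtractMin (.snd (.var 0)))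
        (.ifPair (.var 0)
          (.ifLe (.add (.call fAmount (.fst (.snd (.fst (.var 1)))))
              (.call fAmount (.fst (.snd (.fst (.var 0))))))
            (.fst (.var 2))
            (.pair (.pair (.add (.fst (.fst (.var 1))) (.fst (.fst (.var 0))))
                (.pair (.call fAppend (.pair (.fst (.snd (.fst (.var 1))))
                  (.fst (.snd (.fst (.var 0)))))) (.num 0)))
              (.snd (.var 0)))
            (.letIn (.call fExtractMin (.snd (.var 0)))
              (.ifPair (.var 0)
                (.ifPair (.snd (.var 0))
                  (.ifLe (.add (.fst (.var 3)) (.fst (.var 3)))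
                    (.add (.add (.call fAmount (.fst (.snd (.fst (.var 2)))))
                        (.call fAmount (.fst (.snd (.fst (.var 1))))))
                      (.call fAmount (.fst (.snd (.fst (.var 0))))))
                    (.num 0)
                    (.pair (.pair (.num 0) (.pair (.num 0) (.pair (.fst (.var 2))
                        (.pair (.fst (.var 1)) (.pair (.fst (.var 0)) (.num 0))))))
                      (.snd (.var 0))))
                  (.num 0))
                (.num 0))))
          (.num 0)))
      (.num 0))

def bNorm : Expr :=
  .letIn (.call fNormStep (.pair (.fst (.var 0)) (.call fAppend (.snd (.var 0)))))
    (.ifPair (.var 0)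
      (.call fNorm (.pair (.fst (.var 1))
        (.pair (.pair (.fst (.var 0)) (.num 0)) (.snd (.var 0)))))
      (.snd (.var 1)))

/-- A pair of lists is encoded just as the argument of `fAppend`, so the result of `fNorm` is passed
on directly. -/
def bNormAll : Expr := .call fAppend (.call fNorm (.var 0))

def bExtractNode : Expr :=
  .ifPair (.snd (.snd (.var 0)))
    (.letIn (.call fExtractNode
        (.pair (.fst (.var 0)) (.pair (.fst (.snd (.var 0))) (.snd (.snd (.snd (.var 0)))))))
      (.ifPair (.snd (.snd (.fst (.snd (.snd (.var 1))))))
        (.ifLe (.fst (.snd (.var 1)))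
          (.call fTraffic (.pair (.fst (.var 1)) (.fst (.snd (.snd (.var 1))))))
          (.snd (.snd (.var 1)))
          (.ifPair (.var 0)
            (.pair (.fst (.var 0)) (.pair (.fst (.snd (.snd (.var 1)))) (.snd (.var 0))))
            (.num 0)))
        (.ifPair (.var 0)
          (.pair (.fst (.var 0)) (.pair (.fst (.snd (.snd (.var 1)))) (.snd (.var 0))))
          (.num 0))))
    (.num 0)

def bFinish : Expr :=
  .letIn (.call fCollect (.snd (.snd (.var 0))))
    (.ifLe (.call fAmount (.var 0)) (.fst (.var 1))
      (.pair (.pair (.add (.fst (.snd (.var 1))) (.call fTotLen (.snd (.snd (.var 1)))))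
        (.pair (.var 0) (.num 0))) (.num 0))
      (.letIn (.call fCeilDiv (.pair (.call fAmount (.var 0)) (.fst (.var 1))))
        (.ifLe (.call fTrafficSum (.pair (.fst (.var 2)) (.snd (.snd (.var 2))))) (.var 0)
          (.call fAddLen (.snd (.var 2)))
          (.letIn (.call fExtractNode
              (.pair (.fst (.var 2)) (.pair (.var 0) (.snd (.snd (.var 2))))))
            (.ifPair (.var 0)
              (.letIn (.call fNormAll (.pair (.fst (.var 3)) (.pair (.num 0) (.call fAppend
                  (.pair (.snd (.var 0)) (.snd (.snd (.fst (.var 0)))))))))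
                (.ifLe (.call fTrafficSum (.pair (.fst (.var 4)) (.var 0))) (.var 2)
                  (.call fAddLen
                    (.pair (.add (.fst (.snd (.var 4))) (.fst (.fst (.var 1)))) (.var 0)))
                  (.pair (.pair (.add (.fst (.snd (.var 4))) (.fst (.fst (.var 1))))
                    (.pair (.num 0) (.var 0))) (.num 0))))
              (.num 0))))))

def bSimplify : Expr :=
  .ifPair (.snd (.var 0))
    (.letIn (.call fSimplify (.pair (.fst (.var 0)) (.snd (.snd (.var 0)))))
      (.ifPair (.snd (.snd (.fst (.snd (.var 1)))))
        (.letIn (.call fNorm (.pair (.fst (.var 1))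
            (.call fSimplify (.pair (.fst (.var 1)) (.snd (.snd (.fst (.snd (.var 1)))))))))
          (.letIn (.call fFinish (.pair (.fst (.var 2))
              (.pair (.fst (.fst (.snd (.var 2)))) (.call fAppend (.var 0)))))
            (.ifPair (.var 0)
              (.pair (.call fAppend (.pair (.var 0) (.fst (.var 2)))) (.snd (.var 2)))
              (.ifPair (.fst (.var 1))
                (.pair (.pair (.pair (.fst (.fst (.snd (.var 3))))
                    (.pair (.fst (.snd (.fst (.snd (.var 3))))) (.call fAppend (.var 1))))
                  (.fst (.var 2))) (.snd (.var 2)))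
                (.pair (.fst (.var 2)) (.pair (.pair (.fst (.fst (.snd (.var 3))))
                    (.pair (.fst (.snd (.fst (.snd (.var 3))))) (.snd (.var 1))))
                  (.snd (.var 2))))))))
        (.pair (.fst (.var 0)) (.pair (.fst (.snd (.var 1))) (.snd (.var 0))))))
    (.pair (.num 0) (.num 0))

def bInit : Expr :=
  .ifPair (.snd (.snd (.var 0)))
    (.letIn (.call fAppend (.pair (.fst (.var 0)) (.pair (.fst (.snd (.var 0))) (.num 0))))
      (.pair
        (.pair (.fst (.fst (.snd (.snd (.var 1)))))
          (.ifPair (.snd (.snd (.fst (.snd (.snd (.var 1))))))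
            (.pair (.num 0) (.call fInit (.pair (.var 0)
              (.pair (.num 0) (.snd (.snd (.fst (.snd (.snd (.var 1))))))))))
            (.pair (.pair (.pair (.var 0) (.fst (.snd (.fst (.snd (.snd (.var 1)))))))
              (.num 0)) (.num 0))))
        (.call fInit (.pair (.fst (.var 1)) (.pair (.add (.fst (.snd (.var 1))) (.num 1))
          (.snd (.snd (.snd (.var 1)))))))))
    (.num 0)

def bSplit : Expr :=
  .ifPair (.snd (.var 0))
    (.ifLe (.snd (.fst (.snd (.var 0)))) (.fst (.var 0))
      (.letIn (.call fSplit (.pair (.sub (.fst (.var 0)) (.snd (.fst (.snd (.var 0)))))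
          (.snd (.snd (.var 0)))))
        (.pair (.pair (.fst (.snd (.var 1))) (.fst (.var 0))) (.snd (.var 0))))
      (.pair (.pair (.pair (.fst (.fst (.snd (.var 0)))) (.fst (.var 0))) (.num 0))
        (.pair (.pair (.fst (.fst (.snd (.var 0))))
          (.sub (.snd (.fst (.snd (.var 0)))) (.fst (.var 0)))) (.snd (.snd (.var 0))))))
    (.pair (.num 0) (.num 0))

def bInsertLen : Expr :=
  .ifPair (.snd (.var 0))
    (.ifLe (.fst (.fst (.var 0))) (.fst (.fst (.snd (.var 0))))
      (.pair (.fst (.var 0)) (.snd (.var 0)))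
      (.pair (.fst (.snd (.var 0)))
        (.call fInsertLen (.pair (.fst (.var 0)) (.snd (.snd (.var 0)))))))
    (.pair (.fst (.var 0)) (.num 0))

def bPart : Expr :=
  .ifPair (.var 0)
    (.letIn (.call fPart (.snd (.var 0)))
      (.ifPair (.snd (.snd (.fst (.var 1))))
        (.pair (.fst (.var 0)) (.pair (.fst (.var 1)) (.snd (.var 0))))
        (.pair (.call fInsertLen (.pair (.fst (.var 1)) (.fst (.var 0)))) (.snd (.var 0)))))
    (.pair (.num 0) (.num 0))

def bChain : Expr :=
  .letIn (.call fPart (.snd (.snd (.var 0))))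
    (.ifPair (.fst (.var 0))
      (.ifPair (.snd (.fst (.var 0)))
        (.ifPair (.snd (.snd (.fst (.var 0))))
          (.letIn (.call fSplit (.pair
              (.sub (.sub (.fst (.var 1)) (.fst (.snd (.var 1))))
                (.call fAmount (.fst (.snd (.fst (.snd (.snd (.fst (.var 0)))))))))
              (.fst (.snd (.fst (.fst (.var 0)))))))
            (.pair
              (.call fAppend (.pair (.fst (.snd (.fst (.snd (.snd (.fst (.var 1)))))))
                (.fst (.var 0))))
              (.pair (.call fAppend (.pair (.fst (.snd (.fst (.snd (.fst (.var 1))))))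
                (.snd (.var 0)))) (.num 0))))
          (.ifPair (.snd (.var 0))
            (.letIn (.call fSplit (.pair
                (.sub (.fst (.var 1)) (.call fAmount (.fst (.snd (.fst (.snd (.fst (.var 0))))))))
                (.fst (.snd (.fst (.fst (.var 0)))))))
              (.letIn (.call fChain (.pair (.fst (.var 2)) (.pair
                  (.add (.fst (.snd (.var 2))) (.call fAmount (.snd (.var 0))))
                  (.snd (.snd (.fst (.snd (.var 1))))))))
                (.pair (.call fAppend (.pair (.snd (.var 1)) (.fst (.var 0))))
                  (.pair (.call fAppend (.pair (.fst (.snd (.fst (.snd (.fst (.var 2))))))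
                    (.fst (.var 1)))) (.snd (.var 0))))))
            (.pair (.num 0) (.num 0))))
        (.pair (.num 0) (.num 0)))
      (.pair (.num 0) (.num 0)))

def bTriple : Expr :=
  .letIn (.snd (.snd (.var 0)))
    (.ifLe (.add (.fst (.fst (.var 0))) (.fst (.fst (.var 0)))) (.fst (.snd (.var 1)))
      (.letIn (.call fSplit (.pair
          (.sub (.fst (.var 1)) (.call fAmount (.fst (.snd (.snd (.snd (.var 0)))))))
          (.fst (.snd (.fst (.var 0))))))
        (.pair (.call fAppend (.pair (.fst (.snd (.snd (.snd (.var 1))))) (.fst (.var 0))))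
          (.pair (.call fAppend (.pair (.fst (.snd (.fst (.snd (.var 1)))))
            (.fst (.call fSplit (.pair
              (.sub (.fst (.var 2)) (.call fAmount (.fst (.snd (.fst (.snd (.var 1)))))))
              (.snd (.var 0))))))) (.num 0))))
      (.pair (.fst (.snd (.snd (.snd (.var 0))))) (.pair (.fst (.snd (.fst (.snd (.var 0)))))
        (.pair (.fst (.snd (.fst (.var 0)))) (.num 0)))))

/-- The function maps `(Q, (x, cs))` to `findHere Q x cs`. -/
def bFindHere : Expr :=
  .letIn (.call fPart (.snd (.snd (.var 0))))
    (.letIn (.fst (.var 0))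
      (.ifPair (.snd (.var 1))
        (.ifPair (.snd (.snd (.var 1)))
          -- The pair `(t, ts)` returned for a chain has the same encoding as the list `t :: ts`.
          (.call fAppend (.pair
            (.call fChain (.pair (.fst (.var 2)) (.pair (.num 0)
              (.snd (.snd (.fst (.snd (.var 1))))))))
            (.call fChain (.pair (.fst (.var 2)) (.pair (.num 0)
              (.snd (.snd (.fst (.snd (.snd (.var 1)))))))))))
          (.ifPair (.var 0)
            (.ifPair (.snd (.var 0))
              (.ifPair (.snd (.snd (.var 0)))
                (.call fTriple (.pair (.fst (.var 2)) (.pair (.fst (.snd (.var 2)))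
                  (.pair (.fst (.var 0)) (.pair (.fst (.snd (.var 0)))
                    (.fst (.snd (.snd (.var 0)))))))))
                (.ifLe (.fst (.snd (.var 2))) (.fst (.fst (.var 0)))
                  (.pair (.fst (.snd (.fst (.snd (.var 0)))))
                    (.pair (.fst (.snd (.fst (.var 0)))) (.num 0)))
                  (.num 0)))
              (.num 0))
            (.num 0)))
        (.ifPair (.var 0)
          (.ifPair (.snd (.var 0))
            (.ifPair (.snd (.snd (.var 0)))
              (.ifPair (.snd (.snd (.snd (.var 0))))
                (.call fTriple (.pair (.fst (.var 2)) (.pair (.fst (.snd (.var 2)))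
                  (.pair (.fst (.var 0)) (.pair (.fst (.snd (.var 0)))
                    (.fst (.snd (.snd (.var 0)))))))))
                (.num 0))
              (.ifLe (.fst (.snd (.var 2))) (.fst (.fst (.var 0)))
                (.pair (.fst (.snd (.fst (.snd (.var 0)))))
                  (.pair (.fst (.snd (.fst (.var 0)))) (.num 0)))
                (.num 0)))
            (.num 0))
          (.num 0))))

def bFind : Expr :=
  .ifPair (.snd (.snd (.var 0)))
    (.ifPair (.snd (.snd (.fst (.snd (.snd (.var 0))))))
      (.letIn (.pair (.fst (.var 0))
          (.pair (.add (.fst (.snd (.var 0))) (.fst (.fst (.snd (.snd (.var 0))))))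
            (.snd (.snd (.fst (.snd (.snd (.var 0))))))))
        (.letIn (.call fFind (.var 0))
          (.ifPair (.var 0) (.var 0)
            (.letIn (.call fFindHere (.var 1))
              (.ifPair (.var 0) (.var 0)
                (.call fFind (.pair (.fst (.var 3)) (.pair (.fst (.snd (.var 3)))
                  (.snd (.snd (.snd (.var 3))))))))))))
      (.ifLe (.fst (.var 0)) (.call fAmount (.fst (.snd (.fst (.snd (.snd (.var 0)))))))
        (.pair (.fst (.snd (.fst (.snd (.snd (.var 0)))))) (.num 0))
        (.call fFind (.pair (.fst (.var 0)) (.pair (.fst (.snd (.var 0)))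
          (.snd (.snd (.snd (.var 0)))))))))
    (.num 0)

def bEqVertex : Expr :=
  .ifPair (.fst (.var 0))
    (.ifPair (.snd (.var 0))
      (.ifLe (.fst (.fst (.var 0))) (.fst (.snd (.var 0)))
        (.ifLe (.fst (.snd (.var 0))) (.fst (.fst (.var 0)))
          (.call fEqVertex (.pair (.snd (.fst (.var 0))) (.snd (.snd (.var 0)))))
          (.num 0))
        (.num 0))
      (.num 0))
    (.ifPair (.snd (.var 0)) (.num 0) (.num 1))

def bMem : Expr :=
  .ifPair (.snd (.var 0))
    (.ifLe (.num 1) (.call fEqVertex (.pair (.fst (.var 0)) (.fst (.fst (.snd (.var 0))))))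
      (.num 1)
      (.call fMem (.pair (.fst (.var 0)) (.snd (.snd (.var 0))))))
    (.num 0)

/-- The function maps `(S, (u, (i, bs)))` to `walk S u i bs`. -/
def bWalk : Expr :=
  .ifPair (.snd (.snd (.snd (.var 0))))
    (.letIn (.call fAppend
        (.pair (.fst (.snd (.var 0))) (.pair (.fst (.snd (.snd (.var 0)))) (.num 0))))
      (.letIn (.call fWalk (.pair (.fst (.var 1)) (.pair (.fst (.snd (.var 1)))
          (.pair (.add (.fst (.snd (.snd (.var 1)))) (.num 1))
            (.snd (.snd (.snd (.snd (.var 1)))))))))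
        (.ifPair (.snd (.snd (.fst (.snd (.snd (.snd (.var 2)))))))
          (.letIn (.call fWalk (.pair (.fst (.var 2)) (.pair (.var 1)
              (.pair (.num 0) (.snd (.snd (.fst (.snd (.snd (.snd (.var 2)))))))))))
            (.ifPair (.var 0)
              (.pair (.var 2) (.call fAppend
                (.pair (.var 0) (.pair (.fst (.snd (.var 3))) (.var 1)))))
              (.var 1)))
          (.ifLe (.num 1) (.call fMem (.pair (.var 1) (.fst (.var 2))))
            (.pair (.var 1) (.pair (.fst (.snd (.var 2))) (.var 0)))
            (.var 0)))))
    (.num 0)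

def bTours : Expr :=
  .ifPair (.snd (.var 0))
    (.pair
      (.pair (.pair (.num 0) (.call fWalk (.pair (.fst (.snd (.var 0)))
          (.pair (.num 0) (.pair (.num 0) (.fst (.var 0)))))))
        (.fst (.snd (.var 0))))
      (.call fTours (.pair (.fst (.var 0)) (.snd (.snd (.var 0))))))
    (.num 0)

def bErase : Expr :=
  .ifPair (.var 0)
    (.pair (.pair (.fst (.fst (.var 0))) (.pair (.call fAmount (.fst (.snd (.fst (.var 0)))))
        (.call fErase (.snd (.snd (.fst (.var 0)))))))
      (.call fErase (.snd (.var 0))))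
    (.num 0)

def prog : Program :=
  [bMain, bAppend, bCollect, bAmount, bTotLen, bCeilDiv, bTraffic, bTrafficSum, bAddLen,
    bExtractMin, bNormStep, bNorm, bNormAll, bExtractNode, bFinish, bSimplify, bInit, bSplit,
    bInsertLen, bPart, bChain, bTriple, bFindHere, bFind, bEqVertex, bMem, bWalk, bTours, bErase]

/-! ## Elementary functions -/

section
variable {α : Type} (enc : α → Val)

lemma encodeList_nil : encodeList enc [] = .num 0 := by rw [encodeList]

lemma encodeList_cons (x : α) (l : List α) :
    encodeList enc (x :: l) = .pair (enc x) (encodeList enc l) := by rw [encodeList]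

lemma append_spec (xs ys : List α) :
    Spec prog fAppend (.pair (encodeList enc xs) (encodeList enc ys)) (encodeList enc (xs ++ ys))
      (20 * xs.length + 10) := by
  induction xs with
  | nil =>
    refine .of_run (show _ = some bAppend from rfl) ?_
    simp only [bAppend, encodeList_nil, List.nil_append, ↓run_rules, ↓val_rules]
    simp
  | cons x xs ih =>
    obtain ⟨t, ht, ih⟩ := ih
    refine .of_run (show _ = some bAppend from rfl) ?_
    simp only [bAppend, encodeList_cons, List.cons_append, ↓run_rules, ↓val_rules, ↓ih]
    simp
    omega

end

lemma append_spec_forest (F G : List TBranch) :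
    Spec prog fAppend (.pair (encF F) (encF G)) (encF (F ++ G)) (20 * F.length + 10) := by
  simpa only [encF_eq] using append_spec encT F G

lemma amount_spec (I : List Item) :
    Spec prog fAmount (encodeList encItem I) (.num (amount I)) (10 * I.length + 5) := by
  refine .of_run (show _ = some bAmount from rfl) ?_
  induction I with
  | nil =>
    simp only [bAmount, encodeList_nil, ↓run_rules, ↓val_rules]
    simp
  | cons x xs ih =>
    obtain ⟨t, ht, ih⟩ := Spec.of_run (show prog[fAmount]? = some bAmount from rfl) ih
    simp only [bAmount, encodeList_cons, encItem, ↓run_rules, ↓val_rules, ↓ih]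
    simp
    omega

lemma collect_spec (N : ℕ) (F : List TBranch) (hN : (collect F).length ≤ N) :
    Spec prog fCollect (encF F) (encodeList encItem (collect F)) (nodes F * (20 * N + 60) + 5) := by
  refine .of_run (show _ = some bCollect from rfl) ?_
  induction F using forest_induction with
  | nil =>
    simp only [bCollect, encF_nil, ↓run_rules, ↓val_rules]
    simp [encodeList_nil]
  | cons l I cs r ih₁ ih₂ =>
    simp only [collect_cons, items_mk, List.length_append] at hN
    obtain ⟨t₁, h₁, e₁⟩ := Spec.of_run (show prog[fCollect]? = some bCollect from rfl)
      (ih₁ (by omega))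
    obtain ⟨t₂, h₂, e₂⟩ := Spec.of_run (show prog[fCollect]? = some bCollect from rfl)
      (ih₂ (by omega))
    obtain ⟨t₃, h₃, e₃⟩ := append_spec encItem (collect cs) (collect r)
    obtain ⟨t₄, h₄, e₄⟩ := append_spec encItem I (collect cs ++ collect r)
    simp only [bCollect, encF_cons, encT_mk, ↓run_rules, ↓val_rules, ↓e₁, ↓e₂, ↓e₃, ↓e₄]
    simp only [collect_cons, items_mk, List.append_assoc, nodes_mk, true_and, add_mul, one_mul]
    omega

lemma totLen_spec (F : List TBranch) :
    Spec prog fTotLen (encF F) (.num (totLen F)) (nodes F * 20 + 5) := by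
  refine .of_run (show _ = some bTotLen from rfl) ?_
  induction F using forest_induction with
  | nil =>
    simp only [bTotLen, encF_nil, ↓run_rules, ↓val_rules]
    simp
  | cons l I cs r ih₁ ih₂ =>
    obtain ⟨t₁, h₁, e₁⟩ := Spec.of_run (show prog[fTotLen]? = some bTotLen from rfl) ih₁
    obtain ⟨t₂, h₂, e₂⟩ := Spec.of_run (show prog[fTotLen]? = some bTotLen from rfl) ih₂
    simp only [bTotLen, encF_cons, encT_mk, ↓run_rules, ↓val_rules, ↓e₁, ↓e₂]
    simp only [totLen, nodes_mk, true_and]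
    omega

lemma ceilDiv_spec {Q : ℕ} (hQ : 0 < Q) (k n : ℕ) (hk : n ⌈/⌉ Q = k) :
    Spec prog fCeilDiv (.pair (.num n) (.num Q)) (.num k) (k * 20 + 10) := by
  refine .of_run (show _ = some bCeilDiv from rfl) ?_
  induction k generalizing n with
  | zero =>
    have hn : n ≤ 0 := by
      by_contra h
      have := (lt_ceilDiv hQ (n := n) (k := 0)).2 (by omega)
      omega
    simp only [bCeilDiv, ↓run_rules, ↓val_rules, ↓caseLe_of_le hn]
    simp
  | succ k ih =>
    have h1 := (lt_ceilDiv hQ (n := n) (k := k)).1 (by omega)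
    have h2 := (ceilDiv_le_iff_le_mul hQ).1 hk.le
    have hn : 0 < n := by omega
    have h3 : (n - Q) ⌈/⌉ Q = k := by
      apply le_antisymm
      · rw [ceilDiv_le_iff_le_mul hQ]
        rw [mul_add, mul_one] at h2
        omega
      · rcases k with _ | k
        · omega
        · apply (lt_ceilDiv hQ).2
          rw [mul_add, mul_one] at h1
          omega
    obtain ⟨t₁, h₁, e₁⟩ := Spec.of_run (show prog[fCeilDiv]? = some bCeilDiv from rfl) (ih _ h3)
    simp only [bCeilDiv, ↓run_rules, ↓val_rules, ↓caseLe_of_lt hn, ↓e₁]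
    simp
    omega

-- Running time of the simplification

/-- Bounds on the number of the nodes and on the items of a list of branches. -/
structure Bdd (Q N : ℕ) (F : List TBranch) : Prop where
  nodes_le : nodes F ≤ 2 * N
  length_le : (collect F).length ≤ N
  amount_le : amount (collect F) ≤ Q * N

namespace Bdd
variable {Q N : ℕ} {b : TBranch} {F G : List TBranch}

lemma tail (h : Bdd Q N (b :: F)) : Bdd Q N F := by
  obtain ⟨h1, h2, h3⟩ := h
  rw [nodes_cons] at h1
  simp only [collect_cons, List.length_append, amount_append] at h2 h3
  exact ⟨by omega, by omega, by omega⟩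

lemma kids (h : Bdd Q N (b :: F)) : Bdd Q N b.kids := by
  obtain ⟨h1, h2, h3⟩ := h
  rw [nodes_cons] at h1
  cases b
  simp only [collect_cons, items_mk, List.length_append, amount_append] at h2 h3
  exact ⟨by simp at *; omega, by simp at *; omega, by simp at *; omega⟩

lemma append_iff : Bdd Q N (F ++ G) ↔ nodes F + nodes G ≤ 2 * N ∧
    (collect F).length + (collect G).length ≤ N ∧
    amount (collect F) + amount (collect G) ≤ Q * N := by
  constructor
  · rintro ⟨h1, h2, h3⟩
    simp [nodes_append] at h1 h2 h3
    exact ⟨h1, h2, h3⟩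
  · rintro ⟨h1, h2, h3⟩
    exact ⟨by simpa [nodes_append], by simpa, by simpa⟩

lemma ceilDiv_le (h : Bdd Q N F) (hQ : 0 < Q) : amount (collect F) ⌈/⌉ Q ≤ N :=
  (ceilDiv_le_iff_le_mul hQ).2 h.amount_le

end Bdd

def tCollect (N : ℕ) : ℕ := 2 * N * (20 * N + 60) + 5

lemma collect_spec_of_bdd {Q N : ℕ} {F : List TBranch} (h : Bdd Q N F) :
    Spec prog fCollect (encF F) (encodeList encItem (collect F)) (tCollect N) :=
  (collect_spec N F h.length_le).mono
    (Nat.add_le_add_right (Nat.mul_le_mul_right _ h.nodes_le) _)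

def tTraffic (N : ℕ) : ℕ := tCollect N + 60 * N + 100

lemma traffic_spec {Q N : ℕ} (hQ : 0 < Q) {b : TBranch} (h : Bdd Q N [b]) :
    Spec prog fTraffic (.pair (.num Q) (encT b)) (.num (b.traffic Q)) (tTraffic N) := by
  obtain ⟨t₁, h₁, e₁⟩ := collect_spec_of_bdd h.kids
  have hl := h.length_le
  obtain ⟨t₄, h₄, e₄⟩ := ceilDiv_spec hQ _ (amount b.items) rfl
  have hc := h.ceilDiv_le hQ
  rcases b with ⟨l, I, cs⟩
  simp only [collect_cons, items_mk, kids_mk, collect_nil, List.append_nil, List.length_append]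
    at e₁ e₄ h₄ hl hc
  obtain ⟨t₂, h₂, e₂⟩ := append_spec encItem I (collect cs)
  obtain ⟨t₃, h₃, e₃⟩ := amount_spec (I ++ collect cs)
  rw [List.length_append] at h₃
  refine .of_run (show _ = some bTraffic from rfl) ?_
  simp only [bTraffic, encT_mk, ↓run_rules, ↓val_rules, ↓e₁, ↓e₂, ↓e₃, ↓e₄]
  simp only [traffic, items_mk, true_and]
  unfold tTraffic
  omega

def tTrafficSum (N : ℕ) : ℕ := 2 * N * (tTraffic N + 20) + 10

lemma trafficSum_spec {Q N : ℕ} (hQ : 0 < Q) {F : List TBranch} (h : Bdd Q N F) :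
    Spec prog fTrafficSum (.pair (.num Q) (encF F)) (.num (trafficSum Q F)) (tTrafficSum N) := by
  refine Spec.mono (m := F.length * (tTraffic N + 20) + 10) ?_
    (Nat.add_le_add_right (Nat.mul_le_mul_right _ ((length_le_nodes F).trans h.nodes_le)) _)
  induction F with
  | nil =>
    refine .of_run (show _ = some bTrafficSum from rfl) ?_
    simp only [bTrafficSum, encF_nil, ↓run_rules, ↓val_rules]
    simp [trafficSum]
  | cons b r ih =>
    obtain ⟨t₁, h₁, e₁⟩ := ih h.tail
    obtain ⟨t₂, h₂, e₂⟩ := traffic_spec hQ (N := N) (b := b) (by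
      obtain ⟨a1, a2, a3⟩ := (Bdd.append_iff (F := [b])).1 h
      exact ⟨by omega, by omega, by omega⟩)
    refine .of_run (show _ = some bTrafficSum from rfl) ?_
    simp only [bTrafficSum, encF_cons, ↓run_rules, ↓val_rules, ↓e₁, ↓e₂]
    simp only [trafficSum, List.map_cons, List.sum_cons, List.length_cons, add_mul, one_mul,
      true_and]
    omega

lemma addLen_spec (l : ℕ) (F : List TBranch) :
    Spec prog fAddLen (.pair (.num l) (encF F)) (encF (addLen l F)) (F.length * 40 + 10) := by
  induction F with
  | nil =>
    refine .of_run (show _ = some bAddLen from rfl) ?_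
    simp only [bAddLen, encF_nil, ↓run_rules, ↓val_rules]
    simp [addLen, encF_nil]
  | cons b r ih =>
    obtain ⟨t₁, h₁, e₁⟩ := ih
    rcases b with ⟨l', I, cs⟩
    refine .of_run (show _ = some bAddLen from rfl) ?_
    simp only [bAddLen, addLen, encF_cons, encT_mk, ↓run_rules, ↓val_rules, ↓e₁]
    simp only [List.length_cons, true_and]
    omega

lemma extractMin_spec (N : ℕ) (F : List TBranch) (hN : (collect F).length ≤ N) :
    Spec prog fExtractMin (encF F) (encOpt (extractMin F)) (F.length * (20 * N + 60) + 5) := by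
  induction F with
  | nil =>
    refine .of_run (show _ = some bExtractMin from rfl) ?_
    simp only [bExtractMin, extractMin, encOpt_none, encF_nil, ↓run_rules, ↓val_rules]
    simp
  | cons b r ih =>
    have hN' := hN
    rw [collect_cons, List.length_append] at hN'
    obtain ⟨t₁, h₁, e₁⟩ := ih (by omega)
    obtain ⟨t₂, h₂, e₂⟩ := amount_spec b.its
    have hb := its_length_le (show b ∈ b :: r by simp)
    refine .of_run (show _ = some bExtractMin from rfl) ?_
    rcases hm : extractMin r with _ | ⟨m, r'⟩
    · rw [hm] at e₁
      rcases b with ⟨l, I, _ | ⟨c, cs⟩⟩ <;>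
      · simp only [bExtractMin, extractMin, hm, encOpt_none, encOpt_some, encF_nil, encF_cons,
          encT_mk, ↓run_rules, ↓val_rules, ↓e₁] at *
        simp only [List.length_cons, true_and, add_mul, one_mul]
        omega
    · rw [hm] at e₁
      obtain ⟨t₃, h₃, e₃⟩ := amount_spec m.its
      have hm' := its_length_le (show m ∈ b :: r from
        List.mem_cons_of_mem _ ((extractMin_some hm).2.1.mem_iff.2 (by simp)))
      rcases m with ⟨l', I', ks⟩
      rcases b with ⟨l, I, _ | ⟨c, cs⟩⟩
      · simp only [encOpt_some, its_mk, encT_mk] at e₁ e₂ e₃ h₂ h₃ hb hm'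
        by_cases hle : amount I ≤ amount I'
        · have hx : extractMin (.mk l I [] :: r) = some (.mk l I [], r) := by
            rw [extractMin, hm]
            exact if_pos hle
          simp only [bExtractMin, hx, encOpt_some, encF_nil, encF_cons,
            encT_mk, ↓run_rules, ↓val_rules, ↓e₁, ↓e₂, ↓e₃, ↓caseLe_of_le hle]
          simp only [List.length_cons, true_and, add_mul, one_mul]
          omega
        · have hx : extractMin (.mk l I [] :: r) = some (.mk l' I' ks, .mk l I [] :: r') := by
            rw [extractMin, hm]
            exact if_neg hle
          simp only [bExtractMin, hx, encOpt_some, encF_nil, encF_cons,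
            encT_mk, ↓run_rules, ↓val_rules, ↓e₁, ↓e₂, ↓e₃, ↓caseLe_of_lt (not_le.1 hle)]
          simp only [List.length_cons, true_and, add_mul, one_mul]
          omega
      · simp only [bExtractMin, extractMin, hm, encOpt_some, encF_cons,
          encT_mk, ↓run_rules, ↓val_rules, ↓e₁] at *
        simp only [List.length_cons, true_and, add_mul, one_mul]
        omega

lemma nodes_eq_sum (F : List TBranch) : nodes F = (F.map fun b => 1 + nodes b.kids).sum := by
  induction F with
  | nil => simp [nodes_nil]
  | cons b r ih => rw [nodes_cons, ih, List.map_cons, List.sum_cons]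

lemma Bdd.of_perm {Q N : ℕ} {F G : List TBranch} (h : Bdd Q N F) (hp : F.Perm G) : Bdd Q N G where
  nodes_le := by
    have := h.nodes_le
    rwa [nodes_eq_sum, (hp.map _).sum_eq, ← nodes_eq_sum] at this
  length_le := by
    rw [← hp.collect.length_eq]
    exact h.length_le
  amount_le := by
    rw [← hp.collect.amount_eq]
    exact h.amount_le

lemma Bdd.its_le {Q N : ℕ} {F : List TBranch} {b : TBranch} (h : Bdd Q N (b :: F)) :
    b.its.length ≤ N :=
  (its_length_le (by simp)).trans h.length_le

def tExtractMin (N : ℕ) : ℕ := 2 * N * (20 * N + 60) + 5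

lemma extractMin_spec_of_bdd {Q N : ℕ} {F : List TBranch} (h : Bdd Q N F) :
    Spec prog fExtractMin (encF F) (encOpt (extractMin F)) (tExtractMin N) :=
  (extractMin_spec N F h.length_le).mono (Nat.add_le_add_right
    (Nat.mul_le_mul_right _ ((length_le_nodes F).trans h.nodes_le)) _)

def tNormStep (N : ℕ) : ℕ := 3 * tExtractMin N + 100 * N + 300

lemma normStep_spec {Q N : ℕ} {F : List TBranch} (h : Bdd Q N F) :
    Spec prog fNormStep (.pair (.num Q) (encF F)) (encOpt (normStep Q F)) (tNormStep N) := by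
  have hF := h
  obtain ⟨t₁, h₁, e₁⟩ := extractMin_spec_of_bdd h
  refine .of_run (show _ = some bNormStep from rfl) ?_
  unfold tNormStep
  rcases ha : extractMin F with _ | ⟨a, F₁⟩
  · rw [ha] at e₁
    simp only [bNormStep, normStep, ha, encOpt_none, ↓run_rules, ↓val_rules, ↓e₁] at *
    simp only [true_and]
    omega
  replace h := h.of_perm (extractMin_some ha).2.1
  have ia := h.its_le
  replace h := h.tail
  obtain ⟨u₁, v₁, w₁⟩ := amount_spec a.its
  obtain ⟨t₂, h₂, e₂⟩ := extractMin_spec_of_bdd h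
  rcases hb : extractMin F₁ with _ | ⟨b, F₂⟩
  · rw [ha] at e₁
    rw [hb] at e₂
    simp only [bNormStep, normStep, ha, hb, encOpt_none, encOpt_some, ↓run_rules, ↓val_rules,
      ↓e₁, ↓e₂] at *
    simp only [true_and]
    omega
  replace h := h.of_perm (extractMin_some hb).2.1
  have ib := h.its_le
  replace h := h.tail
  obtain ⟨u₂, v₂, w₂⟩ := amount_spec b.its
  rcases a with ⟨la, Ia, ka⟩
  rcases b with ⟨lb, Ib, kb⟩
  simp only [its_mk] at ia ib v₁ w₁ v₂ w₂
  rw [ha, encOpt_some, encT_mk] at e₁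
  rw [hb, encOpt_some, encT_mk] at e₂
  by_cases hle : amount Ia + amount Ib ≤ Q
  · have hx : normStep Q F = some (.mk (la + lb) (Ia ++ Ib) [], F₂) := by
      simp only [normStep, ha, hb]
      exact if_pos hle
    obtain ⟨u₃, v₃, w₃⟩ := append_spec encItem Ia Ib
    simp only [bNormStep, hx, encOpt_some, encT_mk, encF_nil, ↓run_rules, ↓val_rules, ↓e₁, ↓e₂,
      ↓w₁, ↓w₂, ↓w₃, ↓caseLe_of_le hle]
    simp only [true_and]
    omega
  obtain ⟨t₃, h₃, e₃⟩ := extractMin_spec_of_bdd h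
  rcases hc : extractMin F₂ with _ | ⟨c, F₃⟩
  · have hx : normStep Q F = none := by
      simp only [normStep, ha, hb, hc]
      exact if_neg hle
    rw [hc] at e₃
    simp only [bNormStep, hx, encOpt_none, ↓run_rules, ↓val_rules, ↓e₁, ↓e₂, ↓e₃, ↓w₁, ↓w₂,
      ↓caseLe_of_lt (not_le.1 hle)]
    simp only [true_and]
    omega
  replace h := h.of_perm (extractMin_some hc).2.1
  have ic := h.its_le
  obtain ⟨u₃, v₃, w₃⟩ := amount_spec c.its
  rcases c with ⟨lc, Ic, kc⟩
  simp only [its_mk] at ic v₃ w₃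
  rw [hc, encOpt_some, encT_mk] at e₃
  rcases F₃ with _ | ⟨x, F₄⟩
  · have hx : normStep Q F = none := by
      simp only [normStep, ha, hb, hc]
      exact if_neg hle
    simp only [bNormStep, hx, encOpt_none, encF_nil, ↓run_rules, ↓val_rules, ↓e₁, ↓e₂, ↓e₃, ↓w₁,
      ↓w₂, ↓caseLe_of_lt (not_le.1 hle)]
    simp only [true_and]
    omega
  by_cases hge : Q + Q ≤ amount Ia + amount Ib + amount Ic
  · have hx : normStep Q F = none := by
      simp only [normStep, ha, hb, hc]
      exact (if_neg hle).trans (if_pos (by simp only [its_mk]; omega))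
    simp only [bNormStep, hx, encOpt_none, encF_cons, ↓run_rules, ↓val_rules, ↓e₁, ↓e₂, ↓e₃, ↓w₁,
      ↓w₂, ↓w₃, ↓caseLe_of_lt (not_le.1 hle), ↓caseLe_of_le hge]
    simp only [true_and]
    omega
  · have hx : normStep Q F =
        some (.mk 0 [] [.mk la Ia ka, .mk lb Ib kb, .mk lc Ic kc], x :: F₄) := by
      simp only [normStep, ha, hb, hc]
      exact (if_neg hle).trans (if_neg (by simp only [its_mk]; omega))
    simp only [bNormStep, hx, encOpt_some, encF_cons, encF_nil, encT_mk, encodeList_nil,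
      ↓run_rules, ↓val_rules, ↓e₁, ↓e₂, ↓e₃, ↓w₁,
      ↓w₂, ↓w₃, ↓caseLe_of_lt (not_le.1 hle), ↓caseLe_of_lt (not_le.1 hge)]
    simp only [true_and]
    omega

/-- Branches whose leaves and internal vertices are in order, with bounds on their items. -/
structure Good (Q N : ℕ) (F : List TBranch) : Prop where
  leafOK : AllSub (LeafOK Q) F
  nodeOK : AllSub (NodeOK Q) F
  length_le : (collect F).length ≤ N
  amount_le : amount (collect F) ≤ Q * N

/-- A single child would have the traffic of the stem, which `NodeOK` excludes. -/
lemma two_le_kids {Q : ℕ} {b : TBranch} (h : NodeOK Q b) (hk : b.kids ≠ []) : 2 ≤ b.kids.length := by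
  obtain ⟨-, h1, -⟩ := h hk
  rcases hb : b.kids with _ | ⟨c, _ | ⟨d, r⟩⟩
  · exact absurd hb hk
  · rw [hb] at h1
    simp [trafficSum, traffic] at h1
  · simp

/-- In a forest whose inner vertices all have at least two children there are fewer than twice as
many vertices as leaves, and every leaf holds an item. With the number of trees added, the bound is
inductive: the two or more children pay for their parent. -/
lemma nodes_add_length_le {Q : ℕ} {F : List TBranch} (hl : AllSub (LeafOK Q) F)
    (hn : AllSub (NodeOK Q) F) : nodes F + F.length ≤ 2 * (collect F).length := by
  induction F using forest_induction with
  | nil => simp [nodes_nil]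
  | cons l I cs r ih₁ ih₂ =>
    simp only [AllSub_cons, kids_mk] at hl hn
    have h2 := ih₂ hl.2.2 hn.2.2
    have h1 := ih₁ hl.2.1 hn.2.1
    simp only [nodes_mk, collect_cons, items_mk, List.length_append, List.length_cons]
    by_cases hcs : cs = []
    · have := (hl.1.1 hcs).1
      rcases I with _ | ⟨x, I⟩
      · simp at this
      · simp [hcs, nodes_nil]
        omega
    · have := two_le_kids hn.1 hcs
      simp only [kids_mk] at this
      omega

namespace Good
variable {Q N : ℕ} {b : TBranch} {F G ch sm : List TBranch}

lemma bdd (h : Good Q N F) : Bdd Q N F where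
  nodes_le := by
    have := nodes_add_length_le h.leafOK h.nodeOK
    have := h.length_le
    omega
  length_le := h.length_le
  amount_le := h.amount_le

lemma of_perm (h : Good Q N F) (hp : F.Perm G) : Good Q N G where
  leafOK := (hp.allSub_iff _).1 h.leafOK
  nodeOK := (hp.allSub_iff _).1 h.nodeOK
  length_le := (h.bdd.of_perm hp).length_le
  amount_le := (h.bdd.of_perm hp).amount_le

lemma of_collect (h : Good Q N F) (hc : (collect F).Perm (collect G)) (hl : AllSub (LeafOK Q) G)
    (hn : AllSub (NodeOK Q) G) : Good Q N G :=
  ⟨hl, hn, hc.length_eq ▸ h.length_le, hc.amount_eq ▸ h.amount_le⟩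

lemma length_forest_le (h : Good Q N F) : F.length ≤ N := by
  have h1 := nodes_add_length_le h.leafOK h.nodeOK
  have := h.length_le
  have := length_le_nodes F
  omega

lemma normStep (hQ : 0 < Q) (h : Good Q N F) (hs : normStep Q F = some (b, G)) :
    Good Q N (b :: G) :=
  h.of_collect (HStep.of_normStep hs).collect_perm ((HStep.of_normStep hs).leafOK hQ h.leafOK)
    (normStep_nodeOK hQ hs h.nodeOK h.leafOK)

lemma norm (hQ : 0 < Q) (h : Good Q N (ch ++ sm)) :
    Good Q N ((norm Q ch sm).1 ++ (norm Q ch sm).2) :=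
  h.of_collect (steps_collect_perm (norm_steps Q ch sm)) (steps_leafOK hQ (norm_steps Q ch sm) h.leafOK)
    (norm_nodeOK hQ _ _ h.nodeOK h.leafOK)

end Good

def encPair (p : List TBranch × List TBranch) : Val := .pair (encF p.1) (encF p.2)

def tNorm (N : ℕ) : ℕ := (N + 1) * (tNormStep N + 20 * N + 50)

lemma norm_spec {Q N : ℕ} (hQ : 0 < Q) (ch sm : List TBranch) (h : Good Q N (ch ++ sm)) :
    Spec prog fNorm (.pair (.num Q) (.pair (encF ch) (encF sm))) (encPair (norm Q ch sm))
      (tNorm N) := by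
  refine Spec.mono (m := ((ch ++ sm).length + 1) * (tNormStep N + 20 * N + 50)) ?_
    (Nat.mul_le_mul_right _ (Nat.succ_le_succ h.length_forest_le))
  induction ch, sm using norm_induction (Q := Q) with
  | done ch sm hn =>
    obtain ⟨t₁, h₁, e₁⟩ := normStep_spec h.bdd
    obtain ⟨t₂, h₂, e₂⟩ := append_spec_forest ch sm
    have hl := h.length_forest_le
    rw [List.length_append] at hl
    rw [hn, encOpt_none] at e₁
    refine .of_run (show _ = some bNorm from rfl) ?_
    simp only [bNorm, norm_of_none hn, encPair, ↓run_rules, ↓val_rules, ↓e₁, ↓e₂]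
    simp only [true_and, Nat.add_one_mul]
    omega
  | step ch sm w r hs ih =>
    obtain ⟨t₁, h₁, e₁⟩ := normStep_spec h.bdd
    obtain ⟨t₂, h₂, e₂⟩ := append_spec_forest ch sm
    obtain ⟨t₃, h₃, e₃⟩ := ih (h.normStep hQ hs)
    have hl := h.length_forest_le
    rw [List.length_append] at hl
    rw [hs, encOpt_some] at e₁
    rw [encF_cons, encF_nil] at e₃
    have hlen : ([w] ++ r).length + 1 ≤ (ch ++ sm).length := normStep_length hs
    have := Nat.mul_le_mul_right (tNormStep N + 20 * N + 50) hlen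
    refine .of_run (show _ = some bNorm from rfl) ?_
    simp only [bNorm, norm_of_some hs, ↓run_rules, ↓val_rules, ↓e₁, ↓e₂, ↓e₃]
    simp only [true_and, Nat.add_one_mul] at *
    omega

def tNormAll (N : ℕ) : ℕ := tNorm N + 20 * N + 50

lemma normAll_spec {Q N : ℕ} (hQ : 0 < Q) (ch sm : List TBranch) (h : Good Q N (ch ++ sm)) :
    Spec prog fNormAll (.pair (.num Q) (.pair (encF ch) (encF sm)))
      (encF ((norm Q ch sm).1 ++ (norm Q ch sm).2)) (tNormAll N) := by
  obtain ⟨t₁, h₁, e₁⟩ := norm_spec hQ ch sm h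
  obtain ⟨t₂, h₂, e₂⟩ := append_spec_forest (norm Q ch sm).1 (norm Q ch sm).2
  have hl := (h.norm hQ).length_forest_le
  rw [List.length_append] at hl
  refine .of_run (show _ = some bNormAll from rfl) ?_
  simp only [bNormAll, encPair, ↓run_rules, ↓val_rules, ↓e₁, ↓e₂] at *
  simp only [true_and]
  unfold tNormAll
  omega

lemma Bdd.head {Q N : ℕ} {b : TBranch} {F : List TBranch} (h : Bdd Q N (b :: F)) : Bdd Q N [b] := by
  obtain ⟨a1, a2, a3⟩ := (Bdd.append_iff (F := [b])).1 h
  exact ⟨by omega, by omega, by omega⟩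

lemma extractNode_spec {Q N f : ℕ} (hQ : 0 < Q) {F : List TBranch} (h : Bdd Q N F) :
    Spec prog fExtractNode (.pair (.num Q) (.pair (.num f) (encF F))) (encOpt (extractNode Q f F))
      (F.length * (tTraffic N + 80) + 10) := by
  induction F with
  | nil =>
    refine .of_run (show _ = some bExtractNode from rfl) ?_
    simp only [bExtractNode, extractNode, encOpt_none, encF_nil, ↓run_rules, ↓val_rules]
    simp
  | cons b r ih =>
    obtain ⟨t₁, h₁, e₁⟩ := ih h.tail
    obtain ⟨t₂, h₂, e₂⟩ := traffic_spec hQ h.head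
    refine .of_run (show _ = some bExtractNode from rfl) ?_
    rcases b with ⟨l, I, _ | ⟨c, cs⟩⟩
    · rcases hm : extractNode Q f r with _ | ⟨m, r'⟩
      · rw [hm] at e₁
        have hx : extractNode Q f (.mk l I [] :: r) = none := by
          rw [extractNode, hm]
          exact if_neg (by simp)
        simp only [bExtractNode, hx, encOpt_none, encF_nil, encF_cons, encT_mk, ↓run_rules,
          ↓val_rules, ↓e₁] at *
        simp only [List.length_cons, true_and, Nat.add_one_mul]
        omega
      · rw [hm] at e₁
        have hx : extractNode Q f (.mk l I [] :: r) = some (m, .mk l I [] :: r') := by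
          rw [extractNode, hm]
          exact if_neg (by simp)
        simp only [bExtractNode, hx, encOpt_some, encF_nil, encF_cons, encT_mk, ↓run_rules,
          ↓val_rules, ↓e₁] at *
        simp only [List.length_cons, true_and, Nat.add_one_mul]
        omega
    · by_cases hle : f ≤ (mk l I (c :: cs)).traffic Q
      · have hx : extractNode Q f (.mk l I (c :: cs) :: r) = some (.mk l I (c :: cs), r) := by
          rw [extractNode]
          exact if_pos (by simp [hle])
        simp only [bExtractNode, hx, encOpt_some, encF_nil, encF_cons, encT_mk, ↓run_rules,
          ↓val_rules, ↓e₁]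
        simp only [encF_cons, encT_mk] at e₂
        simp only [↓e₂, ↓run_rules, ↓val_rules, ↓caseLe_of_le hle]
        simp only [List.length_cons, true_and, Nat.add_one_mul]
        omega
      · rcases hm : extractNode Q f r with _ | ⟨m, r'⟩
        · rw [hm] at e₁
          have hx : extractNode Q f (.mk l I (c :: cs) :: r) = none := by
            rw [extractNode, hm]
            exact if_neg (by simp [hle])
          simp only [encF_cons, encT_mk, encOpt_none] at e₂ e₁
          simp only [bExtractNode, hx, encOpt_none, encF_nil, encF_cons, encT_mk, ↓run_rules,
            ↓val_rules, ↓e₁, ↓e₂, ↓caseLe_of_lt (not_le.1 hle)]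
          simp only [List.length_cons, true_and, Nat.add_one_mul]
          omega
        · rw [hm] at e₁
          have hx : extractNode Q f (.mk l I (c :: cs) :: r) =
              some (m, .mk l I (c :: cs) :: r') := by
            rw [extractNode, hm]
            exact if_neg (by simp [hle])
          simp only [encF_cons, encT_mk, encOpt_some] at e₂ e₁
          simp only [bExtractNode, hx, encOpt_some, encF_nil, encF_cons, encT_mk, ↓run_rules,
            ↓val_rules, ↓e₁, ↓e₂, ↓caseLe_of_lt (not_le.1 hle)]
          simp only [List.length_cons, true_and, Nat.add_one_mul]
          omega

lemma addLen_length (l : ℕ) (F : List TBranch) : (addLen l F).length = F.length := by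
  induction F with
  | nil => simp [addLen]
  | cons b r ih =>
    rcases b with ⟨l', I, cs⟩
    simp [addLen, ih]

def tExtractNode (N : ℕ) : ℕ := N * (tTraffic N + 80) + 10

def tFinish (N : ℕ) : ℕ :=
  tCollect N + tExtractNode N + tNormAll N + 2 * tTrafficSum N + 200 * N + 500

lemma Good.slide {Q N : ℕ} {w : TBranch} {F r : List TBranch} (h : Good Q N F)
    (hp : F.Perm (w :: r)) (hw : w.kids ≠ []) : Good Q N (r ++ w.kids) := by
  have h := h.of_perm hp
  have h1 := (AllSub_cons _ _ _).1 h.leafOK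
  have h2 := (AllSub_cons _ _ _).1 h.nodeOK
  have hi := h1.1.2 hw
  refine h.of_collect ?_ ((AllSub_append _ _ _).2 ⟨h1.2.2, h1.2.1⟩)
    ((AllSub_append _ _ _).2 ⟨h2.2.2, h2.2.1⟩)
  rcases w with ⟨l, I, cs⟩
  simp only [its_mk] at hi
  subst hi
  simpa [collect_append] using List.perm_append_comm

lemma finish_length_le {Q N l : ℕ} (hQ : 0 < Q) {cs : List TBranch} (h : Good Q N cs) :
    (finish Q l cs).length ≤ N + 1 := by
  have hl := h.length_forest_le
  unfold finish
  split_ifs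
  · simp
  · rw [addLen_length]
    omega
  · split
    · simp
    · rename_i w r hm
      obtain ⟨hp, hk, -⟩ := extractNode_some hm
      have := ((h.slide hp hk).norm (ch := []) (sm := r ++ w.kids) hQ).length_forest_le
      split_ifs
      · rw [addLen_length]
        omega
      · simp

lemma finish_spec {Q N l : ℕ} (hQ : 0 < Q) {cs : List TBranch} (h : Good Q N cs) :
    Spec prog fFinish (.pair (.num Q) (.pair (.num l) (encF cs))) (encF (finish Q l cs))
      (tFinish N) := by
  obtain ⟨t₁, h₁, e₁⟩ := collect_spec_of_bdd h.bdd
  obtain ⟨t₂, h₂, e₂⟩ := amount_spec (collect cs)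
  have hc := h.length_le
  have hl := h.length_forest_le
  have hn := h.bdd.nodes_le
  refine .of_run (show _ = some bFinish from rfl) ?_
  unfold tFinish
  by_cases hle : amount (collect cs) ≤ Q
  · obtain ⟨t₃, h₃, e₃⟩ := totLen_spec cs
    have hx : finish Q l cs = [.mk (l + totLen cs) (collect cs) []] := if_pos hle
    simp only [bFinish, hx, encF_cons, encF_nil, encT_mk, ↓run_rules, ↓val_rules, ↓e₁, ↓e₂, ↓e₃,
      ↓caseLe_of_le hle]
    simp only [true_and]
    omega
  obtain ⟨t₃, h₃, e₃⟩ := ceilDiv_spec hQ _ (amount (collect cs)) rfl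
  have hd := h.bdd.ceilDiv_le hQ
  obtain ⟨t₄, h₄, e₄⟩ := trafficSum_spec hQ h.bdd
  by_cases hts : trafficSum Q cs ≤ amount (collect cs) ⌈/⌉ Q
  · obtain ⟨t₅, h₅, e₅⟩ := addLen_spec l cs
    have hx : finish Q l cs = addLen l cs := (if_neg hle).trans (if_pos hts)
    simp only [bFinish, hx, ↓run_rules, ↓val_rules, ↓e₁, ↓e₂, ↓e₃, ↓e₄, ↓e₅,
      ↓caseLe_of_lt (not_le.1 hle), ↓caseLe_of_le hts]
    simp only [true_and]
    omega
  obtain ⟨t₅, h₅, e₅⟩ := extractNode_spec (f := amount (collect cs) ⌈/⌉ Q) hQ h.bdd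
  have h₅' : t₅ ≤ tExtractNode N :=
    h₅.trans (Nat.add_le_add_right (Nat.mul_le_mul_right _ hl) _)
  rcases hm : extractNode Q (amount (collect cs) ⌈/⌉ Q) cs with _ | ⟨w, r⟩
  · have hx : finish Q l cs = [] := by
      unfold finish
      rw [if_neg hle, if_neg hts, hm]
    rw [hm] at e₅
    simp only [bFinish, hx, encF_nil, encOpt_none, ↓run_rules, ↓val_rules, ↓e₁, ↓e₂, ↓e₃, ↓e₄,
      ↓e₅, ↓caseLe_of_lt (not_le.1 hle), ↓caseLe_of_lt (not_le.1 hts)] at *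
    simp only [true_and]
    omega
  obtain ⟨hp, hk, -⟩ := extractNode_some hm
  have hs := h.slide hp hk
  obtain ⟨t₆, h₆, e₆⟩ := append_spec_forest r w.kids
  obtain ⟨t₇, h₇, e₇⟩ := normAll_spec hQ [] (r ++ w.kids) hs
  have hg := hs.norm (ch := []) (sm := r ++ w.kids) hQ
  obtain ⟨t₈, h₈, e₈⟩ := trafficSum_spec hQ hg.bdd
  have hrl := hs.length_forest_le
  have hgl := hg.length_forest_le
  obtain ⟨t₉, h₉, e₉⟩ := addLen_spec (l + w.len)
    ((norm Q [] (r ++ w.kids)).1 ++ (norm Q [] (r ++ w.kids)).2)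
  rw [hm, encOpt_some] at e₅
  rw [List.length_append] at hrl
  rw [encF_nil] at e₇
  rcases w with ⟨lw, Iw, ks⟩
  simp only [kids_mk, len_mk, encT_mk] at e₅ e₆ e₇ e₈ e₉ h₉ hgl
  by_cases hts' : trafficSum Q ((norm Q [] (r ++ ks)).1 ++ (norm Q [] (r ++ ks)).2) ≤
      amount (collect cs) ⌈/⌉ Q
  · have hx : finish Q l cs =
        addLen (l + lw) ((norm Q [] (r ++ ks)).1 ++ (norm Q [] (r ++ ks)).2) := by
      unfold finish
      rw [if_neg hle, if_neg hts, hm]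
      exact if_pos hts'
    simp only [bFinish, hx, ↓run_rules, ↓val_rules, ↓e₁, ↓e₂, ↓e₃, ↓e₄, ↓e₆, ↓e₇, ↓e₈, ↓e₉,
      ↓e₅, ↓caseLe_of_lt (not_le.1 hle), ↓caseLe_of_lt (not_le.1 hts), ↓caseLe_of_le hts']
    simp only [true_and]
    omega
  · have hx : finish Q l cs =
        [.mk (l + lw) [] ((norm Q [] (r ++ ks)).1 ++ (norm Q [] (r ++ ks)).2)] := by
      unfold finish
      rw [if_neg hle, if_neg hts, hm]
      exact if_neg hts'
    simp only [bFinish, hx, encF_cons, encF_nil, encT_mk, encodeList_nil, ↓run_rules, ↓val_rules,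
      ↓e₁, ↓e₂, ↓e₃, ↓e₄, ↓e₆, ↓e₇, ↓e₈, ↓e₉,
      ↓e₅, ↓caseLe_of_lt (not_le.1 hle), ↓caseLe_of_lt (not_le.1 hts),
      ↓caseLe_of_lt (not_le.1 hts')]
    simp only [true_and]
    omega

lemma simplify_good {Q N : ℕ} (hQ : 0 < Q) {F : List TBranch} (hl : AllSub (LeafOK Q) F)
    (h1 : (collect F).length ≤ N) (h2 : amount (collect F) ≤ Q * N) :
    Good Q N ((simplify Q F).1 ++ (simplify Q F).2) := by
  have hs := (simplify_reach hQ F hl).reflTransGen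
  have hp := steps_collect_perm hs
  exact ⟨steps_leafOK hQ hs hl, simplify_nodeOK hQ F hl, hp.length_eq ▸ h1, hp.amount_eq ▸ h2⟩

def tSimplify (N : ℕ) : ℕ := tNorm N + tFinish N + 100 * N + 300

/-- The input may contain long paths of vertices of degree two, so the recursion is counted by its
own vertices. At each of them, `norm` and `finish` run only on branches that are already simplified,
whose size is controlled by the number of items. -/
lemma simplify_spec {Q N : ℕ} (hQ : 0 < Q) {F : List TBranch} (hl : AllSub (LeafOK Q) F)
    (h1 : (collect F).length ≤ N) (h2 : amount (collect F) ≤ Q * N) :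
    Spec prog fSimplify (.pair (.num Q) (encF F)) (encPair (simplify Q F))
      (nodes F * tSimplify N + 10) := by
  induction F using forest_induction with
  | nil =>
    refine .of_run (show _ = some bSimplify from rfl) ?_
    simp only [bSimplify, simplify, encPair, encF_nil, ↓run_rules, ↓val_rules]
    simp
  | cons l I cs r ih₁ ih₂ =>
    simp only [AllSub_cons, kids_mk] at hl
    simp only [collect_cons, items_mk, List.length_append, amount_append] at h1 h2
    obtain ⟨t₂, h₂, e₂⟩ := ih₂ hl.2.2 (by omega) (by omega)
    refine .of_run (show _ = some bSimplify from rfl) ?_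
    rcases cs with _ | ⟨c, cs⟩
    · simp only [bSimplify, simplify, encPair, encF_nil, encF_cons, encT_mk, ↓run_rules,
        ↓val_rules, ↓e₂] at *
      simp only [nodes_mk, Nat.add_mul, one_mul, true_and]
      unfold tSimplify at *
      omega
    obtain ⟨t₁, h₁, e₁⟩ := ih₁ hl.2.1 (by omega) (by omega)
    have hg := simplify_good (N := N) hQ hl.2.1 (by omega) (by omega)
    have hr := (simplify_good (N := N) hQ hl.2.2 (by omega) (by omega)).length_forest_le
    have hg' := hg.norm hQ
    obtain ⟨t₃, h₃, e₃⟩ := norm_spec hQ _ _ hg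
    obtain ⟨t₄, h₄, e₄⟩ := append_spec_forest
      (norm Q (simplify Q (c :: cs)).1 (simplify Q (c :: cs)).2).1
      (norm Q (simplify Q (c :: cs)).1 (simplify Q (c :: cs)).2).2
    obtain ⟨t₅, h₅, e₅⟩ := finish_spec (l := l) hQ hg'
    have hf := finish_length_le (l := l) hQ hg'
    obtain ⟨t₆, h₆, e₆⟩ := append_spec_forest
      (finish Q l ((norm Q (simplify Q (c :: cs)).1 (simplify Q (c :: cs)).2).1 ++
        (norm Q (simplify Q (c :: cs)).1 (simplify Q (c :: cs)).2).2)) (simplify Q r).1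
    have hgl := hg'.length_forest_le
    rw [List.length_append] at hgl
    rw [simplify]
    generalize norm Q (simplify Q (c :: cs)).1 (simplify Q (c :: cs)).2 = n at *
    obtain ⟨c₁, s₁⟩ := n
    simp only [encPair] at e₁ e₂ e₃ e₄ e₅ e₆ h₄ h₅ h₆ hgl hf ⊢
    rw [encF_cons] at e₁
    cases hy : finish Q l (c₁ ++ s₁) with
    | cons y ys =>
      rw [hy, encF_cons] at e₆ e₅
      rw [hy] at h₆ hf
      simp only [bSimplify, encF_cons, encT_mk, ↓run_rules, ↓val_rules, ↓e₁, ↓e₂, ↓e₃, ↓e₄, ↓e₅,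
        ↓e₆]
      simp only [nodes_mk, Nat.add_mul, one_mul, true_and]
      unfold tSimplify at *
      omega
    | nil =>
      rw [hy, encF_nil] at e₅
      rcases c₁ with _ | ⟨x, xs⟩
      · rw [encF_nil] at e₃ e₄
        simp only [bSimplify, encF_cons, encF_nil, encT_mk, ↓run_rules, ↓val_rules, ↓e₁, ↓e₂, ↓e₃,
          ↓e₄, ↓e₅]
        simp only [nodes_mk, Nat.add_mul, one_mul, true_and]
        unfold tSimplify at *
        omega
      · rw [encF_cons] at e₃ e₄
        simp only [bSimplify, encF_cons, encT_mk, ↓run_rules, ↓val_rules, ↓e₁, ↓e₂, ↓e₃,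
          ↓e₄, ↓e₅]
        simp only [nodes_mk, Nat.add_mul, one_mul, true_and]
        unfold tSimplify at *
        omega

-- Running times of the initialization and of the search

lemma encodeBranches_nil : encodeBranches [] = .num 0 := by rw [encodeBranches]

lemma encodeBranches_cons (l d : ℕ) (cs r : List Branch) :
    encodeBranches (.mk l d cs :: r) =
      .pair (.pair (.num l) (.pair (.num d) (encodeBranches cs))) (encodeBranches r) := by
  rw [encodeBranches, Branch.encode]

lemma init_spec (L : ℕ) (bs : List Branch) (u : Vertex) (i : ℕ)
    (hL : u.length + nodes (initF u i bs) ≤ L) :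
    Spec prog fInit (.pair (encodeVertex u) (.pair (.num i) (encodeBranches bs)))
      (encF (initF u i bs)) (nodes (initF u i bs) * (20 * L + 100) + 10) := by
  induction bs using branch_induction generalizing u i with
  | nil =>
    refine .of_run (show _ = some bInit from rfl) ?_
    simp only [bInit, initF, encF_nil, encodeBranches_nil, ↓run_rules, ↓val_rules]
    simp
  | leaf l d r ih =>
    simp only [initF, nodes_mk, nodes_nil] at hL
    obtain ⟨t₁, h₁, e₁⟩ := ih u (i + 1) (by omega)
    obtain ⟨t₂, h₂, e₂⟩ := append_spec Val.num u [i]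
    rw [encodeList_cons, encodeList_nil] at e₂
    refine .of_run (show _ = some bInit from rfl) ?_
    simp only [bInit, initF, encF_nil, encF_cons, encT_mk, encodeList_nil, encodeList_cons, encItem,
      encodeBranches_nil, encodeBranches_cons, encodeVertex, ↓run_rules, ↓val_rules, ↓e₂] at e₁ ⊢
    simp only [↓e₁, nodes_mk, nodes_nil, true_and, Nat.add_mul, one_mul]
    omega
  | node l d c cs r ih1 ih2 =>
    simp only [initF, nodes_mk] at hL
    obtain ⟨t₁, h₁, e₁⟩ := ih2 u (i + 1) (by omega)
    obtain ⟨t₂, h₂, e₂⟩ := append_spec Val.num u [i]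
    obtain ⟨t₃, h₃, e₃⟩ := ih1 (u ++ [i]) 0 (by simp; omega)
    rw [encodeList_cons, encodeList_nil] at e₂
    rcases c with ⟨lc, dc, kc⟩
    rw [encodeBranches_cons] at e₃
    refine .of_run (show _ = some bInit from rfl) ?_
    simp only [encodeVertex] at e₁ e₃
    simp only [bInit, initF, encF_nil, encF_cons, encT_mk, encodeList_nil, encodeList_cons,
      encodeBranches_nil, encodeBranches_cons, encodeVertex, ↓run_rules, ↓val_rules, ↓e₂, ↓e₁, ↓e₃]
    simp only [nodes_mk, true_and, Nat.add_mul, one_mul]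
    omega

def encSplit (p : List Item × List Item) : Val :=
  .pair (encodeList encItem p.1) (encodeList encItem p.2)

lemma split_spec (q : ℕ) (I : List Item) :
    Spec prog fSplit (.pair (.num q) (encodeList encItem I)) (encSplit (splitItems q I))
      (I.length * 60 + 50) := by
  induction I generalizing q with
  | nil =>
    refine .of_run (show _ = some bSplit from rfl) ?_
    simp only [bSplit, splitItems, encSplit, encodeList_nil, ↓run_rules, ↓val_rules]
    simp
  | cons x I ih =>
    obtain ⟨t₁, h₁, e₁⟩ := ih (q - x.2)
    refine .of_run (show _ = some bSplit from rfl) ?_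
    by_cases hle : x.2 ≤ q
    · simp only [bSplit, splitItems, if_pos hle, encSplit, encodeList_cons, encItem, ↓run_rules,
        ↓val_rules, ↓e₁, ↓caseLe_of_le hle] at e₁ ⊢
      simp only [List.length_cons, true_and, Nat.add_one_mul]
      omega
    · simp only [bSplit, splitItems, if_neg hle, encSplit, encodeList_cons, encodeList_nil, encItem,
        ↓run_rules, ↓val_rules, ↓caseLe_of_lt (not_le.1 hle)]
      simp only [List.length_cons, true_and, Nat.add_one_mul]
      omega

lemma insertLen_spec (b : TBranch) (F : List TBranch) :
    Spec prog fInsertLen (.pair (encT b) (encF F)) (encF (insertLen b F))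
      (F.length * 40 + 50) := by
  rcases b with ⟨l, I, cs⟩
  induction F with
  | nil =>
    refine .of_run (show _ = some bInsertLen from rfl) ?_
    simp only [bInsertLen, insertLen, encF_nil, encF_cons, ↓run_rules, ↓val_rules]
    simp
  | cons c r ih =>
    obtain ⟨t₁, h₁, e₁⟩ := ih
    rcases c with ⟨l', I', cs'⟩
    refine .of_run (show _ = some bInsertLen from rfl) ?_
    by_cases hle : l ≤ l'
    · have hx : insertLen (.mk l I cs) (.mk l' I' cs' :: r) =
        .mk l I cs :: .mk l' I' cs' :: r := if_pos hle
      simp only [bInsertLen, hx, encF_cons, encT_mk, ↓run_rules, ↓val_rules, ↓caseLe_of_le hle]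
      simp only [List.length_cons, true_and, Nat.add_one_mul]
      omega
    · have hx : insertLen (.mk l I cs) (.mk l' I' cs' :: r) =
        .mk l' I' cs' :: insertLen (.mk l I cs) r := if_neg hle
      rw [encT_mk] at e₁
      simp only [bInsertLen, hx, encF_cons, encT_mk, ↓run_rules, ↓val_rules, ↓e₁,
        ↓caseLe_of_lt (not_le.1 hle)]
      simp only [List.length_cons, true_and, Nat.add_one_mul]
      omega

lemma part_run (M : ℕ) (F : List TBranch) (hM : F.length ≤ M) :
    Spec prog fPart (encF F) (encPair (part F)) (F.length * (40 * M + 100) + 10) := by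
  induction F with
  | nil =>
    refine .of_run (show _ = some bPart from rfl) ?_
    simp only [bPart, part, encPair, encF_nil, ↓run_rules, ↓val_rules]
    simp
  | cons b r ih =>
    rw [List.length_cons] at hM
    obtain ⟨t₁, h₁, e₁⟩ := ih (by omega)
    have hp := (part_spec r).1.length_eq
    rw [List.length_append] at hp
    refine .of_run (show _ = some bPart from rfl) ?_
    rcases b with ⟨l, I, _ | ⟨c, cs⟩⟩
    · obtain ⟨t₂, h₂, e₂⟩ := insertLen_spec (.mk l I []) (part r).1
      simp only [encT_mk, encPair, encF_nil] at e₁ e₂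
      simp only [bPart, part, encPair, encF_nil, encF_cons, encT_mk, ↓run_rules, ↓val_rules, ↓e₁,
        ↓e₂]
      simp only [List.length_cons, true_and, Nat.add_one_mul r.length]
      omega
    · simp only [encPair] at e₁
      simp only [bPart, part, encPair, encF_nil, encF_cons, encT_mk, ↓run_rules, ↓val_rules, ↓e₁]
      simp only [List.length_cons, true_and, Nat.add_one_mul r.length]
      omega

def tPart (N : ℕ) : ℕ := 2 * N * (40 * (2 * N) + 100) + 10

lemma part_run_of_bdd {Q N : ℕ} {F : List TBranch} (h : Bdd Q N F) :
    Spec prog fPart (encF F) (encPair (part F)) (tPart N) := by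
  have hl := (length_le_nodes F).trans h.nodes_le
  exact (part_run _ F hl).mono (Nat.add_le_add_right (Nat.mul_le_mul_right _ hl) _)

lemma mem_of_mem_part {F : List TBranch} {b : TBranch} (h : b ∈ (part F).1 ∨ b ∈ (part F).2) :
    b ∈ F := (part_spec F).1.mem_iff.2 (List.mem_append.2 h)

lemma Bdd.of_mem {Q N : ℕ} {F : List TBranch} {b : TBranch} (h : Bdd Q N F) (hb : b ∈ F) :
    b.its.length ≤ N ∧ Bdd Q N b.kids ∧ nodes b.kids + 1 ≤ nodes F := by
  obtain ⟨s, t, rfl⟩ := List.append_of_mem hb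
  have h' := h.of_perm List.perm_middle
  refine ⟨h'.its_le, h'.kids, ?_⟩
  rw [nodes_append, nodes_cons]
  omega

def encTours (p : List Item × List (List Item)) : Val :=
  .pair (encodeList encItem p.1) (encodeList (encodeList encItem) p.2)

def tChain (N : ℕ) : ℕ := tPart N + 400 * N + 1000

lemma chain_length_le {Q r : ℕ} (cs : List TBranch) : (chain Q r cs).2.length ≤ nodes cs := by
  induction h : nodes cs using Nat.strong_induction_on generalizing r cs with
  | _ k ih =>
    subst h
    have hp := (part_spec cs).1.length_eq
    have hl := length_le_nodes cs
    rw [chain]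
    split
    · rename_i h
      rw [h] at hp
      simp at hp ⊢
      omega
    · rename_i s a h
      split
      · simp
      · rename_i n t hn
        have hmem : n ∈ cs := mem_of_mem_part (.inr (by rw [hn]; simp))
        have hk : nodes n.kids + 1 ≤ nodes cs := by
          obtain ⟨s, t, rfl⟩ := List.append_of_mem hmem
          rw [nodes_append, nodes_cons]
          omega
        have := ih _ hk (r := r + amount (splitItems (Q - amount a.its) s.its).2) _ rfl
        simp only [List.length_cons]
        omega
    · simp

/-- The function descends into one child only, so the number of its calls is bounded by the depth
and thus by the number of vertices. The bound does not depend on whether the tree really is a chain.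
-/
lemma chain_run {Q N : ℕ} {r : ℕ} {cs : List TBranch} (h : Bdd Q N cs) :
    Spec prog fChain (.pair (.num Q) (.pair (.num r) (encF cs))) (encTours (chain Q r cs))
      ((nodes cs + 1) * tChain N) := by
  induction hk : nodes cs using Nat.strong_induction_on generalizing r cs with
  | _ k ih =>
    subst hk
    obtain ⟨t₁, h₁, e₁⟩ := part_run_of_bdd h
    have hmem := fun b => @mem_of_mem_part cs b
    refine .of_run (show _ = some bChain from rfl) ?_
    rw [chain, Nat.add_one_mul]
    have hT : tChain N = tPart N + 400 * N + 1000 := rfl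
    rcases hp1 : (part cs).1 with _ | ⟨s, _ | ⟨a, _ | ⟨d, L⟩⟩⟩
    · simp only [encPair, hp1, encF_nil] at e₁
      simp only [bChain, encTours, encodeList_nil, ↓run_rules, ↓val_rules, ↓e₁]
      simp only [true_and]
      omega
    · simp only [encPair, hp1, encF_nil, encF_cons] at e₁
      simp only [bChain, encTours, encodeList_nil, ↓run_rules, ↓val_rules, ↓e₁]
      simp only [true_and]
      omega
    · have ms := (h.of_mem (hmem s (by simp [hp1]))).1
      have ma := (h.of_mem (hmem a (by simp [hp1]))).1
      rcases hp2 : (part cs).2 with _ | ⟨n, M⟩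
      · simp only [encPair, hp1, hp2, encF_nil, encF_cons] at e₁
        simp only [bChain, encTours, encodeList_nil, ↓run_rules, ↓val_rules, ↓e₁]
        simp only [true_and]
        omega
      · obtain ⟨-, mn, hlt⟩ := h.of_mem (hmem n (by simp [hp2]))
        rcases s with ⟨ls, Is, ks⟩
        rcases a with ⟨la, Ia, ka⟩
        rcases n with ⟨ln, In, kn⟩
        simp only [its_mk, kids_mk] at ms ma mn hlt
        obtain ⟨t₂, h₂, e₂⟩ := split_spec (Q - amount Ia) Is
        obtain ⟨t₃, h₃, e₃⟩ := ih _ hlt (r := r + amount (splitItems (Q - amount Ia) Is).2) mn rfl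
        obtain ⟨t₄, h₄, e₄⟩ := amount_spec Ia
        obtain ⟨t₅, h₅, e₅⟩ := amount_spec (splitItems (Q - amount Ia) Is).2
        obtain ⟨t₆, h₆, e₆⟩ := append_spec encItem (splitItems (Q - amount Ia) Is).2
          (chain Q (r + amount (splitItems (Q - amount Ia) Is).2) kn).1
        obtain ⟨t₇, h₇, e₇⟩ := append_spec encItem Ia (splitItems (Q - amount Ia) Is).1
        have hs := length_splitItems (Q - amount Ia) Is
        have hm := Nat.mul_le_mul_right (tChain N) hlt
        simp only [encPair, hp1, hp2, encF_nil, encF_cons, encT_mk] at e₁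
        simp only [encTours, encSplit] at e₂ e₃
        simp only [bChain, encTours, encodeList_cons, its_mk, kids_mk, ↓run_rules, ↓val_rules, ↓e₁,
          ↓e₂, ↓e₃, ↓e₄, ↓e₅, ↓e₆, ↓e₇]
        simp only [true_and]
        omega
    · have ms := (h.of_mem (hmem s (by simp [hp1]))).1
      have ma := (h.of_mem (hmem a (by simp [hp1]))).1
      have md := (h.of_mem (hmem d (by simp [hp1]))).1
      rcases s with ⟨ls, Is, ks⟩
      rcases a with ⟨la, Ia, ka⟩
      rcases d with ⟨ld, Id, kd⟩
      simp only [its_mk] at ms ma md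
      obtain ⟨t₂, h₂, e₂⟩ := split_spec (Q - r - amount Id) Is
      obtain ⟨t₄, h₄, e₄⟩ := amount_spec Id
      obtain ⟨t₆, h₆, e₆⟩ := append_spec encItem Ia (splitItems (Q - r - amount Id) Is).2
      obtain ⟨t₇, h₇, e₇⟩ := append_spec encItem Id (splitItems (Q - r - amount Id) Is).1
      simp only [encPair, hp1, encF_nil, encF_cons, encT_mk] at e₁
      simp only [encSplit] at e₂
      simp only [bChain, encTours, encodeList_cons, encodeList_nil, its_mk, ↓run_rules, ↓val_rules,
        ↓e₁, ↓e₂, ↓e₄, ↓e₆, ↓e₇]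
      simp only [true_and]
      omega

lemma triple_spec {Q x N : ℕ} {c b a : TBranch} (hc : c.its.length ≤ N) (hb : b.its.length ≤ N)
    (ha : a.its.length ≤ N) :
    Spec prog fTriple (.pair (.num Q) (.pair (.num x) (.pair (encT c) (.pair (encT b) (encT a)))))
      (encodeList (encodeList encItem) (triple Q x c b a)) (400 * N + 1000) := by
  rcases c with ⟨lc, Ic, kc⟩
  rcases b with ⟨lb, Ib, kb⟩
  rcases a with ⟨la, Ia, ka⟩
  simp only [its_mk] at hc hb ha
  obtain ⟨t₁, h₁, e₁⟩ := split_spec (Q - amount Ia) Ic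
  obtain ⟨t₂, h₂, e₂⟩ := split_spec (Q - amount Ib) (splitItems (Q - amount Ia) Ic).2
  obtain ⟨t₃, h₃, e₃⟩ := amount_spec Ia
  obtain ⟨t₄, h₄, e₄⟩ := amount_spec Ib
  obtain ⟨t₅, h₅, e₅⟩ := append_spec encItem Ia (splitItems (Q - amount Ia) Ic).1
  obtain ⟨t₆, h₆, e₆⟩ := append_spec encItem Ib
    (splitItems (Q - amount Ib) (splitItems (Q - amount Ia) Ic).2).1
  have hs := length_splitItems (Q - amount Ia) Ic
  simp only [encSplit] at e₁ e₂
  refine .of_run (show _ = some bTriple from rfl) ?_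
  by_cases hle : lc + lc ≤ x
  · have hx : triple Q x (.mk lc Ic kc) (.mk lb Ib kb) (.mk la Ia ka) =
        [Ia ++ (splitItems (Q - amount Ia) Ic).1,
          Ib ++ (splitItems (Q - amount Ib) (splitItems (Q - amount Ia) Ic).2).1] :=
      if_pos (by simp only [len_mk]; omega)
    simp only [bTriple, hx, encT_mk, encodeList_cons, encodeList_nil, ↓run_rules, ↓val_rules,
      ↓caseLe_of_le hle, ↓e₁, ↓e₂, ↓e₃, ↓e₄, ↓e₅, ↓e₆]
    simp only [true_and]
    omega
  · have hx : triple Q x (.mk lc Ic kc) (.mk lb Ib kb) (.mk la Ia ka) = [Ia, Ib, Ic] :=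
      if_neg (by simp only [len_mk]; omega)
    simp only [bTriple, hx, encT_mk, encodeList_cons, encodeList_nil, ↓run_rules, ↓val_rules,
      ↓caseLe_of_lt (not_le.1 hle)]
    simp only [true_and]
    omega

def tFindHere (N : ℕ) : ℕ := tPart N + 2 * ((2 * N + 1) * tChain N) + 500 * N + 2000

lemma findHere_run {Q x N : ℕ} {cs : List TBranch} (h : Bdd Q N cs) :
    Spec prog fFindHere (.pair (.num Q) (.pair (.num x) (encF cs)))
      (encodeList (encodeList encItem) (findHere Q x cs)) (tFindHere N) := by
  obtain ⟨t₁, h₁, e₁⟩ := part_run_of_bdd h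
  have hmem := fun b => @mem_of_mem_part cs b
  have hn := h.nodes_le
  have htr : ∀ c b a : TBranch, c ∈ cs → b ∈ cs → a ∈ cs → _ := fun c b a hc hb ha =>
    triple_spec (Q := Q) (x := x) (h.of_mem hc).1 (h.of_mem hb).1 (h.of_mem ha).1
  refine .of_run (show _ = some bFindHere from rfl) ?_
  unfold findHere
  unfold tFindHere
  rcases hpc : part cs with ⟨L, M⟩
  rw [hpc] at hmem
  simp only [encPair, hpc] at e₁
  rcases M with _ | ⟨n₁, _ | ⟨n₂, M⟩⟩
  · rcases L with _ | ⟨c, _ | ⟨b, _ | ⟨a, _ | ⟨d, L⟩⟩⟩⟩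
    · simp only [encF_nil] at e₁
      simp only [bFindHere, encodeList_nil, ↓run_rules, ↓val_rules, ↓e₁]
      simp only [true_and]
      omega
    · simp only [encF_nil, encF_cons] at e₁
      simp only [bFindHere, encodeList_nil, ↓run_rules, ↓val_rules, ↓e₁]
      simp only [true_and]
      omega
    · simp only
      by_cases hle : x ≤ c.len
      · rw [if_pos hle]
        rcases c with ⟨lc, Ic, kc⟩
        rcases b with ⟨lb, Ib, kb⟩
        simp only [encF_nil, encF_cons, encT_mk, len_mk] at e₁ hle
        simp only [bFindHere, its_mk, encodeList_cons, encodeList_nil,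
          ↓run_rules, ↓val_rules, ↓e₁, ↓caseLe_of_le hle]
        simp only [true_and]
        omega
      · rw [if_neg hle]
        rcases c with ⟨lc, Ic, kc⟩
        rcases b with ⟨lb, Ib, kb⟩
        simp only [encF_nil, encF_cons, encT_mk, len_mk] at e₁ hle
        simp only [bFindHere, its_mk, encodeList_cons, encodeList_nil,
          ↓run_rules, ↓val_rules, ↓e₁, ↓caseLe_of_lt (not_le.1 hle)]
        simp only [true_and]
        omega
    · simp only [encF_nil, encF_cons] at e₁
      simp only [bFindHere, encodeList_nil, ↓run_rules, ↓val_rules, ↓e₁]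
      simp only [true_and]
      omega
    · simp only [encF_nil, encF_cons] at e₁
      obtain ⟨t₂, h₂, e₂⟩ := htr c b a (hmem _ (by simp)) (hmem _ (by simp)) (hmem _ (by simp))
      simp only [bFindHere, encodeList_nil, ↓run_rules, ↓val_rules, ↓e₁, ↓e₂]
      simp only [true_and]
      omega
  · rcases L with _ | ⟨c, _ | ⟨b, _ | ⟨a, L⟩⟩⟩
    · simp only [encF_nil, encF_cons] at e₁
      simp only [bFindHere, encodeList_nil, ↓run_rules, ↓val_rules, ↓e₁]
      simp only [true_and]
      omega
    · simp only [encF_nil, encF_cons] at e₁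
      simp only [bFindHere, encodeList_nil, ↓run_rules, ↓val_rules, ↓e₁]
      simp only [true_and]
      omega
    · simp only
      by_cases hle : x ≤ c.len
      · rw [if_pos hle]
        rcases c with ⟨lc, Ic, kc⟩
        rcases b with ⟨lb, Ib, kb⟩
        simp only [encF_nil, encF_cons, encT_mk, len_mk] at e₁ hle
        simp only [bFindHere, its_mk, encodeList_cons, encodeList_nil,
          ↓run_rules, ↓val_rules, ↓e₁, ↓caseLe_of_le hle]
        simp only [true_and]
        omega
      · rw [if_neg hle]
        rcases c with ⟨lc, Ic, kc⟩
        rcases b with ⟨lb, Ib, kb⟩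
        simp only [encF_nil, encF_cons, encT_mk, len_mk] at e₁ hle
        simp only [bFindHere, its_mk, encodeList_cons, encodeList_nil,
          ↓run_rules, ↓val_rules, ↓e₁, ↓caseLe_of_lt (not_le.1 hle)]
        simp only [true_and]
        omega
    · simp only [encF_nil, encF_cons] at e₁
      obtain ⟨t₂, h₂, e₂⟩ := htr c b a (hmem _ (by simp)) (hmem _ (by simp)) (hmem _ (by simp))
      simp only [bFindHere, encodeList_nil, ↓run_rules, ↓val_rules, ↓e₁, ↓e₂]
      simp only [true_and]
      omega
  · obtain ⟨-, b₁, k₁⟩ := h.of_mem (hmem n₁ (by simp))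
    obtain ⟨-, b₂, k₂⟩ := h.of_mem (hmem n₂ (by simp))
    rcases n₁ with ⟨l₁, I₁, c₁⟩
    rcases n₂ with ⟨l₂, I₂, c₂⟩
    simp only [kids_mk] at b₁ k₁ b₂ k₂
    obtain ⟨t₂, h₂, e₂⟩ := chain_run (r := 0) b₁
    obtain ⟨t₃, h₃, e₃⟩ := chain_run (r := 0) b₂
    have hl := chain_length_le (Q := Q) (r := 0) c₁
    have hm₂ := h₂.trans (Nat.mul_le_mul_right (tChain N) (show nodes c₁ + 1 ≤ 2 * N + 1 by omega))
    have hm₃ := h₃.trans (Nat.mul_le_mul_right (tChain N) (show nodes c₂ + 1 ≤ 2 * N + 1 by omega))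
    obtain ⟨t₄, h₄, e₄⟩ := append_spec (encodeList encItem)
      ((chain Q 0 c₁).1 :: (chain Q 0 c₁).2) ((chain Q 0 c₂).1 :: (chain Q 0 c₂).2)
    rw [List.length_cons] at h₄
    simp only [encF_cons, encT_mk] at e₁
    simp only [encTours] at e₂ e₃
    simp only [encodeList_cons, List.cons_append] at e₄
    simp only [bFindHere, kids_mk, List.cons_append, encodeList_cons, ↓run_rules, ↓val_rules, ↓e₁,
      ↓e₂, ↓e₃, ↓e₄]
    simp only [true_and]
    omega

def tFind (N : ℕ) : ℕ := tFindHere N + 100 * N + 300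

lemma find_run {Q x N : ℕ} {F : List TBranch} (h : Bdd Q N F) :
    Spec prog fFind (.pair (.num Q) (.pair (.num x) (encF F)))
      (encodeList (encodeList encItem) (find Q x F)) (nodes F * tFind N + 10) := by
  induction F using forest_induction generalizing x with
  | nil =>
    refine .of_run (show _ = some bFind from rfl) ?_
    simp only [bFind, find, encF_nil, encodeList_nil, ↓run_rules, ↓val_rules]
    simp
  | cons l I cs r ih₁ ih₂ =>
    have hT : tFind N = tFindHere N + 100 * N + 300 := rfl
    obtain ⟨t₁, h₁, e₁⟩ := ih₂ (x := x) h.tail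
    refine .of_run (show _ = some bFind from rfl) ?_
    simp only [nodes_mk, Nat.add_mul _ _ (tFind N), one_mul]
    rcases cs with _ | ⟨c, cs⟩
    · obtain ⟨t₂, h₂, e₂⟩ := amount_spec I
      have hI := h.its_le
      rw [its_mk] at hI
      by_cases hle : Q ≤ amount I
      · simp only [bFind, find, if_pos hle, encodeList_cons, encodeList_nil, encF_cons, encF_nil,
          encT_mk, ↓run_rules, ↓val_rules, ↓e₁, ↓e₂, ↓caseLe_of_le hle]
        simp only [true_and]
        omega
      · simp only [bFind, find, if_neg hle, encodeList_cons, encodeList_nil, encF_cons, encF_nil,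
          encT_mk, ↓run_rules, ↓val_rules, ↓e₁, ↓e₂, ↓caseLe_of_lt (not_le.1 hle)]
        simp only [true_and]
        omega
    · obtain ⟨t₂, h₂, e₂⟩ := ih₁ (x := x + l) h.kids
      obtain ⟨t₃, h₃, e₃⟩ := findHere_run (x := x + l) h.kids
      simp only [kids_mk, encF_cons] at e₂ e₃
      rw [find]
      cases hf : find Q (x + l) (c :: cs) with
      | cons t ts =>
        simp only [hf, encodeList_cons] at e₂
        simp only [bFind, encodeList_cons, encF_cons, encT_mk, ↓run_rules, ↓val_rules, ↓e₂]
        simp only [true_and]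
        omega
      | nil =>
        simp only [hf, encodeList_nil] at e₂
        cases hg : findHere Q (x + l) (c :: cs) with
        | cons t ts =>
          simp only [hg, encodeList_cons] at e₃
          simp only [bFind, encodeList_cons, encF_cons, encT_mk, ↓run_rules, ↓val_rules, ↓e₂, ↓e₃]
          simp only [true_and]
          omega
        | nil =>
          simp only [hg, encodeList_nil] at e₃
          simp only [bFind, encF_cons, encT_mk, ↓run_rules, ↓val_rules, ↓e₁, ↓e₂, ↓e₃]
          simp only [true_and]
          omega

-- Running times of the walks and of the output

lemma eqVertex_spec (u v : Vertex) :
    Spec prog fEqVertex (.pair (encodeVertex u) (encodeVertex v)) (.num (if u = v then 1 else 0))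
      (u.length * 40 + 20) := by
  unfold encodeVertex
  induction u generalizing v with
  | nil =>
    refine .of_run (show _ = some bEqVertex from rfl) ?_
    rcases v with _ | ⟨j, v⟩ <;>
    · simp only [bEqVertex, encodeList_nil, encodeList_cons, ↓run_rules, ↓val_rules]
      simp
  | cons i u ih =>
    refine .of_run (show _ = some bEqVertex from rfl) ?_
    rcases v with _ | ⟨j, v⟩
    · simp only [bEqVertex, encodeList_nil, encodeList_cons, ↓run_rules, ↓val_rules]
      simp
    · obtain ⟨t₁, h₁, e₁⟩ := ih v
      rcases lt_trichotomy i j with hij | rfl | hij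
      · simp only [bEqVertex, encodeList_nil, encodeList_cons, ↓run_rules, ↓val_rules,
          ↓caseLe_of_le hij.le, ↓caseLe_of_lt hij]
        simp [hij.ne]
        omega
      · simp only [bEqVertex, encodeList_nil, encodeList_cons, ↓run_rules, ↓val_rules,
          ↓caseLe_of_le le_rfl, ↓e₁]
        simp
        omega
      · simp only [bEqVertex, encodeList_nil, encodeList_cons, ↓run_rules, ↓val_rules,
          ↓caseLe_of_lt hij]
        simp [hij.ne']

lemma mem_spec (u : Vertex) (S : List Item) :
    Spec prog fMem (.pair (encodeVertex u) (encodeList encItem S))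
      (.num (if u ∈ S.map Prod.fst then 1 else 0)) (S.length * (u.length * 40 + 60) + 10) := by
  induction S with
  | nil =>
    refine .of_run (show _ = some bMem from rfl) ?_
    simp only [bMem, encodeList_nil, ↓run_rules, ↓val_rules]
    simp
  | cons x S ih =>
    obtain ⟨t₁, h₁, e₁⟩ := ih
    obtain ⟨t₂, h₂, e₂⟩ := eqVertex_spec u x.1
    refine .of_run (show _ = some bMem from rfl) ?_
    by_cases hx : u = x.1
    · rw [if_pos hx] at e₂
      have hm : u ∈ (x :: S).map Prod.fst := by simp [hx]
      simp only [bMem, if_pos hm, encodeList_cons, encItem, ↓run_rules, ↓val_rules, ↓e₂,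
        ↓caseLe_of_le le_rfl]
      simp only [List.length_cons, Nat.add_mul S.length 1, true_and]
      omega
    · rw [if_neg hx] at e₂
      have hm : u ∈ (x :: S).map Prod.fst ↔ u ∈ S.map Prod.fst := by simp [hx]
      simp only [bMem, hm, encodeList_cons, encItem, ↓run_rules, ↓val_rules, ↓e₂,
        ↓caseLe_of_lt zero_lt_one, ↓e₁]
      simp only [List.length_cons, Nat.add_mul S.length 1, true_and]
      omega

lemma walk_length_le (S : List Item) (bs : List Branch) (u : Vertex) (i : ℕ) :
    (walk S u i bs).length ≤ 2 * nodes (initF u i bs) := by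
  induction bs using branch_induction generalizing u i with
  | nil => simp [walk]
  | leaf l d r ih =>
    have := ih u (i + 1)
    rw [walk, initF, nodes_mk]
    split_ifs
    · simp only [List.length_cons]
      omega
    · omega
  | node l d c cs r ih1 ih2 =>
    have h1 := ih1 (u ++ [i]) 0
    have h2 := ih2 u (i + 1)
    rw [walk, initF, nodes_mk]
    split
    · omega
    · rename_i hw
      rw [hw] at h1
      simp only [List.length_cons, List.length_append] at h1 ⊢
      omega

/-- Bound on the number of steps for one vertex in a walk; `M` bounds the number of items. -/
def tWalk (L M : ℕ) : ℕ := M * (L * 40 + 60) + 100 * L + 200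

lemma walk_spec (L M : ℕ) (S : List Item) (hM : S.length ≤ M) (bs : List Branch) (u : Vertex)
    (i : ℕ) (hL : u.length + nodes (initF u i bs) ≤ L) :
    Spec prog fWalk (.pair (encodeList encItem S) (.pair (encodeVertex u)
        (.pair (.num i) (encodeBranches bs)))) (encodeList encodeVertex (walk S u i bs))
      (nodes (initF u i bs) * tWalk L M + 10) := by
  have hT : tWalk L M = M * (L * 40 + 60) + 100 * L + 200 := rfl
  induction bs using branch_induction generalizing u i with
  | nil =>
    refine .of_run (show _ = some bWalk from rfl) ?_
    simp only [bWalk, walk, encodeList_nil, encodeBranches_nil, ↓run_rules, ↓val_rules]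
    simp
  | leaf l d r ih =>
    simp only [initF, nodes_mk, nodes_nil] at hL
    obtain ⟨t₁, h₁, e₁⟩ := ih u (i + 1) (by omega)
    obtain ⟨t₂, h₂, e₂⟩ := append_spec Val.num u [i]
    obtain ⟨t₃, h₃, e₃⟩ := mem_spec (u ++ [i]) S
    rw [encodeList_cons, encodeList_nil] at e₂
    have h₃' : S.length * ((u ++ [i]).length * 40 + 60) ≤ M * (L * 40 + 60) := by
      apply Nat.mul_le_mul hM
      simp only [List.length_append, List.length_cons, List.length_nil]
      omega
    refine .of_run (show _ = some bWalk from rfl) ?_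
    simp only [initF, nodes_mk, nodes_nil, Nat.add_mul _ _ (tWalk L M), one_mul, zero_mul]
    rw [walk]
    simp only [encodeVertex] at e₁ e₃
    by_cases hm : u ++ [i] ∈ S.map Prod.fst
    · rw [if_pos hm] at e₃ ⊢
      simp only [bWalk, encodeList_cons, encodeVertex, encodeBranches_nil, encodeBranches_cons,
        ↓run_rules, ↓val_rules, ↓e₁, ↓e₂, ↓e₃, ↓caseLe_of_le le_rfl]
      simp only [true_and]
      omega
    · rw [if_neg hm] at e₃ ⊢
      simp only [bWalk, encodeList_cons, encodeVertex, encodeBranches_nil, encodeBranches_cons,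
        ↓run_rules, ↓val_rules, ↓e₁, ↓e₂, ↓e₃, ↓caseLe_of_lt zero_lt_one]
      simp only [true_and]
      omega
  | node l d c cs r ih1 ih2 =>
    simp only [initF, nodes_mk] at hL
    obtain ⟨t₁, h₁, e₁⟩ := ih2 u (i + 1) (by omega)
    obtain ⟨t₂, h₂, e₂⟩ := append_spec Val.num u [i]
    obtain ⟨t₃, h₃, e₃⟩ := ih1 (u ++ [i]) 0 (by simp; omega)
    obtain ⟨t₄, h₄, e₄⟩ := append_spec (encodeList Val.num) (walk S (u ++ [i]) 0 (c :: cs))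
      (u :: walk S u (i + 1) r)
    have hw := walk_length_le S (c :: cs) (u ++ [i]) 0
    rw [encodeList_cons, encodeList_nil] at e₂
    rw [encodeList_cons] at e₄
    rcases c with ⟨lc, dc, kc⟩
    rw [encodeBranches_cons] at e₃
    refine .of_run (show _ = some bWalk from rfl) ?_
    simp only [initF, nodes_mk, Nat.add_mul _ _ (tWalk L M), one_mul]
    rw [walk]
    have hv : encodeVertex = encodeList Val.num := rfl
    simp only [hv] at e₁ e₃ ⊢
    cases hw' : walk S (u ++ [i]) 0 (.mk lc dc kc :: cs) with
    | nil =>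
      simp only [hw', encodeList_nil] at e₃
      simp only [bWalk, encodeBranches_cons, ↓run_rules, ↓val_rules, ↓e₁, ↓e₂, ↓e₃]
      simp only [true_and]
      omega
    | cons w ws =>
      simp only [hw', encodeList_cons, List.cons_append] at e₃ e₄
      simp only [bWalk, encodeBranches_cons, encodeList_cons, List.cons_append, ↓run_rules,
        ↓val_rules, ↓e₁, ↓e₂, ↓e₃, ↓e₄]
      simp only [true_and]
      omega

lemma erase_spec {Q N : ℕ} {F : List TBranch} (h : Bdd Q N F) :
    Spec prog fErase (encF F) (encodeBranches (F.map erase)) (nodes F * (10 * N + 60) + 10) := by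
  induction F using forest_induction with
  | nil =>
    refine .of_run (show _ = some bErase from rfl) ?_
    simp only [bErase, encF_nil, List.map_nil, encodeBranches_nil, ↓run_rules, ↓val_rules]
    simp
  | cons l I cs r ih₁ ih₂ =>
    obtain ⟨t₁, h₁, e₁⟩ := ih₁ h.kids
    obtain ⟨t₂, h₂, e₂⟩ := ih₂ h.tail
    obtain ⟨t₃, h₃, e₃⟩ := amount_spec I
    have hI := h.its_le
    rw [its_mk] at hI
    refine .of_run (show _ = some bErase from rfl) ?_
    simp only [bErase, encF_cons, encT_mk, List.map_cons, erase_mk, encodeBranches_cons,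
      ↓run_rules, ↓val_rules, ↓e₁, ↓e₂, ↓e₃]
    simp only [nodes_mk, Nat.add_mul _ _ (10 * N + 60), one_mul, true_and]
    omega

lemma tours_spec {L M : ℕ} {bs : List Branch} (hL : nodes (initF [] 0 bs) ≤ L)
    (ts : List (List Item)) (hM : ∀ t ∈ ts, t.length ≤ M) :
    Spec prog fTours (.pair (encodeBranches bs) (encodeList (encodeList encItem) ts))
      (encodeList Tour.encode (ts.map fun t => ⟨[] :: walk t [] 0 bs, t⟩))
      (ts.length * (L * tWalk L M + 60) + 10) := by
  induction ts with
  | nil =>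
    refine .of_run (show _ = some bTours from rfl) ?_
    simp only [bTours, encodeList_nil, List.map_nil, ↓run_rules, ↓val_rules]
    simp
  | cons t ts ih =>
    simp only [List.mem_cons, forall_eq_or_imp] at hM
    obtain ⟨t₁, h₁, e₁⟩ := ih hM.2
    obtain ⟨t₂, h₂, e₂⟩ := walk_spec L M t hM.1 bs [] 0 (by simpa)
    have h₂' := h₂.trans (Nat.add_le_add_right (Nat.mul_le_mul_right _ hL) _)
    have hv : encodeVertex [] = .num 0 := encodeList_nil _
    have ht : (Tour.encode ⟨[] :: walk t [] 0 bs, t⟩) =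
        .pair (.pair (.num 0) (encodeList encodeVertex (walk t [] 0 bs)))
          (encodeList encItem t) := by
      rw [Tour.encode, encodeList_cons, hv]
      rfl
    rw [hv] at e₂
    refine .of_run (show _ = some bTours from rfl) ?_
    simp only [bTours, encodeList_cons, List.map_cons, ht, ↓run_rules, ↓val_rules, ↓e₁, ↓e₂]
    simp only [List.length_cons, Nat.add_mul ts.length, one_mul, true_and]
    omega

-- Running time of the whole program

lemma collect_initF_length_le (bs : List Branch) (u : Vertex) (i : ℕ) :
    (collect (initF u i bs)).length ≤ nodes (initF u i bs) := by
  induction bs using branch_induction generalizing u i with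
  | nil => simp [initF]
  | leaf l d r ih =>
    have := ih u (i + 1)
    simp [initF, nodes_mk, nodes_nil]
    omega
  | node l d c cs r ih1 ih2 =>
    have h1 := ih1 (u ++ [i]) 0
    have h2 := ih2 u (i + 1)
    simp only [initF, nodes_mk, collect_cons, items_mk, List.nil_append, List.length_append]
    omega

/-- A leaf holds at most one load. Hence the traffics are bounded by the number of vertices, as
needed for division by subtraction. -/
lemma amount_le_of_leafOK {Q : ℕ} {F : List TBranch} (h : AllSub (LeafOK Q) F) :
    amount (collect F) ≤ Q * nodes F := by
  induction F using forest_induction with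
  | nil => simp
  | cons l I cs r ih₁ ih₂ =>
    simp only [AllSub_cons, kids_mk] at h
    have h1 := ih₁ h.2.1
    have h2 := ih₂ h.2.2
    simp only [nodes_mk, collect_cons, items_mk, amount_append, Nat.mul_add, mul_one]
    by_cases hcs : cs = []
    · have := (h.1.1 hcs).2
      simp only [its_mk] at this
      omega
    · have := h.1.2 hcs
      simp only [its_mk] at this
      simp only [this, amount_nil]
      omega

section
variable {Q N : ℕ} {bs : List Branch}

lemma initF_bounds (h : DemandAtLeaves Q bs) (hN : nodes (initF [] 0 bs) ≤ N) :
    (collect (initF [] 0 bs)).length ≤ N ∧ amount (collect (initF [] 0 bs)) ≤ Q * N :=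
  ⟨(collect_initF_length_le _ _ _).trans hN,
    (amount_le_of_leafOK (leafOK_initF h _ _)).trans (Nat.mul_le_mul_left _ hN)⟩

lemma resultTree_good (hQ : 0 < Q) (h : DemandAtLeaves Q bs) (hN : nodes (initF [] 0 bs) ≤ N) :
    Good Q N (resultTree Q bs) := by
  obtain ⟨h1, h2⟩ := initF_bounds h hN
  have hp := resultTree_collect hQ h
  exact ⟨resultTree_leafOK hQ h, resultTree_nodeOK hQ h, hp.length_eq ▸ h1, hp.amount_eq ▸ h2⟩

lemma length_le_flatten {α : Type*} {ts : List (List α)} {t : List α} (h : t ∈ ts) :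
    t.length ≤ ts.flatten.length := by
  rw [List.length_flatten]
  exact List.single_le_sum (by simp) _ (List.mem_map_of_mem h)

lemma length_le_length_flatten {α : Type*} {ts : List (List α)} (h : ∀ t ∈ ts, t ≠ []) :
    ts.length ≤ ts.flatten.length := by
  induction ts with
  | nil => simp
  | cons t ts ih =>
    simp only [List.mem_cons, forall_eq_or_imp] at h
    have := ih h.2
    have := List.length_pos_iff.2 h.1
    simp only [List.length_cons, List.flatten_cons, List.length_append]
    omega

/-- Bounds on the tours that are found. -/
lemma find_bounds (hQ : 0 < Q) (h : DemandAtLeaves Q bs) (hN : nodes (initF [] 0 bs) ≤ N) :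
    (find Q 0 (resultTree Q bs)).length ≤ 3 * N ∧ ∀ t ∈ find Q 0 (resultTree Q bs),
      t.length ≤ 3 * N ∧ amount t ≤ Q ∧ Within t (collect (resultTree Q bs)) := by
  by_cases hf : find Q 0 (resultTree Q bs) = []
  · simp [hf]
  have hs := (find_spec hQ _ 0 (resultTree_leafOK hQ h) (resultTree_nodeOK hQ h)
    (resultTree_nodup hQ h)).1 hf
  have hl := (resultTree_good hQ h hN).length_le
  have := hs.length_le
  refine ⟨(length_le_length_flatten fun t ht h0 => ?_).trans (by omega), fun t ht =>
    ⟨(length_le_flatten ht).trans (by omega), (hs.cap t ht).2, hs.sub t ht⟩⟩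
  have := (hs.cap t ht).1
  simp [h0] at this

def tMain (N : ℕ) : ℕ :=
  N * (20 * N + 100) + N * tSimplify N + tNormAll N + 2 * N * (10 * N + 60) + 2 * N * tFind N +
    3 * N * (N * tWalk N (3 * N) + 60) + 200

theorem main_spec (hQ : 0 < Q) (h : DemandAtLeaves Q bs) (hN : nodes (initF [] 0 bs) ≤ N) :
    Spec prog fMain (encodeInstance Q bs)
      (encodeOutput ((resultTree Q bs).map erase) (resultTours Q bs)) (tMain N) := by
  obtain ⟨b1, b2⟩ := initF_bounds h hN
  have hg := resultTree_good hQ h hN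
  obtain ⟨f1, f2⟩ := find_bounds hQ h hN
  obtain ⟨t₁, h₁, e₁⟩ := init_spec N bs [] 0 (by simpa)
  obtain ⟨t₂, h₂, e₂⟩ := simplify_spec hQ (leafOK_initF h [] 0) b1 b2
  obtain ⟨t₃, h₃, e₃⟩ := normAll_spec hQ _ _ (simplify_good hQ (leafOK_initF h [] 0) b1 b2)
  obtain ⟨t₄, h₄, e₄⟩ := erase_spec hg.bdd
  obtain ⟨t₅, h₅, e₅⟩ := find_run (x := 0) hg.bdd
  obtain ⟨t₆, h₆, e₆⟩ := tours_spec hN (find Q 0 (resultTree Q bs)) fun t ht => (f2 t ht).1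
  replace h₁ := h₁.trans (Nat.add_le_add_right (Nat.mul_le_mul_right _ hN) _)
  replace h₂ := h₂.trans (Nat.add_le_add_right (Nat.mul_le_mul_right _ hN) _)
  replace h₄ := h₄.trans (Nat.add_le_add_right (Nat.mul_le_mul_right _ hg.bdd.nodes_le) _)
  replace h₅ := h₅.trans (Nat.add_le_add_right (Nat.mul_le_mul_right _ hg.bdd.nodes_le) _)
  replace h₆ := h₆.trans (Nat.add_le_add_right (Nat.mul_le_mul_right _ f1) _)
  have hv : encodeVertex [] = .num 0 := encodeList_nil _
  rw [hv] at e₁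
  rw [encPair] at e₂
  -- The normalization of the simplified list is `resultTree` by definition.
  change ∀ K, Call prog fNormAll _ K ↔ K (encF (resultTree Q bs)) t₃ at e₃
  refine .of_run (show _ = some bMain from rfl) ?_
  simp only [bMain, encodeInstance, encodeOutput, resultTours, ↓run_rules, ↓val_rules, ↓e₁, ↓e₂,
    ↓e₃, ↓e₄, ↓e₅, ↓e₆]
  simp only [true_and]
  unfold tMain
  omega

end

/-! ## Sizes -/

/-- The sum of all numbers in a value. -/
def Val.sum : Val → ℕ
  | .num n => n
  | .pair x y => x.sum + y.sum

lemma Val.sum_lt (v : Val) : v.sum < 2 ^ v.size := by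
  induction v with
  | num n =>
    exact (Nat.lt_size_self n).trans_le (Nat.pow_le_pow_right two_pos (by simp [Val.size]))
  | pair x y ih₁ ih₂ =>
    have h1 := Nat.pow_le_pow_right two_pos (Nat.le_add_right x.size y.size)
    have h2 := Nat.pow_le_pow_right two_pos (Nat.le_add_left y.size x.size)
    rw [Val.sum, Val.size, add_assoc, pow_add, pow_one]
    omega

lemma nodes_initF_le (bs : List Branch) (u : Vertex) (i : ℕ) :
    nodes (initF u i bs) ≤ (encodeBranches bs).size := by
  induction bs using branch_induction generalizing u i with
  | nil => simp [initF, nodes_nil]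
  | leaf l d r ih =>
    have := ih u (i + 1)
    simp only [initF, nodes_mk, nodes_nil, encodeBranches_cons, Val.size]
    omega
  | node l d c cs r ih1 ih2 =>
    have h1 := ih1 (u ++ [i]) 0
    have h2 := ih2 u (i + 1)
    rw [initF, nodes_mk, encodeBranches_cons]
    simp only [Val.size]
    omega

lemma sum_initF_le (bs : List Branch) (u : Vertex) (i : ℕ) :
    totLen (initF u i bs) + amount (collect (initF u i bs)) ≤ (encodeBranches bs).sum := by
  induction bs using branch_induction generalizing u i with
  | nil => simp [initF]
  | leaf l d r ih =>
    have := ih u (i + 1)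
    simp only [initF, totLen, collect_cons, collect_nil, items_mk, amount_append, amount_cons,
      amount_nil, encodeBranches_cons, Val.sum]
    omega
  | node l d c cs r ih1 ih2 =>
    have h1 := ih1 (u ++ [i]) 0
    have h2 := ih2 u (i + 1)
    rw [initF, encodeBranches_cons]
    simp only [totLen, collect_cons, items_mk, amount_append, amount_nil, Val.sum]
    omega

lemma size_encodeList_le {α : Type} {enc : α → Val} {B : ℕ} {l : List α}
    (h : ∀ x ∈ l, (enc x).size ≤ B) : (encodeList enc l).size ≤ l.length * (B + 1) + 1 := by
  induction l with
  | nil => simp [encodeList_nil, Val.size]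
  | cons x l ih =>
    simp only [List.mem_cons, forall_eq_or_imp] at h
    have := ih h.2
    rw [encodeList_cons, Val.size, List.length_cons, Nat.add_mul l.length]
    omega

lemma size_erase_le {K : ℕ} {F : List TBranch} (h1 : totLen F < 2 ^ K)
    (h2 : amount (collect F) < 2 ^ K) :
    (encodeBranches (F.map erase)).size ≤ nodes F * (2 * K + 6) + 1 := by
  induction F using forest_induction with
  | nil => simp [encodeBranches_nil, Val.size]
  | cons l I cs r ih₁ ih₂ =>
    simp only [totLen, collect_cons, items_mk, amount_append] at h1 h2
    have a1 := ih₁ (by omega) (by omega)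
    have a2 := ih₂ (by omega) (by omega)
    have a3 : Nat.size l ≤ K := Nat.size_le.2 (by omega)
    have a4 : Nat.size (amount I) ≤ K := Nat.size_le.2 (by omega)
    rw [List.map_cons, erase_mk, encodeBranches_cons, nodes_mk]
    simp only [Val.size, Nat.add_mul _ _ (2 * K + 6), one_mul]
    omega

/-- Bounds on the length and on the entries of an address. -/
def Short (L : ℕ) (v : Vertex) : Prop := v.length ≤ L ∧ ∀ j ∈ v, j ≤ L

def sVertex (L : ℕ) : ℕ := L * (L + 2) + 1

lemma Short.size_le {L : ℕ} {v : Vertex} (h : Short L v) : (encodeVertex v).size ≤ sVertex L := by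
  refine (size_encodeList_le (B := L + 1) fun j hj => ?_).trans
    (Nat.add_le_add_right (Nat.mul_le_mul_right _ h.1) _)
  have : Nat.size j ≤ j := Nat.size_le.2 Nat.lt_two_pow_self
  have := h.2 j hj
  rw [Val.size]
  omega

lemma Short.snoc {L i : ℕ} {u : Vertex} (h : ∀ j ∈ u, j ≤ L) (hu : u.length + 1 ≤ L) (hi : i ≤ L) :
    Short L (u ++ [i]) := by
  refine ⟨by simpa using hu, fun j hj => ?_⟩
  rcases List.mem_append.1 hj with hj | hj
  · exact h j hj
  · simp only [List.mem_singleton] at hj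
    omega

/-- Going down a level or on to the next sibling uses up a vertex, so both the length and the
entries of an address are bounded by the number of vertices. -/
lemma short_initF {L : ℕ} (bs : List Branch) (u : Vertex) (i : ℕ) (hu : ∀ j ∈ u, j ≤ L)
    (h1 : u.length + nodes (initF u i bs) ≤ L) (h2 : i + nodes (initF u i bs) ≤ L) :
    ∀ x ∈ collect (initF u i bs), Short L x.1 := by
  induction bs using branch_induction generalizing u i with
  | nil => simp [initF]
  | leaf l d r ih =>
    simp only [initF, nodes_mk, nodes_nil] at h1 h2
    have := ih u (i + 1) hu (by omega) (by omega)
    simp only [initF, collect_cons, items_mk, collect_nil, List.append_nil, List.singleton_append,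
      List.mem_cons, forall_eq_or_imp]
    exact ⟨.snoc hu (by omega) (by omega), this⟩
  | node l d c cs r ih1 ih2 =>
    simp only [initF, nodes_mk] at h1 h2
    have h := ih2 u (i + 1) hu (by omega) (by omega)
    have h' := ih1 (u ++ [i]) 0 (Short.snoc hu (by omega) (by omega)).2 (by simp; omega) (by omega)
    rw [initF]
    simp only [collect_cons, items_mk, List.nil_append, List.mem_append] at h' ⊢
    rintro x (hx | hx)
    · exact h' x hx
    · exact h x hx

lemma short_walk {L : ℕ} (S : List Item) (bs : List Branch) (u : Vertex) (i : ℕ)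
    (hu : ∀ j ∈ u, j ≤ L) (h1 : u.length + nodes (initF u i bs) ≤ L)
    (h2 : i + nodes (initF u i bs) ≤ L) : ∀ v ∈ walk S u i bs, Short L v := by
  induction bs using branch_induction generalizing u i with
  | nil => simp [walk]
  | leaf l d r ih =>
    simp only [initF, nodes_mk, nodes_nil] at h1 h2
    have := ih u (i + 1) hu (by omega) (by omega)
    rw [walk]
    split_ifs
    · simp only [List.mem_cons, forall_eq_or_imp]
      exact ⟨.snoc hu (by omega) (by omega), ⟨by omega, hu⟩, this⟩
    · exact this
  | node l d c cs r ih1 ih2 =>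
    simp only [initF, nodes_mk] at h1 h2
    have h := ih2 u (i + 1) hu (by omega) (by omega)
    have hs : Short L (u ++ [i]) := .snoc hu (by omega) (by omega)
    have h' := ih1 (u ++ [i]) 0 hs.2 (by simp; omega) (by omega)
    rw [walk]
    split
    · exact h
    · rename_i w ws hw
      rw [hw] at h'
      intro v hv
      rcases List.mem_cons.1 hv with rfl | hv
      · exact hs
      rcases List.mem_append.1 hv with hv | hv
      · exact h' v hv
      rcases List.mem_cons.1 hv with hv | hv
      · exact hv ▸ ⟨by omega, hu⟩
      · exact h v hv

def sTour (S : ℕ) : ℕ :=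
  1 + ((2 * S + 1) * (sVertex S + 1) + 1) + (3 * S * (1 + sVertex S + (1 + S) + 1) + 1)

def sOutput (S : ℕ) : ℕ :=
  1 + (2 * S * (2 * (2 * S) + 6) + 1) + (3 * S * (sTour S + 1) + 1)

section
variable {Q : ℕ} {bs : List Branch}

lemma ceilDiv_le_self (hQ : 0 < Q) (n : ℕ) : n ⌈/⌉ Q ≤ n :=
  (ceilDiv_le_iff_le_mul hQ).2 (Nat.le_mul_of_pos_left _ hQ)

/-- Deleting vertices copies the lengths of their stems, so the total length may grow. It is at most
half the lower bound, which does not grow and is at most the total length of the input times the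
traffic of its whole demand. Both factors are below `2 ^ size`, which explains the factor two in the
exponent. -/
lemma resultTree_sizes (hQ : 0 < Q) (h : DemandAtLeaves Q bs) :
    totLen (resultTree Q bs) < 2 ^ (2 * (encodeInstance Q bs).size) ∧
    amount (collect (resultTree Q bs)) < 2 ^ (2 * (encodeInstance Q bs).size) := by
  have hs := (encodeInstance Q bs).sum_lt
  have h0 := sum_initF_le bs [] 0
  have hsum : (encodeInstance Q bs).sum = Q + (encodeBranches bs).sum := rfl
  have hl := leafOK_initF h [] 0
  rw [← (resultTree_collect hQ h).amount_eq]
  have h1 : totLen (resultTree Q bs) ≤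
      totLen (initF [] 0 bs) * amount (collect (initF [] 0 bs)) :=
    calc totLen (resultTree Q bs)
        ≤ cost (· ⌈/⌉ Q) Prod.snd (resultTree Q bs) := totLen_le_cost hQ (resultTree_leafOK hQ h)
      _ ≤ cost (· ⌈/⌉ Q) Prod.snd (initF [] 0 bs) := steps_cost_snd_le hQ (resultTree_steps hQ h) hl
      _ ≤ totLen (initF [] 0 bs) * (amount (collect (initF [] 0 bs)) ⌈/⌉ Q) :=
          cost_le_totLen (subadd_ceilDiv hQ) _ _
      _ ≤ _ := Nat.mul_le_mul_left _ (ceilDiv_le_self hQ _)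
  constructor
  · refine h1.trans_lt ?_
    rw [two_mul, pow_add]
    exact Nat.mul_lt_mul'' (by omega) (by omega)
  · exact lt_of_lt_of_le (by omega : _ < 2 ^ (encodeInstance Q bs).size)
      (Nat.pow_le_pow_right two_pos (by omega))

theorem output_size_le (hQ : 0 < Q) (h : DemandAtLeaves Q bs) {S : ℕ}
    (hS : (encodeInstance Q bs).size = S) :
    (encodeOutput ((resultTree Q bs).map erase) (resultTours Q bs)).size ≤ sOutput S := by
  have hsz : (encodeInstance Q bs).size = 1 + (1 + Nat.size Q) + (encodeBranches bs).size := rfl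
  have hN : nodes (initF [] 0 bs) ≤ S := (nodes_initF_le bs [] 0).trans (by omega)
  have hg := resultTree_good hQ h hN
  obtain ⟨f1, f2⟩ := find_bounds hQ h hN
  obtain ⟨z1, z2⟩ := resultTree_sizes hQ h
  rw [hS] at z1 z2
  have hb := (size_erase_le z1 z2).trans
    (Nat.add_le_add_right (Nat.mul_le_mul_right _ hg.bdd.nodes_le) _)
  have ht : ∀ t ∈ resultTours Q bs, t.encode.size ≤ sTour S := by
    intro t ht
    obtain ⟨I, hI, rfl⟩ := List.mem_map.1 ht
    obtain ⟨g1, g2, g3⟩ := f2 I hI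
    rw [Tour.encode, Val.size]
    unfold sTour
    refine Nat.add_le_add (Nat.add_le_add_left ?_ _) ?_
    · refine (size_encodeList_le (B := sVertex S) fun v hv => ?_).trans
        (Nat.add_le_add_right (Nat.mul_le_mul_right _ ?_) _)
      · apply Short.size_le
        rcases List.mem_cons.1 hv with rfl | hv
        · simp [Short]
        · exact short_walk I bs [] 0 (by simp) (by simpa) (by simpa) v hv
      · have := walk_length_le I bs [] 0
        rw [List.length_cons]
        omega
    · refine (size_encodeList_le (B := 1 + sVertex S + (1 + S)) fun x hx => ?_).trans
        (Nat.add_le_add_right (Nat.mul_le_mul_right _ g1) _)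
      obtain ⟨y, hy, hyx⟩ := List.mem_map.1 (g3 x hx)
      have h1 := (short_initF bs [] 0 (by simp) (by simpa) (by simpa) y
        ((resultTree_collect hQ h).mem_iff.2 hy)).size_le
      rw [hyx] at h1
      have h2 : x.2 ≤ amount I := List.single_le_sum (by simp) _ (List.mem_map_of_mem hx)
      have h3 := Nat.size_le_size (h2.trans g2)
      simp only [Val.size]
      omega
  have htl := (size_encodeList_le ht).trans (Nat.add_le_add_right (Nat.mul_le_mul_right _
    (show (resultTours Q bs).length ≤ 3 * S by simpa [resultTours] using f1)) _)
  rw [encodeOutput, Val.size]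
  unfold sOutput
  omega

end

/-! ## Polynomial bounds -/

/-- The function is given by a polynomial. -/
def IsPoly (f : ℕ → ℕ) : Prop := ∃ p : Polynomial ℕ, ∀ n, f n = p.eval n

namespace IsPoly
variable {f g : ℕ → ℕ}

lemma const (c : ℕ) : IsPoly fun _ => c := ⟨.C c, by simp⟩

lemma id : IsPoly fun n => n := ⟨.X, by simp⟩

lemma add (hf : IsPoly f) (hg : IsPoly g) : IsPoly fun n => f n + g n := by
  obtain ⟨p, hp⟩ := hf
  obtain ⟨q, hq⟩ := hg
  exact ⟨p + q, by simp [hp, hq]⟩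

lemma mul (hf : IsPoly f) (hg : IsPoly g) : IsPoly fun n => f n * g n := by
  obtain ⟨p, hp⟩ := hf
  obtain ⟨q, hq⟩ := hg
  exact ⟨p * q, by simp [hp, hq]⟩

end IsPoly

lemma isPoly_tCollect : IsPoly tCollect := by
  unfold tCollect
  repeat' with_reducible first
    | assumption
    | exact .const _
    | exact .id
    | refine .add ?_ ?_
    | refine .mul ?_ ?_

lemma isPoly_tTraffic : IsPoly tTraffic := by
  have := isPoly_tCollect
  unfold tTraffic
  repeat' with_reducible first
    | assumption
    | exact .const _
    | exact .id
    | refine .add ?_ ?_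
    | refine .mul ?_ ?_

lemma isPoly_tTrafficSum : IsPoly tTrafficSum := by
  have := isPoly_tTraffic
  unfold tTrafficSum
  repeat' with_reducible first
    | assumption
    | exact .const _
    | exact .id
    | refine .add ?_ ?_
    | refine .mul ?_ ?_

lemma isPoly_tExtractMin : IsPoly tExtractMin := by
  unfold tExtractMin
  repeat' with_reducible first
    | assumption
    | exact .const _
    | exact .id
    | refine .add ?_ ?_
    | refine .mul ?_ ?_

lemma isPoly_tNormStep : IsPoly tNormStep := by
  have := isPoly_tExtractMin
  unfold tNormStep
  repeat' with_reducible first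
    | assumption
    | exact .const _
    | exact .id
    | refine .add ?_ ?_
    | refine .mul ?_ ?_

lemma isPoly_tNorm : IsPoly tNorm := by
  have := isPoly_tNormStep
  unfold tNorm
  repeat' with_reducible first
    | assumption
    | exact .const _
    | exact .id
    | refine .add ?_ ?_
    | refine .mul ?_ ?_

lemma isPoly_tNormAll : IsPoly tNormAll := by
  have := isPoly_tNorm
  unfold tNormAll
  repeat' with_reducible first
    | assumption
    | exact .const _
    | exact .id
    | refine .add ?_ ?_
    | refine .mul ?_ ?_

lemma isPoly_tExtractNode : IsPoly tExtractNode := by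
  have := isPoly_tTraffic
  unfold tExtractNode
  repeat' with_reducible first
    | assumption
    | exact .const _
    | exact .id
    | refine .add ?_ ?_
    | refine .mul ?_ ?_

lemma isPoly_tFinish : IsPoly tFinish := by
  have := isPoly_tCollect
  have := isPoly_tExtractNode
  have := isPoly_tNormAll
  have := isPoly_tTrafficSum
  unfold tFinish
  repeat' with_reducible first
    | assumption
    | exact .const _
    | exact .id
    | refine .add ?_ ?_
    | refine .mul ?_ ?_

lemma isPoly_tSimplify : IsPoly tSimplify := by
  have := isPoly_tNorm
  have := isPoly_tFinish
  unfold tSimplify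
  repeat' with_reducible first
    | assumption
    | exact .const _
    | exact .id
    | refine .add ?_ ?_
    | refine .mul ?_ ?_

lemma isPoly_tPart : IsPoly tPart := by
  unfold tPart
  repeat' with_reducible first
    | assumption
    | exact .const _
    | exact .id
    | refine .add ?_ ?_
    | refine .mul ?_ ?_

lemma isPoly_tChain : IsPoly tChain := by
  have := isPoly_tPart
  unfold tChain
  repeat' with_reducible first
    | assumption
    | exact .const _
    | exact .id
    | refine .add ?_ ?_
    | refine .mul ?_ ?_

lemma isPoly_tFindHere : IsPoly tFindHere := by
  have := isPoly_tPart
  have := isPoly_tChain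
  unfold tFindHere
  repeat' with_reducible first
    | assumption
    | exact .const _
    | exact .id
    | refine .add ?_ ?_
    | refine .mul ?_ ?_

lemma isPoly_tFind : IsPoly tFind := by
  have := isPoly_tFindHere
  unfold tFind
  repeat' with_reducible first
    | assumption
    | exact .const _
    | exact .id
    | refine .add ?_ ?_
    | refine .mul ?_ ?_

lemma isPoly_bound : IsPoly fun n => tMain n + 2 + sOutput n := by
  have := isPoly_tSimplify
  have := isPoly_tNormAll
  have := isPoly_tFind
  unfold tMain tWalk sOutput sTour sVertex
  repeat' with_reducible first
    | assumption
    | exact .const _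
    | exact .id
    | refine .add ?_ ?_
    | refine .mul ?_ ?_

end CVRP

theorem lemma6 :
    ∃ (P : CVRP.Program) (p : Polynomial ℕ),
      ∀ (Q : ℕ) (bs : List CVRP.Branch), 0 < Q → CVRP.DemandAtLeaves Q bs →
        ∃ (bs' : List CVRP.Branch) (ts : List CVRP.Tour) (t : ℕ),
          P.Computes (CVRP.encodeInstance Q bs) (CVRP.encodeOutput bs' ts) t ∧
          t + (CVRP.encodeOutput bs' ts).size ≤ p.eval (CVRP.encodeInstance Q bs).size ∧
          CVRP.Simplifies Q bs bs' ∧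
          (CVRP.IsApproxTourSet Q bs ts ∨
            (ts = [] ∧ CVRP.Simplified Q bs' ∧
              ∀ b ∈ bs', b.traffic Q = 1 ∨ ∃ p', CVRP.IsLongChain Q 0 p' b)) := by
  obtain ⟨p, hp⟩ := CVRP.isPoly_bound
  refine ⟨CVRP.prog, p, fun Q bs hQ h => ?_⟩
  have hN : CVRP.nodes (CVRP.initF [] 0 bs) ≤ (CVRP.encodeInstance Q bs).size :=
    (CVRP.nodes_initF_le bs [] 0).trans (Nat.le_add_left _ _)
  obtain ⟨t, ht, hc⟩ := (CVRP.main_spec hQ h hN).computes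
  have hs := CVRP.output_size_le hQ h rfl
  have hb : _ + 2 + _ = _ := hp (CVRP.encodeInstance Q bs).size
  exact ⟨_, _, t, hc, by omega, CVRP.result_simplifies hQ h, CVRP.result_spec hQ h⟩
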